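/- Let $n\ge 3$ and $\lambda>n-1$. For $z\in\mathbb C^n$ write $|z|^2=\sum_j|z_j|^2$, $z^\top z=\sum_j z_j^2$, $\Delta(z)=1-2|z|^2+|z^\top z|^2$, and let $D=D_n^{IV}=\{z\in\mathbb C^n:\ |z|<1,\ 2|z|^2<1+|z^\top z|^2\}$ be the Cartan domain of type IV. Let $v_\lambda$ be the probability measure on $D$ proportional to $\Delta(z)^{\lambda-n}\,dv(z)$, where $dv$ is Lebesgue measure; let $\mathcal A^2_\lambda(D)$ be the closed subspace of $L^2(D,v_\lambda)$ consisting of the holomorphic functions, $B_\lambda$ the orthogonal projection of $L^2(D,v_\lambda)$ onto it, and, for $a\in L^\infty(D)$, let $T_a=T^{(\lambda)}_a\in\mathcal B(\mathcal A^2_\lambda(D))$, $T_a(h)=B_\lambda(ah)$, be the Toeplitz operator with symbol $a$. Equip $D$ with the symplectic form $\omega=i\sum_{j,k}g_{jk}\,dz_j\wedge d\overline z_k$ of its Bergman metric, where $g_{jk}=\frac1{2n}\frac{\partial^2}{\partial z_j\partial\overline z_k}\log K(z,z)$ and $K(z,w)=\big(1-2z^\top\overline w+(z^\top z)\overline{(w^\top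 w)}\big)^{-n}$. Let $\mathrm{SO}(2)$, identified with the unit circle $\mathbb T$, act on $D$ by $(t,z)\mapsto tz$, and identify its Lie algebra and the dual of the latter with $\mathbb R$ so that $X\in\mathbb R$ has exponential $e^{iX}$ and induces the vector field $X^\sharp_z=\frac{d}{dr}\big|_{r=0}e^{irX}z$. A moment map for this action is a smooth function $\mu:D\to\mathbb R$ with $\mu(tz)=\mu(z)$ for all $t\in\mathbb T$, $z\in D$, and $d(X\mu)=\omega(X^\sharp,\cdot)$ for all $X\in\mathbb R$. For $k\in\mathbb N=\{0,1,2,\dots\}$ let $\mathcal H^{k}(\mathbb C^n)$ be the space of homogeneous holomorphic polynomials $p$ of degree $k$ on $\mathbb C^n$ with $\sum_j\partial^2p/\partial z_j^2=0$. Then the following hold. (0) The function $$\mu^{\mathrm{SO}(2)}(z)=\frac{|z^\top z|^2-|z|^2}{1+|z^\top z|^2-2|z|^2}$$ is a moment map for the $\mathrm{SO}(2)$-action on $D$. (1) There is a Hilbert direct sum decomposition $$\mathcal A^2_\lambda(D)=\bigoplus_{(k_1,k_2)\in\mathbb N^2}\mathcal H^{k_1}(\mathbb C^n)(z^\top z)^{k_2}.$$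 Moreover, for every moment map $\mu$ of the $\mathrm{SO}(2)$-action (in particular for $\mu=\mu^{\mathrm{SO}(2)}$): (2) The unital $C^*$-algebra generated by all Toeplitz operators $T^{(\lambda)}_a$ whose symbol $a\in L^\infty(D)$ is of the form $a=f\circ\mu$ almost everywhere, with $f:\mathbb R\to\mathbb C$ measurable, is commutative. (3) If $f:\mathbb R\to\mathbb C$ is measurable and $a=f\circ\mu$ is essentially bounded on $D$, then $T^{(\lambda)}_a$ maps each summand $\mathcal H^{k_1}(\mathbb C^n)(z^\top z)^{k_2}$ into itself, and there are complex numbers $c_{k_1,k_2}(f,\lambda)$, $(k_1,k_2)\in\mathbb N^2$, such that $T^{(\lambda)}_a$ acts on this summand as $c_{k_1,k_2}(f,\lambda)$ times the identity, for every $(k_1,k_2)\in\mathbb N^2$. -/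

import Mathlib

open MeasureTheory Set Filter Topology
open scoped ENNReal ComplexConjugate

noncomputable section

namespace CartanIV

/-! ## The domain and the weighted measures -/

/-- The bilinear product `zᵀ w` on `ℂⁿ`. -/
def dot {n : ℕ} (z w : Fin n → ℂ) : ℂ := ∑ j, z j * w j

/-- The square `|z|²` of the Euclidean norm on `ℂⁿ`. -/
def absSq {n : ℕ} (z : Fin n → ℂ) : ℝ := ∑ j, ‖z j‖ ^ 2

/-- The Cartan domain of type IV: all `z ∈ ℂⁿ` with `|z| < 1` and `2 |z|² < 1 + |zᵀ z|²`. -/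
def domain (n : ℕ) : Set (Fin n → ℂ) :=
  {z | absSq z < 1 ∧ 2 * absSq z < 1 + ‖dot z z‖ ^ 2}

/-- `Δ(z) = 1 - 2 |z|² + |zᵀ z|²`. -/
def Delta {n : ℕ} (z : Fin n → ℂ) : ℝ := 1 - 2 * absSq z + ‖dot z z‖ ^ 2

/-- The measure `Δ(z)^(λ - n) dv(z)` on the domain, `dv` being Lebesgue measure on `ℂⁿ = ℝ²ⁿ`. -/
def weightedMeasure (n : ℕ) (lam : ℝ) : Measure (Fin n → ℂ) :=
  (volume.restrict (domain n)).withDensity fun z => ENNReal.ofReal (Delta z ^ (lam - n))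

/-- The measure `v_λ`: the previous one divided by its total mass, so that `v_λ` has total mass
one (any normalisation of Lebesgue measure cancels). It is carried by the domain. -/
def bergmanMeasure (n : ℕ) (lam : ℝ) : Measure (Fin n → ℂ) :=
  (weightedMeasure n lam univ)⁻¹ • weightedMeasure n lam

/-! ## Square integrable holomorphic functions form a closed subspace -/

theorem volume_rot (n : ℕ) (c : Circle) :
    MeasurePreserving (fun w : Fin n → ℂ => (c : ℂ) • w) volume volume := by
  have h : ∀ _ : Fin n, MeasurePreserving (fun x : ℂ => (c : ℂ) * x) volume volume := fun _ =>
    (rotation c).measurePreserving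
  exact volume_preserving_pi h

theorem mean_value_le {n : ℕ} {z : Fin n → ℂ} {r : ℝ} {g : (Fin n → ℂ) → ℂ}
    (hg : DifferentiableOn ℂ g (Metric.ball z r)) :
    ‖g z‖ₑ * volume (Metric.ball z r) ≤ ∫⁻ w in Metric.ball z r, ‖g w‖ₑ := by
  classical
  set H : (Fin n → ℂ) → ℝ≥0∞ := (Metric.ball (0 : Fin n → ℂ) r).indicator (fun w => ‖g (z + w)‖ₑ)
    with hH
  have hmap : MapsTo (fun w => z + w) (Metric.ball (0 : Fin n → ℂ) r) (Metric.ball z r) := by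
    intro w hw
    simpa [Metric.mem_ball, dist_eq_norm] using hw
  have hHm : Measurable H := by
    have hc : ContinuousOn (fun w => ‖g (z + w)‖ₑ) (Metric.ball (0 : Fin n → ℂ) r) :=
      (hg.continuousOn.comp (by fun_prop) hmap).enorm
    have := hc.measurable_piecewise (g := fun _ => (0 : ℝ≥0∞)) continuousOn_const
      measurableSet_ball
    rw [hH, ← Set.piecewise_eq_indicator]
    exact this
  have hint : ∫⁻ w, H w = ∫⁻ w in Metric.ball z r, ‖g w‖ₑ := by
    rw [← lintegral_indicator measurableSet_ball,
      ← lintegral_add_left_eq_self (μ := volume) ((Metric.ball z r).indicator _) z]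
    refine lintegral_congr fun w => ?_
    by_cases hw : w ∈ Metric.ball (0 : Fin n → ℂ) r
    · rw [hH, indicator_of_mem hw, indicator_of_mem (hmap hw)]
    · rw [hH, indicator_of_notMem hw, indicator_of_notMem]
      simpa [Metric.mem_ball, dist_eq_norm] using hw
  have hvol : volume (Metric.ball z r) = volume (Metric.ball (0 : Fin n → ℂ) r) := by
    have := measure_preimage_add volume (-z) (Metric.ball (0 : Fin n → ℂ) r)
    rw [← this]
    congr 1
    ext w
    simp [Metric.mem_ball, dist_eq_norm, neg_add_eq_sub]
  -- one variable mean value inequality along circles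
  have hpt : ∀ w ∈ Metric.ball (0 : Fin n → ℂ) r,
      ENNReal.ofReal (2 * Real.pi) * ‖g z‖ₑ
        ≤ ∫⁻ θ in Ioc 0 (2 * Real.pi), H ((Circle.exp θ : ℂ) • w) := by
    intro w hw
    have hw' : ‖w‖ < r := by simpa using hw
    have hsub : MapsTo (fun ζ : ℂ => z + ζ • w) (Metric.closedBall 0 1) (Metric.ball z r) := by
      intro ζ hζ
      have hζ' : ‖ζ‖ ≤ 1 := by simpa using hζ
      simp only [Metric.mem_ball, dist_eq_norm, add_sub_cancel_left, norm_smul]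
      nlinarith [norm_nonneg w]
    have hdc : DiffContOnCl ℂ (fun ζ : ℂ => g (z + ζ • w)) (Metric.ball 0 |1|) := by
      rw [abs_one]
      refine DifferentiableOn.diffContOnCl ?_
      rw [closure_ball _ one_ne_zero]
      exact hg.comp (by fun_prop) hsub
    have hav := hdc.circleAverage
    have hav2 : (2 * Real.pi : ℝ) • g z
        = ∫ θ in Ioc 0 (2 * Real.pi), g (z + (Circle.exp θ : ℂ) • w) := by
      rw [Real.circleAverage_def, zero_smul, add_zero] at hav
      rw [← hav, smul_smul, mul_inv_cancel₀ (by positivity), one_smul,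
        intervalIntegral.integral_of_le (by positivity)]
      simp [circleMap, Circle.coe_exp]
    calc ENNReal.ofReal (2 * Real.pi) * ‖g z‖ₑ = ‖(2 * Real.pi : ℝ) • g z‖ₑ := by
          rw [enorm_smul, Real.enorm_eq_ofReal (by positivity)]
      _ ≤ ∫⁻ θ in Ioc 0 (2 * Real.pi), ‖g (z + (Circle.exp θ : ℂ) • w)‖ₑ := by
          rw [hav2]; exact enorm_integral_le_lintegral_enorm _
      _ = _ := by
          refine lintegral_congr fun θ => ?_
          rw [hH, indicator_of_mem]
          simpa [norm_smul] using hw'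
  have hexp : Measurable (fun θ : ℝ => (Circle.exp θ : ℂ)) := by fun_prop
  have hjm : Measurable (fun p : (Fin n → ℂ) × ℝ => H ((Circle.exp p.2 : ℂ) • p.1)) := by
    refine hHm.comp ?_
    exact (hexp.comp measurable_snd).smul measurable_fst
  have htot : ENNReal.ofReal (2 * Real.pi) * (‖g z‖ₑ * volume (Metric.ball (0 : Fin n → ℂ) r))
      ≤ ENNReal.ofReal (2 * Real.pi) * ∫⁻ w, H w := by
    calc _ = ∫⁻ _ in Metric.ball (0 : Fin n → ℂ) r, ENNReal.ofReal (2 * Real.pi) * ‖g z‖ₑ := by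
          rw [setLIntegral_const, mul_assoc]
      _ ≤ ∫⁻ w in Metric.ball (0 : Fin n → ℂ) r,
            ∫⁻ θ in Ioc 0 (2 * Real.pi), H ((Circle.exp θ : ℂ) • w) :=
          setLIntegral_mono' measurableSet_ball hpt
      _ ≤ ∫⁻ w, ∫⁻ θ in Ioc 0 (2 * Real.pi), H ((Circle.exp θ : ℂ) • w) :=
          setLIntegral_le_lintegral _ _
      _ = ∫⁻ θ in Ioc 0 (2 * Real.pi), ∫⁻ w, H ((Circle.exp θ : ℂ) • w) :=
          lintegral_lintegral_swap hjm.aemeasurable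
      _ = ∫⁻ _ in Ioc 0 (2 * Real.pi), ∫⁻ w, H w := by
          refine lintegral_congr fun θ => ?_
          exact (volume_rot n (Circle.exp θ)).lintegral_comp hHm
      _ = _ := by
          rw [setLIntegral_const, Real.volume_Ioc, sub_zero, mul_comm]
  rw [hvol, ← hint]
  exact (ENNReal.mul_le_mul_iff_right (by simp [Real.pi_pos]) ENNReal.ofReal_ne_top).1 htot

theorem eval_le {n : ℕ} {U : Set (Fin n → ℂ)} {ν : Measure (Fin n → ℂ)} {z : Fin n → ℂ} {r : ℝ}
    (hr : 0 < r) (hzU : Metric.ball z r ⊆ U) {C : ℝ≥0∞} (hC : C ≠ ⊤)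
    (hCν : volume.restrict (Metric.ball z r) ≤ C • ν) :
    ∃ K : ℝ, 0 ≤ K ∧ ∀ g : (Fin n → ℂ) → ℂ, DifferentiableOn ℂ g U → MemLp g 2 ν →
      ∀ x ∈ Metric.ball z (r / 2), ‖g x‖ ≤ K * (eLpNorm g 2 ν).toReal := by
  set V := volume (Metric.ball (0 : Fin n → ℂ) (r / 2)) with hV
  have hV0 : V ≠ 0 := (Metric.measure_ball_pos _ _ (by positivity)).ne'
  have hVt : V ≠ ⊤ := measure_ball_lt_top.ne
  set K' : ℝ≥0∞ := C ^ (1 / 2 : ℝ) * V ^ (1 / 2 : ℝ) / V with hK'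
  have hK't : K' ≠ ⊤ := by
    refine ENNReal.div_ne_top (ENNReal.mul_ne_top ?_ ?_) hV0
    · exact ENNReal.rpow_ne_top_of_nonneg (by norm_num) hC
    · exact ENNReal.rpow_ne_top_of_nonneg (by norm_num) hVt
  refine ⟨K'.toReal, ENNReal.toReal_nonneg, fun g hg hgν x hx => ?_⟩
  have hsub : Metric.ball x (r / 2) ⊆ Metric.ball z r :=
    Metric.ball_subset_ball' (by rw [Metric.mem_ball] at hx; linarith)
  have hvol : volume (Metric.ball x (r / 2)) = V := by
    have := measure_preimage_add volume (-x) (Metric.ball (0 : Fin n → ℂ) (r / 2))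
    rw [hV, ← this]
    congr 1
    ext w
    simp [Metric.mem_ball, dist_eq_norm, neg_add_eq_sub]
  have hg' : DifferentiableOn ℂ g (Metric.ball x (r / 2)) := hg.mono (hsub.trans hzU)
  have h1 := mean_value_le hg'
  rw [hvol] at h1
  have h2 : ∫⁻ w in Metric.ball x (r / 2), ‖g w‖ₑ ≤ C ^ (1 / 2 : ℝ) * eLpNorm g 2 ν * V ^ (1 / 2 : ℝ) := by
    rw [← eLpNorm_one_eq_lintegral_enorm]
    have h3 := eLpNorm_le_eLpNorm_mul_rpow_measure_univ
      (μ := volume.restrict (Metric.ball x (r / 2))) (f := g) (p := 1) (q := 2) (by norm_num)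
      (hg'.continuousOn.aestronglyMeasurable measurableSet_ball)
    rw [Measure.restrict_apply_univ, hvol] at h3
    have h4 : eLpNorm g 2 (volume.restrict (Metric.ball x (r / 2)))
        ≤ C ^ (1 / 2 : ℝ) * eLpNorm g 2 ν := by
      calc _ ≤ eLpNorm g 2 (C • ν) :=
            eLpNorm_mono_measure _ ((Measure.restrict_mono hsub le_rfl).trans hCν)
        _ ≤ _ := by
            rw [eLpNorm_smul_measure_of_ne_top (by norm_num)]
            simp
    refine h3.trans ?_
    have h5 : (1 / (1 : ℝ≥0∞).toReal - 1 / (2 : ℝ≥0∞).toReal) = (1 / 2 : ℝ) := by norm_num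
    rw [h5]
    gcongr
  have h6 : ‖g x‖ₑ ≤ K' * eLpNorm g 2 ν := by
    have := h1.trans h2
    rw [hK', ENNReal.div_eq_inv_mul]
    calc ‖g x‖ₑ ≤ (C ^ (1 / 2 : ℝ) * eLpNorm g 2 ν * V ^ (1 / 2 : ℝ)) / V :=
          (ENNReal.le_div_iff_mul_le (Or.inl hV0) (Or.inl hVt)).2 this
      _ = _ := by rw [ENNReal.div_eq_inv_mul]; ring
  rw [← ENNReal.toReal_mul, ← toReal_enorm]
  exact ENNReal.toReal_mono (ENNReal.mul_ne_top hK't hgν.eLpNorm_ne_top) h6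

/-- The space of classes of square integrable functions that are holomorphic on `U`. -/
def holoL2 {n : ℕ} (U : Set (Fin n → ℂ)) (ν : Measure (Fin n → ℂ)) : Submodule ℂ (Lp ℂ 2 ν) where
  carrier := {F | ∃ g : (Fin n → ℂ) → ℂ, DifferentiableOn ℂ g U ∧ F =ᵐ[ν] g}
  zero_mem' := ⟨0, differentiableOn_const 0, Lp.coeFn_zero ℂ 2 ν⟩
  add_mem' := by
    rintro F G ⟨f, hf, hF⟩ ⟨g, hg, hG⟩
    exact ⟨f + g, hf.add hg, (Lp.coeFn_add F G).trans (hF.add hG)⟩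
  smul_mem' := by
    rintro c F ⟨f, hf, hF⟩
    exact ⟨c • f, hf.const_smul c, (Lp.coeFn_smul c F).trans (hF.const_smul c)⟩

theorem isClosed_holoL2 {n : ℕ} {U : Set (Fin n → ℂ)} {ν : Measure (Fin n → ℂ)}
    (hU : ∀ᵐ z ∂ν, z ∈ U)
    (hloc : ∀ z ∈ U, ∃ r > 0, Metric.ball z r ⊆ U ∧
      ∃ C : ℝ≥0∞, C ≠ ⊤ ∧ volume.restrict (Metric.ball z r) ≤ C • ν) :
    IsClosed (holoL2 U ν : Set (Lp ℂ 2 ν)) := by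
  refine IsSeqClosed.isClosed ?_
  intro F F₀ hF hlim
  choose g hg hFg using hF
  have hmem : ∀ k, MemLp (g k) 2 ν := fun k => (memLp_congr_ae (hFg k)).1 (Lp.memLp (F k))
  have hnorm : ∀ k l, (eLpNorm (g k - g l) 2 ν).toReal = ‖F k - F l‖ := by
    intro k l
    rw [Lp.norm_def]
    congr 1
    exact eLpNorm_congr_ae (((Lp.coeFn_sub _ _).trans ((hFg k).sub (hFg l))).symm)
  have hcau : ∀ ε > 0, ∃ N, ∀ k ≥ N, ∀ l ≥ N, ‖F k - F l‖ < ε := by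
    simpa [dist_eq_norm] using Metric.cauchySeq_iff.1 hlim.cauchySeq
  -- uniform estimates for the functions and their derivatives
  have hunif : ∀ z ∈ U, ∃ ρ > 0, ∃ K : ℝ, 0 < K ∧ Metric.ball z ρ ⊆ U ∧
      (∀ k l, ∀ x ∈ Metric.ball z ρ, ‖g k x - g l x‖ ≤ K * ‖F k - F l‖) ∧
      (∀ k l, ∀ x ∈ Metric.ball z ρ,
        ‖fderiv ℂ (g k) x - fderiv ℂ (g l) x‖ ≤ K * ‖F k - F l‖) := by
    intro z hz
    obtain ⟨r, hr, hrU, C, hC, hCν⟩ := hloc z hz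
    obtain ⟨K, hK0, hK⟩ := eval_le hr hrU hC hCν
    have hb : ∀ k l, ∀ x ∈ Metric.ball z (r / 2), ‖g k x - g l x‖ ≤ K * ‖F k - F l‖ := by
      intro k l x hx
      rw [← hnorm]
      exact hK (g k - g l) ((hg k).sub (hg l)) ((hmem k).sub (hmem l)) x hx
    have hsub1 : Metric.ball z (r / 2) ⊆ U :=
      (Metric.ball_subset_ball (by linarith)).trans hrU
    have hsub2 : Metric.ball z (r / 4) ⊆ Metric.ball z (r / 2) :=
      Metric.ball_subset_ball (by linarith)
    refine ⟨r / 4, by positivity, K + 2 * K / (r / 4) + 1, by positivity, hsub2.trans hsub1, ?_, ?_⟩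
    · intro k l x hx
      refine (hb k l x (hsub2 hx)).trans ?_
      gcongr
      have : 0 ≤ 2 * K / (r / 4) := by positivity
      linarith
    · intro k l x hx
      have hsub3 : Metric.ball x (r / 4) ⊆ Metric.ball z (r / 2) :=
        Metric.ball_subset_ball' (by rw [Metric.mem_ball] at hx; linarith)
      have hd : ∀ k, DifferentiableAt ℂ (g k) x := fun k =>
        (hg k).differentiableAt (mem_of_superset (Metric.ball_mem_nhds x (by positivity))
          (hsub3.trans hsub1))
      have hmaps : MapsTo (g k - g l) (Metric.ball x (r / 4))
          (Metric.closedBall ((g k - g l) x) (2 * K * ‖F k - F l‖)) := by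
        intro y hy
        have h1 := hb k l y (hsub3 hy)
        have h2 := hb k l x (hsub2 hx)
        rw [Metric.mem_closedBall, dist_eq_norm]
        calc _ ≤ ‖(g k - g l) y‖ + ‖(g k - g l) x‖ := norm_sub_le _ _
          _ ≤ K * ‖F k - F l‖ + K * ‖F k - F l‖ := add_le_add h1 h2
          _ = _ := by ring
      have h3 := Complex.norm_fderiv_le_div_of_mapsTo_ball
        (((hg k).sub (hg l)).mono (hsub3.trans hsub1)) hmaps (by positivity)
      rw [fderiv_sub (hd k) (hd l)] at h3
      refine h3.trans ?_
      rw [mul_div_right_comm]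
      gcongr
      linarith
  -- the pointwise limit
  have hptc : ∀ x ∈ U, ∃ y, Tendsto (fun k => g k x) atTop (𝓝 y) := by
    intro x hx
    obtain ⟨ρ, hρ, K, hK, -, h1, -⟩ := hunif x hx
    refine cauchySeq_tendsto_of_complete (Metric.cauchySeq_iff.2 fun ε hε => ?_)
    obtain ⟨N, hN⟩ := hcau (ε / K) (by positivity)
    refine ⟨N, fun k hk l hl => ?_⟩
    rw [dist_eq_norm]
    refine (h1 k l x (Metric.mem_ball_self hρ)).trans_lt ?_
    have := hN k hk l hl
    rwa [lt_div_iff₀ hK, mul_comm] at this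
  choose! G hG using hptc
  refine ⟨G, fun z hz => ?_, ?_⟩
  · obtain ⟨ρ, hρ, K, hK, hρU, -, h2⟩ := hunif z hz
    have huc : UniformCauchySeqOn (fun k => fderiv ℂ (g k)) atTop (Metric.ball z ρ) := by
      rw [Metric.uniformCauchySeqOn_iff]
      intro ε hε
      obtain ⟨N, hN⟩ := hcau (ε / K) (by positivity)
      refine ⟨N, fun k hk l hl x hx => ?_⟩
      rw [dist_eq_norm]
      refine (h2 k l x hx).trans_lt ?_
      have := hN k hk l hl
      rwa [lt_div_iff₀ hK, mul_comm] at this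
    have hptd : ∀ x ∈ Metric.ball z ρ, ∃ y, Tendsto (fun k => fderiv ℂ (g k) x) atTop (𝓝 y) :=
      fun x hx => cauchySeq_tendsto_of_complete (huc.cauchySeq hx)
    choose! G' hG' using hptd
    have htu := huc.tendstoUniformlyOn_of_tendsto hG'
    have := hasFDerivAt_of_tendstoUniformlyOn Metric.isOpen_ball htu
      (fun k x hx => ((hg k).differentiableAt
        (mem_of_superset (Metric.isOpen_ball.mem_nhds hx) hρU)).hasFDerivAt)
      (fun x hx => hG x (hρU hx)) (Metric.mem_ball_self hρ)
    exact this.differentiableAt.differentiableWithinAt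
  · have hm := tendstoInMeasure_of_tendsto_Lp hlim
    obtain ⟨ns, hns, hae⟩ := hm.exists_seq_tendsto_ae
    have hall : ∀ᵐ z ∂ν, ∀ k, F k z = g k z := ae_all_iff.2 hFg
    filter_upwards [hae, hall, hU] with z hz1 hz2 hz3
    refine tendsto_nhds_unique hz1 ?_
    simp_rw [hz2]
    exact (hG z hz3).comp hns.tendsto_atTop

theorem continuous_absSq {n : ℕ} : Continuous (absSq : (Fin n → ℂ) → ℝ) := by
  unfold absSq; fun_prop

theorem continuous_dot_self {n : ℕ} : Continuous (fun z : Fin n → ℂ => dot z z) := by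
  unfold dot; fun_prop

theorem continuous_Delta {n : ℕ} : Continuous (Delta : (Fin n → ℂ) → ℝ) := by
  have h1 := continuous_absSq (n := n)
  have h2 := continuous_dot_self (n := n)
  unfold Delta; fun_prop

theorem isOpen_domain (n : ℕ) : IsOpen (domain n) := by
  have h1 := continuous_absSq (n := n)
  have h2 := continuous_dot_self (n := n)
  exact (isOpen_lt h1 continuous_const).inter
    (isOpen_lt (continuous_const.mul h1) (continuous_const.add (h2.norm.pow 2)))

theorem Delta_pos {n : ℕ} {z : Fin n → ℂ} (hz : z ∈ domain n) : 0 < Delta z := by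
  have := hz.2
  unfold Delta
  linarith

theorem exists_restrict_le (n : ℕ) (lam : ℝ) {z : Fin n → ℂ} (hz : z ∈ domain n) :
    ∃ r > 0, Metric.ball z r ⊆ domain n ∧ ∃ C : ℝ≥0∞, C ≠ ⊤ ∧
      volume.restrict (Metric.ball z r) ≤ C • weightedMeasure n lam := by
  obtain ⟨r, hr, hrU⟩ := Metric.nhds_basis_closedBall.mem_iff.1 ((isOpen_domain n).mem_nhds hz)
  have hcont : ContinuousOn (fun y : Fin n → ℂ => Delta y ^ (lam - n)) (Metric.closedBall z r) :=
    continuous_Delta.continuousOn.rpow_const fun y hy => Or.inl (Delta_pos (hrU hy)).ne'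
  obtain ⟨y₀, hy₀, hmin⟩ := (isCompact_closedBall z r).exists_isMinOn
    (Metric.nonempty_closedBall.2 hr.le) hcont
  set m := Delta y₀ ^ (lam - n) with hm
  have hm0 : 0 < m := Real.rpow_pos_of_pos (Delta_pos (hrU hy₀)) _
  have hsub : Metric.ball z r ⊆ domain n := Metric.ball_subset_closedBall.trans hrU
  refine ⟨r, hr, hsub, (ENNReal.ofReal m)⁻¹, by simpa using hm0, ?_⟩
  have h1 : ENNReal.ofReal m • volume.restrict (Metric.ball z r) ≤ weightedMeasure n lam := by
    refine Measure.le_iff.2 fun s hs => ?_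
    rw [Measure.smul_apply, Measure.restrict_apply hs, smul_eq_mul, weightedMeasure,
      withDensity_apply _ hs, Measure.restrict_restrict hs, ← setLIntegral_const]
    calc _ ≤ ∫⁻ y in s ∩ Metric.ball z r, ENNReal.ofReal (Delta y ^ (lam - n)) :=
          setLIntegral_mono' (hs.inter measurableSet_ball) fun y hy =>
            ENNReal.ofReal_le_ofReal (hmin (Metric.ball_subset_closedBall hy.2))
      _ ≤ _ := lintegral_mono_set (inter_subset_inter_right _ hsub)
  refine Measure.le_iff.2 fun s hs => ?_
  have h2 := Measure.le_iff.1 h1 s hs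
  rw [Measure.smul_apply, smul_eq_mul] at h2 ⊢
  rw [← ENNReal.div_eq_inv_mul, ENNReal.le_div_iff_mul_le (Or.inl (by simpa using hm0))
    (Or.inl ENNReal.ofReal_ne_top), mul_comm]
  exact h2

/-! ## Bergman spaces and Toeplitz operators -/

/-- The weighted Bergman space `A²_λ`: the subspace of `L²(v_λ)` of all classes represented by a
function that is holomorphic on the domain. -/
def bergman (n : ℕ) (lam : ℝ) : Submodule ℂ (Lp ℂ 2 (bergmanMeasure n lam)) :=
  holoL2 (domain n) (bergmanMeasure n lam)

theorem isClosed_bergman (n : ℕ) (lam : ℝ) :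
    IsClosed (bergman n lam : Set (Lp ℂ 2 (bergmanMeasure n lam))) := by
  by_cases h0 : bergmanMeasure n lam = 0
  · have : (bergman n lam : Set (Lp ℂ 2 (bergmanMeasure n lam))) = univ := by
      refine eq_univ_of_forall fun F => ⟨0, differentiableOn_const 0, ?_⟩
      have : ae (bergmanMeasure n lam) = ⊥ := by rw [h0]; exact ae_zero
      rw [Filter.EventuallyEq, this]
      exact Filter.eventually_bot
    rw [this]
    exact isClosed_univ
  · have ht : weightedMeasure n lam univ ≠ ⊤ := by
      intro h
      apply h0
      rw [bergmanMeasure, h]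
      simp
    have hz : weightedMeasure n lam univ ≠ 0 := by
      intro h
      apply h0
      rw [bergmanMeasure, Measure.measure_univ_eq_zero.1 h]
      simp
    refine isClosed_holoL2 ?_ ?_
    · have h1 : ∀ᵐ z ∂(weightedMeasure n lam), z ∈ domain n :=
        (withDensity_absolutelyContinuous _ _).ae_le
          (ae_restrict_mem (isOpen_domain n).measurableSet)
      exact Measure.ae_smul_measure h1 _
    · intro z hzd
      obtain ⟨r, hr, hrU, C, hC, hle⟩ := exists_restrict_le n lam hzd
      refine ⟨r, hr, hrU, C * weightedMeasure n lam univ, ENNReal.mul_ne_top hC ht, ?_⟩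
      rwa [bergmanMeasure, smul_smul, mul_assoc, ENNReal.mul_inv_cancel hz ht, mul_one]

instance instCompleteSpaceBergman (n : ℕ) (lam : ℝ) : CompleteSpace (bergman n lam) :=
  (isClosed_bergman n lam).completeSpace_coe

/-- The multiplication operator `M_a` on `L²(v_λ)`, for `a ∈ L^∞`. -/
def mulOp {n : ℕ} {lam : ℝ} (a : Lp ℂ ⊤ (bergmanMeasure n lam)) :
    Lp ℂ 2 (bergmanMeasure n lam) →L[ℂ] Lp ℂ 2 (bergmanMeasure n lam) :=
  (ContinuousLinearMap.mul ℂ ℂ).holderL (bergmanMeasure n lam) ⊤ 2 2 a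

/-- The Toeplitz operator `T_a = B_λ ∘ M_a` on `A²_λ`, where `B_λ` is the orthogonal projection
of `L²(v_λ)` onto `A²_λ`. -/
def toeplitz {n : ℕ} {lam : ℝ} (a : Lp ℂ ⊤ (bergmanMeasure n lam)) :
    bergman n lam →L[ℂ] bergman n lam :=
  (bergman n lam).orthogonalProjectionOnto ∘L mulOp a ∘L (bergman n lam).subtypeL

/-- The unital C*-algebra of operators on a Hilbert space `H` generated by a set of bounded
operators: the norm closure of the unital star algebra generated by the set. -/
def cstarAlgebraGenerated {H : Type*} [NormedAddCommGroup H] [InnerProductSpace ℂ H]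
    [CompleteSpace H] (S : Set (H →L[ℂ] H)) : StarSubalgebra ℂ (H →L[ℂ] H) :=
  (StarAlgebra.adjoin ℂ S).topologicalClosure

/-- The unital C*-algebra generated by the Toeplitz operators with symbols in `S`. -/
def toeplitzAlgebra {n : ℕ} {lam : ℝ} (S : Set (Lp ℂ ⊤ (bergmanMeasure n lam))) :
    StarSubalgebra ℂ (bergman n lam →L[ℂ] bergman n lam) :=
  cstarAlgebraGenerated (toeplitz '' S)

/-! ## The Bergman metric, its symplectic form and moment maps -/

/-- The (weightless) Bergman kernel `K(z,w) = (1 - 2 zᵀ w̄ + (zᵀ z) conj(wᵀ w))^(-n)`. -/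
def bergmanKernel (n : ℕ) (z w : Fin n → ℂ) : ℂ :=
  ((1 - 2 * dot z (fun j => conj (w j)) + dot z z * conj (dot w w)) ^ n)⁻¹

/-- The Wirtinger derivative `∂F/∂z_j`. -/
def wirtinger {n : ℕ} (j : Fin n) (F : (Fin n → ℂ) → ℂ) (z : Fin n → ℂ) : ℂ :=
  (fderiv ℝ F z (Pi.single j 1) - Complex.I * fderiv ℝ F z (Pi.single j Complex.I)) / 2

/-- The conjugate Wirtinger derivative of `F` with respect to the conjugate of `z_j`. -/
def wirtingerBar {n : ℕ} (j : Fin n) (F : (Fin n → ℂ) → ℂ) (z : Fin n → ℂ) : ℂ :=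
  (fderiv ℝ F z (Pi.single j 1) + Complex.I * fderiv ℝ F z (Pi.single j Complex.I)) / 2

/-- The coefficients `g_{jk}(z)` of the Bergman metric `∑ g_{jk} dz_j ⊗ dz̄_k`, that is `1 / (2n)`
times the derivative of `log K(z,z)` with respect to `z_j` and the conjugate of `z_k`. -/
def metricCoeff (n : ℕ) (j k : Fin n) (z : Fin n → ℂ) : ℂ :=
  1 / (2 * n) *
    wirtinger j (wirtingerBar k fun w => Complex.log (bergmanKernel n w w)) z

/-- The symplectic form `ω = i ∑ g_{jk} dz_j ∧ dz̄_k` of the Bergman metric at `z`. -/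
def symplecticForm (n : ℕ) (z u v : Fin n → ℂ) : ℂ :=
  Complex.I * ∑ j, ∑ k, metricCoeff n j k z * (u j * conj (v k) - v j * conj (u k))

/-- The vector field on `ℂⁿ` induced by `X` in the Lie algebra of `SO(2)`. The group is identified
with the unit circle, which acts by `t • z`, and its Lie algebra with `ℝ`, the exponential map
being `X ↦ exp(iX)`. -/
def inducedField {n : ℕ} (X : ℝ) (z : Fin n → ℂ) : Fin n → ℂ :=
  deriv (fun r : ℝ => (Circle.exp (r * X) : ℂ) • z) 0

/-- `μ` is a moment map for the action of `SO(2)` on the domain with the symplectic form of the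
Bergman metric. The dual of the Lie algebra is identified with `ℝ`, so `⟨μ(z), X⟩ = μ(z) X`; the
coadjoint action is trivial because `SO(2)` is abelian. -/
structure IsMomentMapSO2 (n : ℕ) (μ : (Fin n → ℂ) → ℝ) : Prop where
  smooth : ContDiffOn ℝ (⊤ : ℕ∞) μ (domain n)
  hamiltonian : ∀ X : ℝ, ∀ z ∈ domain n, ∀ u : Fin n → ℂ,
    ((fderiv ℝ (fun w => μ w * X) z u : ℝ) : ℂ) = symplecticForm n z (inducedField X z) u
  equivariant : ∀ t : Circle, ∀ z ∈ domain n, μ ((t : ℂ) • z) = μ z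

/-- The function `(|zᵀ z|² - |z|²) / (1 + |zᵀ z|² - 2 |z|²)`. -/
def momentMapSO2 (n : ℕ) (z : Fin n → ℂ) : ℝ :=
  (‖dot z z‖ ^ 2 - absSq z) / (1 + ‖dot z z‖ ^ 2 - 2 * absSq z)

/-- The essentially bounded symbols of the form `f ∘ μ` with `f` measurable. -/
def momentMapSymbols (n : ℕ) (lam : ℝ) (μ : (Fin n → ℂ) → ℝ) :
    Set (Lp ℂ ⊤ (bergmanMeasure n lam)) :=
  {a | ∃ f : ℝ → ℂ, Measurable f ∧ a =ᵐ[bergmanMeasure n lam] fun z => f (μ z)}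

/-! ## Harmonic polynomials -/

/-- The holomorphic Laplacian `∑ ∂²/∂z_j²` on polynomials. -/
def laplacian (n : ℕ) : MvPolynomial (Fin n) ℂ →ₗ[ℂ] MvPolynomial (Fin n) ℂ :=
  ∑ j, (MvPolynomial.pderiv j).toLinearMap ∘ₗ (MvPolynomial.pderiv j).toLinearMap

/-- `H^m(ℂⁿ)`: the harmonic polynomials that are homogeneous of degree `m`. -/
def harmonicPoly (n m : ℕ) : Submodule ℂ (MvPolynomial (Fin n) ℂ) :=
  MvPolynomial.homogeneousSubmodule (Fin n) ℂ m ⊓ LinearMap.ker (laplacian n)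

/-- The subspace `H^{k₁}(ℂⁿ) (zᵀ z)^{k₂}` of the Bergman space. -/
def component (n : ℕ) (lam : ℝ) (k : ℕ × ℕ) : Submodule ℂ (bergman n lam) where
  carrier := {F | ∃ p ∈ harmonicPoly n k.1, (F : Lp ℂ 2 (bergmanMeasure n lam))
    =ᵐ[bergmanMeasure n lam] fun z => MvPolynomial.eval z p * dot z z ^ k.2}
  zero_mem' := by
    refine ⟨0, zero_mem _, (Lp.coeFn_zero ℂ 2 (bergmanMeasure n lam)).trans ?_⟩
    filter_upwards with z
    simp
  add_mem' := by
    rintro F G ⟨p, hp, hF⟩ ⟨q, hq, hG⟩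
    refine ⟨p + q, add_mem hp hq, (Lp.coeFn_add _ _).trans ?_⟩
    filter_upwards [hF, hG] with z h1 h2
    simp [h1, h2, add_mul]
  smul_mem' := by
    rintro c F ⟨p, hp, hF⟩
    refine ⟨c • p, Submodule.smul_mem _ c hp, (Lp.coeFn_smul _ _).trans ?_⟩
    filter_upwards [hF] with z h1
    simp [h1, mul_assoc, MvPolynomial.smul_eval]

end CartanIV

end

open CartanIV

/-!
`X^♯` and `ω` determine the differential of a moment map, and `D` is star-shaped, so every moment
map is `μ^{SO(2)}` up to a constant. A symbol `f ∘ μ` hence depends only on `|z|` and `|zᵀz|`, and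
the matrix of its Toeplitz operator on the polynomials is a sesquilinear form invariant under the
circle and under the rotations of `ℂⁿ`. The circle separates the degrees. On
`H^{k₁} (zᵀz)^{k₂}` the Casimir operator of `so(n)` takes a value that determines `k₁`, which
separates the summands of equal degree. For `n ≥ 3` the space `H^k` is irreducible, its only highest
weight vectors being the multiples of `(z_a + i z_b)^k`, so by Schur's lemma the form is a multiple
of the inner product on each summand.

The summands span the polynomials (Fischer decomposition), and the polynomials are dense:
integrating over the circle shows that a function in the Bergman space orthogonal to all polynomials
has vanishing Taylor polynomials at `0`. Finally, operators acting as scalars on the summands of a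
fixed Hilbert sum form a commutative star-algebra, and commutativity passes to the norm closure.
-/

noncomputable section

namespace CartanIV

open MvPolynomial

/-! ## Harmonic polynomials and the Fischer decomposition -/

section Rotations

theorem pderiv_comm {σ R : Type*} [CommRing R] (i j : σ) (f : MvPolynomial σ R) :
    pderiv i (pderiv j f) = pderiv j (pderiv i f) := by
  classical
  have h : ⁅pderiv (R := R) i, pderiv (R := R) j⁆ = 0 := derivation_ext fun k => by
    simp only [Derivation.commutator_apply, pderiv_X, Pi.single_apply]
    split_ifs <;> simp
  rw [← sub_eq_zero, ← Derivation.commutator_apply, h, Derivation.zero_apply]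

/-- The infinitesimal rotation `z_i ∂_j - z_j ∂_i` of the coordinate plane `(i, j)`. -/
def rot {σ R : Type*} [CommRing R] (i j : σ) :
    Derivation R (MvPolynomial σ R) (MvPolynomial σ R) :=
  (X i : MvPolynomial σ R) • pderiv j - (X j : MvPolynomial σ R) • pderiv i

section CommRing

variable {σ R : Type*} [CommRing R] {f : MvPolynomial σ R}

theorem rot_apply (i j : σ) (f : MvPolynomial σ R) :
    rot i j f = X i * pderiv j f - X j * pderiv i f := by
  simp [rot]

theorem isHomogeneous_rot {k : ℕ} (hf : f.IsHomogeneous k) (i j : σ) :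
    (rot i j f).IsHomogeneous k := by
  rw [rot_apply]
  cases k with
  | zero =>
    rw [totalDegree_eq_zero_iff_eq_C.1 ((totalDegree_zero_iff_isHomogeneous _).2 hf)]
    simpa using isHomogeneous_zero σ R 0
  | succ k =>
    rw [add_comm k 1]
    exact ((isHomogeneous_X R i).mul hf.pderiv).sub
      ((isHomogeneous_X R j).mul hf.pderiv)

theorem pderiv_rot [DecidableEq σ] (i j k : σ) (f : MvPolynomial σ R) :
    pderiv k (rot i j f) = rot i j (pderiv k f)
      + ((if k = i then pderiv j f else 0) - if k = j then pderiv i f else 0) := by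
  simp only [rot_apply, map_sub, Derivation.leibniz, pderiv_X, pderiv_comm k, Pi.single_apply,
    smul_eq_mul, eq_comm (a := k)]
  split_ifs <;> ring

end CommRing

variable {n k : ℕ} {f : MvPolynomial (Fin n) ℂ}

/-- The quadratic form `zᵀ z` as a polynomial. -/
def quad (n : ℕ) : MvPolynomial (Fin n) ℂ := ∑ i, X i ^ 2

theorem eval_quad (z : Fin n → ℂ) : eval z (quad n) = dot z z := by
  simp [quad, dot, sq]

theorem pderiv_quad (i : Fin n) : pderiv i (quad n) = 2 * X i := by
  simp [quad, pderiv_X, Pi.single_apply]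

theorem isHomogeneous_quad (n : ℕ) : (quad n).IsHomogeneous 2 :=
  IsHomogeneous.sum _ _ _ fun i _ => by simpa using (isHomogeneous_X ℂ i).pow 2

theorem quad_ne_zero (hn : n ≠ 0) : quad n ≠ 0 := by
  have := NeZero.mk hn
  intro h
  simpa [quad, Pi.single_apply] using congrArg (eval (Pi.single (0 : Fin n) (1 : ℂ))) h

theorem rot_mul_quad_pow (i j : Fin n) (f : MvPolynomial (Fin n) ℂ) (m : ℕ) :
    rot i j (f * quad n ^ m) = rot i j f * quad n ^ m := by
  have h : rot i j (quad n) = 0 := by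
    rw [rot_apply, pderiv_quad, pderiv_quad]
    ring
  rw [Derivation.leibniz, Derivation.leibniz_pow, h]
  simp [mul_comm]

theorem laplacian_apply (f : MvPolynomial (Fin n) ℂ) :
    laplacian n f = ∑ j, pderiv j (pderiv j f) := by
  simp [laplacian]

theorem isHomogeneous_laplacian (hf : f.IsHomogeneous (k + 2)) :
    (laplacian n f).IsHomogeneous k := by
  rw [laplacian_apply]
  exact IsHomogeneous.sum _ _ _ fun i _ => hf.pderiv.pderiv

theorem mem_harmonicPoly : f ∈ harmonicPoly n k ↔ f.IsHomogeneous k ∧ laplacian n f = 0 := Iff.rfl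

theorem laplacian_eq_zero_of_lt_two (hk : k < 2) (hf : f.IsHomogeneous k) :
    laplacian n f = 0 := by
  rw [laplacian_apply]
  refine Finset.sum_eq_zero fun i _ => ?_
  have h : (pderiv i f).IsHomogeneous 0 := (show k - 1 = 0 by omega) ▸ hf.pderiv
  rw [totalDegree_eq_zero_iff_eq_C.1 ((totalDegree_zero_iff_isHomogeneous _).2 h), pderiv_C]

theorem laplacian_rot (i j : Fin n) (f : MvPolynomial (Fin n) ℂ) :
    laplacian n (rot i j f) = rot i j (laplacian n f) := by
  have h : ∀ k, pderiv k (pderiv k (rot i j f)) = rot i j (pderiv k (pderiv k f))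
      + ((if k = i then 2 * pderiv i (pderiv j f) else 0)
        - if k = j then 2 * pderiv i (pderiv j f) else 0) := by
    intro k
    rw [pderiv_rot, map_add, pderiv_rot, map_sub]
    split_ifs with hi hj hj
    · rw [← hi, ← hj]; ring
    · rw [← hi, map_zero, pderiv_comm j k]; ring
    · rw [← hj, map_zero, pderiv_comm i k]; ring
    · rw [map_zero]; ring
  simp [laplacian_apply, h, Finset.sum_add_distrib]

theorem rot_mem_harmonicPoly (hf : f ∈ harmonicPoly n k) (i j : Fin n) :
    rot i j f ∈ harmonicPoly n k := by
  refine mem_harmonicPoly.2 ⟨isHomogeneous_rot hf.1 i j, ?_⟩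
  rw [laplacian_rot, (mem_harmonicPoly.1 hf).2, map_zero]

theorem laplacian_quad_mul (hf : f.IsHomogeneous k) :
    laplacian n (quad n * f) = (2 * n + 4 * k : ℂ) • f + quad n * laplacian n f := by
  have h : ∀ j : Fin n, pderiv j (pderiv j (quad n * f))
      = 2 * f + 4 * (X j * pderiv j f) + quad n * pderiv j (pderiv j f) := by
    intro j
    have h2 : pderiv j (2 : MvPolynomial (Fin n) ℂ) = 0 := Derivation.map_natCast (pderiv j) 2
    simp only [Derivation.leibniz, smul_eq_mul, map_add, pderiv_quad, h2, pderiv_X_self]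
    ring
  simp only [laplacian_apply, h, Finset.sum_add_distrib, ← Finset.mul_sum, hf.sum_X_mul_pderiv]
  simp [smul_eq_C_mul, map_ofNat C]
  ring

end Rotations

section Fischer

variable {n : ℕ}

theorem exists_quad_mul_laplacian_add_smul (k : ℕ) {c : ℝ} (hc : 0 < c)
    {p : MvPolynomial (Fin n) ℂ} (hp : p.IsHomogeneous k) :
    ∃ g : MvPolynomial (Fin n) ℂ, g.IsHomogeneous k ∧
      quad n * laplacian n g + (c : ℂ) • g = p := by
  induction k using Nat.strong_induction_on generalizing c p with
  | _ k ih =>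
    have hc' : (c : ℂ) ≠ 0 := by exact_mod_cast hc.ne'
    rcases lt_or_ge k 2 with hk | hk
    · refine ⟨(c : ℂ)⁻¹ • p, (homogeneousSubmodule _ _ _).smul_mem _ hp, ?_⟩
      rw [map_smul, laplacian_eq_zero_of_lt_two hk hp, smul_inv_smul₀ hc', smul_zero, mul_zero,
        zero_add]
    · obtain ⟨d, rfl⟩ := Nat.exists_eq_add_of_le' hk
      -- Applying the Laplacian to the equation gives the same equation for `g₁ = Δ g`, with the
      -- larger constant `c + 2n + 4d`, in degree `d`.
      obtain ⟨g₁, hg₁, he⟩ := ih d (by omega) (c := c + (2 * n + 4 * d)) (by positivity)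
        (isHomogeneous_laplacian hp)
      have hqg : (quad n * g₁).IsHomogeneous (d + 2) :=
        add_comm 2 d ▸ (isHomogeneous_quad n).mul hg₁
      have hl : laplacian n (p - quad n * g₁) = (c : ℂ) • g₁ := by
        rw [map_sub, laplacian_quad_mul hg₁, ← he]
        push_cast
        module
      refine ⟨(c : ℂ)⁻¹ • (p - quad n * g₁),
        (homogeneousSubmodule _ _ _).smul_mem _ (hp.sub hqg), ?_⟩
      rw [map_smul, hl, inv_smul_smul₀ hc', smul_inv_smul₀ hc', add_sub_cancel]

theorem exists_harmonic_add_quad_mul (hn : n ≠ 0) {k : ℕ} {p : MvPolynomial (Fin n) ℂ}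
    (hp : p.IsHomogeneous (k + 2)) :
    ∃ h ∈ harmonicPoly n (k + 2), ∃ g : MvPolynomial (Fin n) ℂ,
      g.IsHomogeneous k ∧ p = h + quad n * g := by
  obtain ⟨g, hg, he⟩ := exists_quad_mul_laplacian_add_smul k (c := 2 * n + 4 * k) (by positivity)
    (isHomogeneous_laplacian hp)
  have hqg : (quad n * g).IsHomogeneous (k + 2) :=
    add_comm 2 k ▸ (isHomogeneous_quad n).mul hg
  refine ⟨p - quad n * g, mem_harmonicPoly.2 ⟨hp.sub hqg, ?_⟩, g, hg, by ring⟩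
  rw [map_sub, laplacian_quad_mul hg, ← he]
  push_cast
  module

theorem mul_quad_pow_mem_of_isHomogeneous (hn : n ≠ 0)
    {W : Submodule ℂ (MvPolynomial (Fin n) ℂ)}
    (hW : ∀ k m, ∀ h ∈ harmonicPoly n k, h * quad n ^ m ∈ W)
    {k : ℕ} (m : ℕ) {p : MvPolynomial (Fin n) ℂ} (hp : p.IsHomogeneous k) :
    p * quad n ^ m ∈ W := by
  induction k using Nat.strong_induction_on generalizing m p with
  | _ k ih =>
    rcases lt_or_ge k 2 with hk | hk
    · exact hW k m p ⟨hp, laplacian_eq_zero_of_lt_two hk hp⟩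
    · obtain ⟨d, rfl⟩ := Nat.exists_eq_add_of_le' hk
      obtain ⟨h, hh, g, hg, rfl⟩ := exists_harmonic_add_quad_mul hn hp
      have heq : (h + quad n * g) * quad n ^ m = h * quad n ^ m + g * quad n ^ (m + 1) := by ring
      exact heq ▸ add_mem (hW _ _ h hh) (ih d (by omega) (m + 1) hg)

theorem eq_top_of_harmonicPoly_mul_quad_pow_mem (hn : n ≠ 0)
    {W : Submodule ℂ (MvPolynomial (Fin n) ℂ)}
    (hW : ∀ k m, ∀ h ∈ harmonicPoly n k, h * quad n ^ m ∈ W) : W = ⊤ := by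
  refine eq_top_iff.2 fun p _ => ?_
  rw [← sum_homogeneousComponent p]
  refine sum_mem fun k _ => ?_
  simpa using mul_quad_pow_mem_of_isHomogeneous hn hW 0 (homogeneousComponent_isHomogeneous k p)

end Fischer

section Casimir

variable {n : ℕ}

theorem sum_rot_rot (f : MvPolynomial (Fin n) ℂ) :
    ∑ i, ∑ j, rot i j (rot i j f) = (2 : ℂ) • (quad n * laplacian n f
      - ∑ i, X i * ∑ j, X j * pderiv j (pderiv i f) - (n - 1 : ℂ) • ∑ i, X i * pderiv i f) := by
  have key : ∀ i j, rot i j (rot i j f) =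
      X i ^ 2 * pderiv j (pderiv j f) + X j ^ 2 * pderiv i (pderiv i f)
      - X i * pderiv i f - X j * pderiv j f - 2 * (X i * (X j * pderiv j (pderiv i f)))
      + if i = j then 2 * (X i * pderiv i f) else 0 := by
    intro i j
    rw [rot_apply, pderiv_rot, pderiv_rot, rot_apply, rot_apply, pderiv_comm i j]
    by_cases hij : i = j
    · subst hij; simp; ring
    · simp [hij, Ne.symm hij]; ring
  simp only [key, Finset.sum_add_distrib, Finset.sum_sub_distrib, Finset.sum_ite_eq,
    Finset.mem_univ, if_true, ← Finset.mul_sum, ← Finset.sum_mul, Finset.sum_const,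
    Finset.card_univ, Fintype.card_fin, mul_smul_comm, ← Finset.smul_sum, ← laplacian_apply]
  simp only [nsmul_eq_mul, smul_eq_C_mul, map_sub, map_ofNat C, map_natCast, map_one, quad]
  ring

theorem sum_rot_rot_of_mem_harmonicPoly {k : ℕ} {f : MvPolynomial (Fin n) ℂ}
    (hf : f ∈ harmonicPoly n k) :
    ∑ i, ∑ j, rot i j (rot i j f) = (-(2 * (k * (k + n - 2))) : ℂ) • f := by
  rw [sum_rot_rot, (mem_harmonicPoly.1 hf).2, mul_zero]
  have hE : ∀ i, ∑ j, X j * pderiv j (pderiv i f) = (k - 1) • pderiv i f := fun i =>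
    (IsHomogeneous.pderiv hf.1).sum_X_mul_pderiv
  simp_rw [hE, mul_smul_comm, ← Finset.smul_sum, IsHomogeneous.sum_X_mul_pderiv hf.1]
  cases k with
  | zero => simp
  | succ k =>
    simp only [← Nat.cast_smul_eq_nsmul ℂ, add_tsub_cancel_right]
    push_cast
    module

/-- The infinitesimal rotations are skew for the sesquilinear form `B`, that is, `B` is invariant
under the action of `so(n)`. -/
def RotInvariant (B : MvPolynomial (Fin n) ℂ →ₗ⋆[ℂ] MvPolynomial (Fin n) ℂ →ₗ[ℂ] ℂ) : Prop :=
  ∀ i j p q, B (rot i j p) q = -B p (rot i j q)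

theorem RotInvariant.sub_smul {B D : MvPolynomial (Fin n) ℂ →ₗ⋆[ℂ] MvPolynomial (Fin n) ℂ →ₗ[ℂ] ℂ}
    (hD : RotInvariant D) (hB : RotInvariant B) (c : ℂ) : RotInvariant (D - c • B) := by
  intro i j p q
  simp only [LinearMap.sub_apply, LinearMap.smul_apply, hD i j p q, hB i j p q, smul_eq_mul]
  ring

theorem RotInvariant.apply_mul_quad_pow_eq_zero (hn : 2 ≤ n)
    {B : MvPolynomial (Fin n) ℂ →ₗ⋆[ℂ] MvPolynomial (Fin n) ℂ →ₗ[ℂ] ℂ} (hB : RotInvariant B)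
    {k k' : ℕ} (hk : k ≠ k') {h h' : MvPolynomial (Fin n) ℂ} (hh : h ∈ harmonicPoly n k)
    (hh' : h' ∈ harmonicPoly n k') (m m' : ℕ) : B (h * quad n ^ m) (h' * quad n ^ m') = 0 := by
  have casimir : ∀ {l : ℕ} {f : MvPolynomial (Fin n) ℂ} (s : ℕ), f ∈ harmonicPoly n l →
      ∑ i, ∑ j, rot i j (rot i j (f * quad n ^ s))
        = (-(2 * (l * (l + n - 2))) : ℂ) • (f * quad n ^ s) := fun s hf => by
    simp_rw [rot_mul_quad_pow, ← Finset.sum_mul, sum_rot_rot_of_mem_harmonicPoly hf,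
      smul_mul_assoc]
  have symm : B (∑ i, ∑ j, rot i j (rot i j (h * quad n ^ m))) (h' * quad n ^ m')
      = B (h * quad n ^ m) (∑ i, ∑ j, rot i j (rot i j (h' * quad n ^ m'))) := by
    simp only [map_sum, LinearMap.sum_apply, hB _, neg_neg]
  rw [casimir m hh, casimir m' hh', map_smulₛₗ, LinearMap.smul_apply, map_smul] at symm
  have hne : ((k : ℂ) - k') * (k + k' + n - 2 : ℕ) ≠ 0 :=
    mul_ne_zero (sub_ne_zero.2 (by exact_mod_cast hk)) (by norm_cast; omega)
  rw [Nat.cast_sub (by omega)] at hne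
  refine (mul_eq_zero.1 ?_).resolve_left hne
  simp only [map_neg, map_mul, map_ofNat, map_natCast, map_sub, map_add, smul_eq_mul] at symm
  push_cast
  linear_combination (-1 / 2 : ℂ) * symm

end Casimir

/-! ## Irreducibility of the spaces of harmonic polynomials -/

section HighestWeight

variable {n k : ℕ} {a b j : Fin n} {f : MvPolynomial (Fin n) ℂ} {α : ℂ}

/-- The isotropic linear form `z_a + i z_b`. -/
def isoX (a b : Fin n) : MvPolynomial (Fin n) ℂ := X a + Complex.I • X b

/-- The isotropic derivation `∂_a - i ∂_b`, of weight `-1`. -/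
def dIso (a b : Fin n) : Derivation ℂ (MvPolynomial (Fin n) ℂ) (MvPolynomial (Fin n) ℂ) :=
  pderiv a - Complex.I • pderiv b

/-- The isotropic derivation `∂_a + i ∂_b`, of weight `1`. -/
def dIsoBar (a b : Fin n) : Derivation ℂ (MvPolynomial (Fin n) ℂ) (MvPolynomial (Fin n) ℂ) :=
  pderiv a + Complex.I • pderiv b

/-- The element `-i (z_a ∂_b - z_b ∂_a)` of a Cartan subalgebra of `so(n)`; its eigenvalues are
called weights. -/
def weightOp (a b : Fin n) : Derivation ℂ (MvPolynomial (Fin n) ℂ) (MvPolynomial (Fin n) ℂ) :=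
  -(Complex.I • rot a b)

/-- The root vector of `so(n)` that raises weights of `weightOp a b` by one, attached to an index
`j` different from `a` and `b`. -/
def raiseOp (a b j : Fin n) : Derivation ℂ (MvPolynomial (Fin n) ℂ) (MvPolynomial (Fin n) ℂ) :=
  rot a j + Complex.I • rot b j

theorem dIso_apply (a b : Fin n) (f : MvPolynomial (Fin n) ℂ) :
    dIso a b f = pderiv a f - Complex.I • pderiv b f := by simp [dIso]

theorem dIsoBar_apply (a b : Fin n) (f : MvPolynomial (Fin n) ℂ) :
    dIsoBar a b f = pderiv a f + Complex.I • pderiv b f := by simp [dIsoBar]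

theorem weightOp_apply (a b : Fin n) (f : MvPolynomial (Fin n) ℂ) :
    weightOp a b f = -(Complex.I • rot a b f) := by simp [weightOp]

theorem raiseOp_apply (a b j : Fin n) (f : MvPolynomial (Fin n) ℂ) :
    raiseOp a b j f = isoX a b * pderiv j f - X j * dIsoBar a b f := by
  simp only [raiseOp, Derivation.add_apply, Derivation.smul_apply, rot_apply, isoX, dIsoBar_apply,
    add_mul, mul_add, smul_mul_assoc, mul_smul_comm]
  module

theorem isoX_mul_dIso (a b : Fin n) (f : MvPolynomial (Fin n) ℂ) :
    isoX a b * dIso a b f = X a * pderiv a f + X b * pderiv b f + weightOp a b f := by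
  simp only [isoX, dIso_apply, weightOp_apply, rot_apply, add_mul, mul_sub, smul_mul_assoc,
    mul_smul_comm]
  linear_combination (norm := module) -(Complex.I_mul_I • (X b * pderiv b f))

theorem pderiv_left_eq (a b : Fin n) (f : MvPolynomial (Fin n) ℂ) :
    pderiv a f = (1 / 2 : ℂ) • (dIso a b f + dIsoBar a b f) := by
  rw [dIso_apply, dIsoBar_apply]
  module

theorem pderiv_right_eq (a b : Fin n) (f : MvPolynomial (Fin n) ℂ) :
    pderiv b f = (Complex.I / 2) • (dIso a b f - dIsoBar a b f) := by
  rw [dIso_apply, dIsoBar_apply]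
  linear_combination (norm := module) Complex.I_mul_I • pderiv b f

theorem dIso_dIsoBar (a b : Fin n) (f : MvPolynomial (Fin n) ℂ) :
    dIso a b (dIsoBar a b f) = pderiv a (pderiv a f) + pderiv b (pderiv b f) := by
  simp only [dIso_apply, dIsoBar_apply, map_add, Derivation.map_smul, pderiv_comm b a]
  linear_combination (norm := module) -(Complex.I_mul_I • pderiv b (pderiv b f))

theorem dIsoBar_dIso (a b : Fin n) (f : MvPolynomial (Fin n) ℂ) :
    dIsoBar a b (dIso a b f) = dIso a b (dIsoBar a b f) := by
  simp only [dIso_apply, dIsoBar_apply, map_add, map_sub, Derivation.map_smul, pderiv_comm b a]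
  module

theorem pderiv_isoX (hja : j ≠ a) (hjb : j ≠ b) : pderiv j (isoX a b) = 0 := by
  simp [isoX, pderiv_X, hja.symm, hjb.symm]

theorem isoX_ne_zero (hab : a ≠ b) : isoX a b ≠ 0 := by
  intro h
  simpa [isoX, smul_eval, hab.symm] using congrArg (eval (Pi.single a (1 : ℂ))) h

theorem weightOp_pderiv (hja : j ≠ a) (hjb : j ≠ b) (f : MvPolynomial (Fin n) ℂ) :
    weightOp a b (pderiv j f) = pderiv j (weightOp a b f) := by
  simp [weightOp_apply, pderiv_rot, hja, hjb]

theorem weightOp_dIso (hab : a ≠ b) (f : MvPolynomial (Fin n) ℂ) :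
    weightOp a b (dIso a b f) = dIso a b (weightOp a b f) - dIso a b f := by
  simp only [weightOp_apply, dIso_apply, map_neg, map_sub, Derivation.map_smul, pderiv_rot, hab,
    hab.symm, if_true, if_false]
  linear_combination (norm := module) Complex.I_mul_I • pderiv a f

theorem weightOp_dIsoBar (hab : a ≠ b) (f : MvPolynomial (Fin n) ℂ) :
    weightOp a b (dIsoBar a b f) = dIsoBar a b (weightOp a b f) + dIsoBar a b f := by
  simp only [weightOp_apply, dIsoBar_apply, map_neg, map_add, Derivation.map_smul, pderiv_rot, hab,
    hab.symm, if_true, if_false]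
  linear_combination (norm := module) -(Complex.I_mul_I • pderiv a f)

theorem weightOp_raiseOp (hab : a ≠ b) (hja : j ≠ a) (hjb : j ≠ b)
    (f : MvPolynomial (Fin n) ℂ) :
    weightOp a b (raiseOp a b j f) = raiseOp a b j (weightOp a b f) + raiseOp a b j f := by
  have hX : weightOp a b (isoX a b) = isoX a b := by
    simp only [weightOp_apply, isoX, map_add, Derivation.map_smul, rot_apply, pderiv_X,
      Pi.single_apply, hab, hab.symm, if_true, if_false]
    linear_combination (norm := algebra) -(Complex.I_mul_I • (X a : MvPolynomial (Fin n) ℂ))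
  have hXj : weightOp a b (X j) = 0 := by
    simp [weightOp_apply, rot_apply, pderiv_X, hja, hjb]
  simp only [raiseOp_apply, map_sub, Derivation.leibniz, hX, hXj, weightOp_pderiv hja hjb,
    weightOp_dIsoBar hab, smul_eq_mul]
  ring

theorem eq_zero_of_pderiv_eq_zero (hf : f.IsHomogeneous k) (hk : k ≠ 0)
    (h : ∀ j, pderiv j f = 0) : f = 0 := by
  have euler := hf.sum_X_mul_pderiv
  simp only [h, mul_zero, Finset.sum_const_zero] at euler
  exact (smul_eq_zero.1 euler.symm).resolve_left hk

theorem isHomogeneous_dIso (hf : f.IsHomogeneous k) (a b : Fin n) :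
    (dIso a b f).IsHomogeneous (k - 1) := by
  rw [dIso_apply]
  exact hf.pderiv.sub ((homogeneousSubmodule _ _ _).smul_mem _ hf.pderiv)

theorem isHomogeneous_dIsoBar (hf : f.IsHomogeneous k) (a b : Fin n) :
    (dIsoBar a b f).IsHomogeneous (k - 1) := by
  rw [dIsoBar_apply]
  exact hf.pderiv.add ((homogeneousSubmodule _ _ _).smul_mem _ hf.pderiv)

theorem abs_re_weight_le (hab : a ≠ b) (hf : f.IsHomogeneous k) (h0 : f ≠ 0)
    (hα : weightOp a b f = α • f) : |α.re| ≤ k := by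
  induction k generalizing f α with
  | zero =>
    rw [totalDegree_eq_zero_iff_eq_C.1 ((totalDegree_zero_iff_isHomogeneous _).2 hf)] at hα h0
    have hα0 : α = 0 := (smul_eq_zero.1 (hα.symm.trans (by simp))).resolve_right h0
    simp [hα0]
  | succ k ih =>
    by_contra hlt
    rw [Nat.cast_succ, abs_le, not_and_or] at hlt
    -- A nonzero derivative of `f` has weight `α - 1`, `α + 1` or `α`.
    have hdIso : dIso a b f = 0 := by
      by_contra h
      have := ih (α := α - 1) (isHomogeneous_dIso hf a b) h
        (by rw [weightOp_dIso hab, hα, Derivation.map_smul]; module)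
      rw [Complex.sub_re, Complex.one_re, abs_le] at this
      grind
    have hdIsoBar : dIsoBar a b f = 0 := by
      by_contra h
      have := ih (α := α + 1) (isHomogeneous_dIsoBar hf a b) h
        (by rw [weightOp_dIsoBar hab, hα, Derivation.map_smul]; module)
      rw [Complex.add_re, Complex.one_re, abs_le] at this
      grind
    refine h0 (eq_zero_of_pderiv_eq_zero hf k.succ_ne_zero fun j => ?_)
    by_cases hja : j = a
    · rw [hja, pderiv_left_eq a b, hdIso, hdIsoBar, add_zero, smul_zero]
    by_cases hjb : j = b
    · rw [hjb, pderiv_right_eq a b, hdIso, hdIsoBar, sub_zero, smul_zero]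
    by_contra h
    have := ih (α := α) hf.pderiv h (by rw [weightOp_pderiv hja hjb, hα, Derivation.map_smul])
    rw [abs_le] at this
    grind

theorem exists_eq_smul_isoX_pow (hab : a ≠ b) (hf : f.IsHomogeneous k)
    (hbar : dIsoBar a b f = 0) (hd : ∀ j, j ≠ a → j ≠ b → pderiv j f = 0) :
    ∃ c : ℂ, f = c • isoX a b ^ k := by
  induction k generalizing f with
  | zero =>
    refine ⟨coeff 0 f, ?_⟩
    rw [pow_zero, smul_eq_C_mul, mul_one]
    exact totalDegree_eq_zero_iff_eq_C.1 ((totalDegree_zero_iff_isHomogeneous _).2 hf)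
  | succ k ih =>
    obtain ⟨c, hc⟩ := ih (isHomogeneous_dIso hf a b) (by rw [dIsoBar_dIso, hbar, map_zero])
      fun j hja hjb => by
        rw [dIso_apply, map_sub, Derivation.map_smul, pderiv_comm j a, pderiv_comm j b,
          hd j hja hjb]
        simp
    have euler : (k + 1 : ℂ) • f = (c / 2) • isoX a b ^ (k + 1) := by
      have h := hf.sum_X_mul_pderiv
      rw [Fintype.sum_eq_add a b hab fun j hj => by rw [hd j hj.1 hj.2, mul_zero],
        pderiv_left_eq a b, pderiv_right_eq a b f, hbar, hc, add_zero, sub_zero,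
        ← Nat.cast_smul_eq_nsmul ℂ, Nat.cast_succ] at h
      rw [← h, isoX]
      algebra
    exact ⟨(k + 1 : ℂ)⁻¹ * (c / 2), by
      rw [mul_smul, ← euler, inv_smul_smul₀ k.cast_add_one_ne_zero]⟩

theorem isoX_mul_pderiv_pderiv (hja : j ≠ a) (hjb : j ≠ b) (hr : raiseOp a b j f = 0) :
    isoX a b * pderiv j (pderiv j f) = dIsoBar a b f + X j * pderiv j (dIsoBar a b f) := by
  have h := congrArg (pderiv j) (sub_eq_zero.1 ((raiseOp_apply a b j f).symm.trans hr))
  simp only [Derivation.leibniz, pderiv_X_self, pderiv_isoX hja hjb, smul_eq_mul, mul_zero,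
    add_zero, mul_one] at h
  rw [h, add_comm]

theorem isoX_mul_laplacian (hab : a ≠ b) (hr : ∀ j, j ≠ a → j ≠ b → raiseOp a b j f = 0) :
    isoX a b * laplacian n f = ∑ j, X j * pderiv j (dIsoBar a b f)
      + weightOp a b (dIsoBar a b f) + (n - 2 : ℂ) • dIsoBar a b f := by
  set g := dIsoBar a b f
  have hne : ∀ j ∈ ({a, b}ᶜ : Finset (Fin n)), j ≠ a ∧ j ≠ b := fun j hj => by simpa using hj
  have hcard : ((({a, b}ᶜ : Finset (Fin n)).card : ℕ) : ℂ) = n - 2 := by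
    rw [Finset.card_compl, Fintype.card_fin, Finset.card_pair hab, Nat.cast_sub, Nat.cast_ofNat]
    simpa [Finset.card_pair hab] using Finset.card_le_univ ({a, b} : Finset (Fin n))
  have hcompl : isoX a b * ∑ j ∈ {a, b}ᶜ, pderiv j (pderiv j f)
      = (n - 2 : ℂ) • g + ∑ j ∈ {a, b}ᶜ, X j * pderiv j g := by
    rw [Finset.mul_sum, ← hcard, Nat.cast_smul_eq_nsmul, ← Finset.sum_const,
      ← Finset.sum_add_distrib]
    exact Finset.sum_congr rfl fun j hj =>
      isoX_mul_pderiv_pderiv (hne j hj).1 (hne j hj).2 (hr j (hne j hj).1 (hne j hj).2)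
  rw [laplacian_apply, ← Finset.sum_add_sum_compl {a, b}, ← Finset.sum_add_sum_compl {a, b},
    Finset.sum_pair hab, Finset.sum_pair hab, mul_add, hcompl, ← dIso_dIsoBar, isoX_mul_dIso]
  ring

theorem dIsoBar_eq_zero_of_raiseOp_eq_zero (hn : 3 ≤ n) (hab : a ≠ b)
    (hf : f ∈ harmonicPoly n k) (h0 : f ≠ 0) (hα : weightOp a b f = α • f)
    (hr : ∀ j, j ≠ a → j ≠ b → raiseOp a b j f = 0) : dIsoBar a b f = 0 := by
  have hlap := isoX_mul_laplacian hab hr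
  rw [(mem_harmonicPoly.1 hf).2, mul_zero,
    (isHomogeneous_dIsoBar hf.1 a b).sum_X_mul_pderiv, weightOp_dIsoBar hab, hα,
    Derivation.map_smul, ← Nat.cast_smul_eq_nsmul ℂ] at hlap
  have hzero : (((k - 1 : ℕ) : ℂ) + α + n - 1) • dIsoBar a b f = 0 := by
    linear_combination (norm := module) -hlap
  refine (smul_eq_zero.1 hzero).resolve_left fun h => ?_
  have hre := congrArg Complex.re h
  simp only [Complex.add_re, Complex.sub_re, Complex.natCast_re, Complex.one_re,
    Complex.zero_re] at hre
  have hweight := abs_le.1 (abs_re_weight_le hab hf.1 h0 hα)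
  have hk : (k : ℝ) ≤ (k - 1 : ℕ) + 1 := by exact_mod_cast Nat.le_add_of_sub_le le_rfl
  have hn' : (3 : ℝ) ≤ n := by exact_mod_cast hn
  linarith [hweight.1]

theorem exists_eq_smul_isoX_pow_of_raiseOp_eq_zero (hn : 3 ≤ n) (hab : a ≠ b)
    (hf : f ∈ harmonicPoly n k) (h0 : f ≠ 0) (hα : weightOp a b f = α • f)
    (hr : ∀ j, j ≠ a → j ≠ b → raiseOp a b j f = 0) : ∃ c : ℂ, f = c • isoX a b ^ k := by
  have hbar := dIsoBar_eq_zero_of_raiseOp_eq_zero hn hab hf h0 hα hr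
  refine exists_eq_smul_isoX_pow hab hf.1 hbar fun j hja hjb => ?_
  have h := hr j hja hjb
  rw [raiseOp_apply, hbar, mul_zero, sub_zero] at h
  exact (mul_eq_zero.1 h).resolve_left (isoX_ne_zero hab)

end HighestWeight

section Schur

variable {n k : ℕ} {W : Submodule ℂ (MvPolynomial (Fin n) ℂ)}

instance finiteDimensional_harmonicPoly (n k : ℕ) : FiniteDimensional ℂ (harmonicPoly n k) := by
  have : FiniteDimensional ℂ (homogeneousSubmodule (Fin n) ℂ k) :=
    Module.Finite.iff_fg.2 (homogeneousSubmodule_fg (Fin n) ℂ k)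
  exact Submodule.finiteDimensional_of_le inf_le_left

/-- `W` is stable under the infinitesimal rotations, that is, a subrepresentation of `so(n)`. -/
def RotStable (W : Submodule ℂ (MvPolynomial (Fin n) ℂ)) : Prop :=
  ∀ i j, ∀ f ∈ W, rot i j f ∈ W

theorem RotStable.exists_highest_weight [FiniteDimensional ℂ W] (hW : RotStable W) (h0 : W ≠ ⊥)
    {a b : Fin n} (hab : a ≠ b) :
    ∃ f ∈ W, f ≠ 0 ∧ (∃ α : ℂ, weightOp a b f = α • f) ∧
      ∀ j, j ≠ a → j ≠ b → raiseOp a b j f = 0 := by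
  have hweight : ∀ f ∈ W, weightOp a b f ∈ W := fun f hf => by
    rw [weightOp_apply]
    exact W.neg_mem (W.smul_mem _ (hW a b f hf))
  have hraise : ∀ j, ∀ f ∈ W, raiseOp a b j f ∈ W := fun j f hf =>
    W.add_mem (hW a j f hf) (W.smul_mem _ (hW b j f hf))
  have : Nontrivial W := Submodule.nontrivial_iff_ne_bot.2 h0
  let H : Module.End ℂ W :=
    (weightOp a b : MvPolynomial (Fin n) ℂ →ₗ[ℂ] MvPolynomial (Fin n) ℂ).restrict hweight
  obtain ⟨α, hα, hmax⟩ := Set.exists_max_image {α | H.HasEigenvalue α} Complex.re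
    (Module.End.finite_hasEigenvalue H) (Module.End.exists_eigenvalue H)
  obtain ⟨f, hf, hf0⟩ := hα.exists_hasEigenvector
  have hfα : weightOp a b f = α • (f : MvPolynomial (Fin n) ℂ) :=
    congrArg Subtype.val (Module.End.mem_eigenspace_iff.1 hf)
  refine ⟨f, f.2, by simpa using hf0, ⟨α, hfα⟩, fun j hja hjb => ?_⟩
  by_contra hne
  have hα1 : H.HasEigenvalue (α + 1) := Module.End.hasEigenvalue_of_hasEigenvector
    (x := ⟨raiseOp a b j f, hraise j f f.2⟩)
    ⟨Module.End.mem_eigenspace_iff.2 (Subtype.ext <| (weightOp_raiseOp hab hja hjb _).trans <| by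
      rw [hfα, Derivation.map_smul, add_smul, one_smul]; rfl), by simpa using hne⟩
  exact absurd (hmax _ hα1) (by norm_num)

theorem RotStable.isoX_pow_mem (hn : 3 ≤ n) (hW : RotStable W) (hle : W ≤ harmonicPoly n k)
    (h0 : W ≠ ⊥) {a b : Fin n} (hab : a ≠ b) : isoX a b ^ k ∈ W := by
  have : FiniteDimensional ℂ W := Submodule.finiteDimensional_of_le hle
  obtain ⟨f, hfW, hf0, ⟨α, hα⟩, hr⟩ := hW.exists_highest_weight h0 hab
  obtain ⟨c, rfl⟩ := exists_eq_smul_isoX_pow_of_raiseOp_eq_zero hn hab (hle hfW) hf0 hα hr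
  exact (W.smul_mem_iff (left_ne_zero_of_smul hf0)).1 hfW

theorem RotStable.inf {W' : Submodule ℂ (MvPolynomial (Fin n) ℂ)} (hW : RotStable W)
    (hW' : RotStable W') : RotStable (W ⊓ W') :=
  fun i j f hf => ⟨hW i j f hf.1, hW' i j f hf.2⟩

theorem rotStable_harmonicPoly (n k : ℕ) : RotStable (harmonicPoly n k) :=
  fun i j _ hf => rot_mem_harmonicPoly hf i j

theorem RotStable.orthogonalBilin {B : MvPolynomial (Fin n) ℂ →ₗ⋆[ℂ] MvPolynomial (Fin n) ℂ →ₗ[ℂ] ℂ}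
    (hW : RotStable W) (hB : RotInvariant B) : RotStable (W.orthogonalBilin B) :=
  fun i j f hf g hg => by
    rw [← neg_eq_zero, ← hB i j g f]
    exact hf _ (hW i j g hg)

theorem exists_mem_ne_zero_forall_apply_eq_zero {K V : Type*} [Field K] [AddCommGroup V]
    [Module K V] {σ : K →+* K} (B : V →ₛₗ[σ] V →ₗ[K] K) {W H : Submodule K V}
    [FiniteDimensional K H] (hlt : W < H) : ∃ v ∈ H, v ≠ 0 ∧ v ∈ W.orthogonalBilin B := by
  have : FiniteDimensional K W := Submodule.finiteDimensional_of_le hlt.le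
  let e := Module.finBasis K W
  let φ : H →ₗ[K] (Fin (Module.finrank K W) → K) := LinearMap.pi fun i => B (e i) ∘ₗ H.subtype
  have hφ : LinearMap.ker φ ≠ ⊥ := LinearMap.ker_ne_bot_of_finrank_lt (by
    rw [Module.finrank_fin_fun]
    exact Submodule.finrank_lt_finrank_of_lt hlt)
  obtain ⟨v, hv, hv0⟩ := (Submodule.ne_bot_iff _).1 hφ
  refine ⟨v, v.2, by simpa using hv0, fun w hw => ?_⟩
  have hW : (B.flip v).comp W.subtype = 0 := e.ext fun i => congrFun (LinearMap.mem_ker.1 hv) i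
  exact LinearMap.congr_fun hW ⟨w, hw⟩

theorem RotStable.eq_harmonicPoly (hn : 3 ≤ n) (hW : RotStable W) (hle : W ≤ harmonicPoly n k)
    (h0 : W ≠ ⊥) {B : MvPolynomial (Fin n) ℂ →ₗ⋆[ℂ] MvPolynomial (Fin n) ℂ →ₗ[ℂ] ℂ}
    (hB : RotInvariant B) (haniso : ∀ p ∈ harmonicPoly n k, B p p = 0 → p = 0) :
    W = harmonicPoly n k := by
  by_contra hne
  -- Otherwise `W` and its orthogonal complement share the highest weight vector.
  obtain ⟨p, hpH, hp0, hpW⟩ := exists_mem_ne_zero_forall_apply_eq_zero B (lt_of_le_of_ne hle hne)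
  have hab : (⟨0, by omega⟩ : Fin n) ≠ ⟨1, by omega⟩ := by simp
  have hmem := hW.isoX_pow_mem hn hle h0 hab
  have hmem' := ((rotStable_harmonicPoly n k).inf (hW.orthogonalBilin hB)).isoX_pow_mem hn
    inf_le_left ((Submodule.ne_bot_iff _).2 ⟨p, ⟨hpH, hpW⟩, hp0⟩) hab
  exact pow_ne_zero k (isoX_ne_zero hab) (haniso _ hmem'.1 (hmem'.2 _ hmem))

theorem RotInvariant.apply_eq_zero_of_exists (hn : 3 ≤ n)
    {B D : MvPolynomial (Fin n) ℂ →ₗ⋆[ℂ] MvPolynomial (Fin n) ℂ →ₗ[ℂ] ℂ} (hB : RotInvariant B)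
    (haniso : ∀ p ∈ harmonicPoly n k, B p p = 0 → p = 0) (hD : RotInvariant D)
    (h : ∃ q ∈ harmonicPoly n k, q ≠ 0 ∧ ∀ p ∈ harmonicPoly n k, D p q = 0)
    {p q : MvPolynomial (Fin n) ℂ} (hp : p ∈ harmonicPoly n k) (hq : q ∈ harmonicPoly n k) :
    D p q = 0 := by
  obtain ⟨q₀, hq₀, hne, hker⟩ := h
  have hstable := (rotStable_harmonicPoly n k).inf ((rotStable_harmonicPoly n k).orthogonalBilin hD)
  have heq := hstable.eq_harmonicPoly hn inf_le_left
    ((Submodule.ne_bot_iff _).2 ⟨q₀, ⟨hq₀, hker⟩, hne⟩) hB haniso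
  exact (heq.ge hq).2 p hp

theorem RotInvariant.compl_mul_quad_pow
    {B : MvPolynomial (Fin n) ℂ →ₗ⋆[ℂ] MvPolynomial (Fin n) ℂ →ₗ[ℂ] ℂ} (hB : RotInvariant B)
    (m : ℕ) : RotInvariant ((B.comp (LinearMap.mulRight ℂ (quad n ^ m))).compl₂
      (LinearMap.mulRight ℂ (quad n ^ m))) := fun i j p q => by
  simp only [LinearMap.compl₂_apply, LinearMap.comp_apply, LinearMap.mulRight_apply,
    ← rot_mul_quad_pow, hB i j]

end Schur

/-! ## The moment map -/

section MomentMap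

variable {n : ℕ}

/-- The real linear functional `∑ (P_j dz_j + Q_j dz̄_j)`. -/
def wirtCLM (P Q : Fin n → ℂ) : (Fin n → ℂ) →L[ℝ] ℂ :=
  ∑ j, (P j • (ContinuousLinearMap.proj j : (Fin n → ℂ) →L[ℝ] ℂ)
    + Q j • ((Complex.conjCLE : ℂ →L[ℝ] ℂ) ∘L (ContinuousLinearMap.proj j : (Fin n → ℂ) →L[ℝ] ℂ)))

theorem wirtCLM_apply (P Q u : Fin n → ℂ) :
    wirtCLM P Q u = ∑ j, (P j * u j + Q j * conj (u j)) := by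
  simp [wirtCLM]

/-- `F` is real differentiable at `z` with Wirtinger derivatives `P` and `Q`. -/
def HasWirtAt (F : (Fin n → ℂ) → ℂ) (P Q z : Fin n → ℂ) : Prop := HasFDerivAt F (wirtCLM P Q) z

variable {F G : (Fin n → ℂ) → ℂ} {P Q P' Q' z : Fin n → ℂ}

theorem HasWirtAt.congr_coeff (h : HasWirtAt F P Q z) (hP : ∀ j, P j = P' j)
    (hQ : ∀ j, Q j = Q' j) : HasWirtAt F P' Q' z := by
  rwa [← funext hP, ← funext hQ]

theorem HasWirtAt.wirtinger_eq (h : HasWirtAt F P Q z) (j : Fin n) : wirtinger j F z = P j := by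
  rw [wirtinger, HasFDerivAt.fderiv h, wirtCLM_apply, wirtCLM_apply,
    Finset.sum_eq_single j (fun i _ hi => by simp [hi]) (by simp),
    Finset.sum_eq_single j (fun i _ hi => by simp [hi]) (by simp)]
  simp only [Pi.single_eq_same, map_one, mul_one, Complex.conj_I]
  linear_combination ((Q j - P j) / 2) * Complex.I_mul_I

theorem HasWirtAt.wirtingerBar_eq (h : HasWirtAt F P Q z) (j : Fin n) :
    wirtingerBar j F z = Q j := by
  rw [wirtingerBar, HasFDerivAt.fderiv h, wirtCLM_apply, wirtCLM_apply,
    Finset.sum_eq_single j (fun i _ hi => by simp [hi]) (by simp),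
    Finset.sum_eq_single j (fun i _ hi => by simp [hi]) (by simp)]
  simp only [Pi.single_eq_same, map_one, mul_one, Complex.conj_I]
  linear_combination (-(Q j - P j) / 2) * Complex.I_mul_I

theorem hasWirtAt_const (c : ℂ) (z : Fin n → ℂ) : HasWirtAt (fun _ => c) 0 0 z := by
  refine (hasFDerivAt_const c z).congr_fderiv ?_
  ext u
  simp [wirtCLM_apply]

theorem hasWirtAt_coord (j : Fin n) (z : Fin n → ℂ) :
    HasWirtAt (fun w => w j) (Pi.single j 1) 0 z := by
  refine (ContinuousLinearMap.proj (R := ℝ) (φ := fun _ : Fin n => ℂ) j).hasFDerivAt.congr_fderiv ?_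
  ext u
  simp [wirtCLM_apply, Pi.single_apply]

theorem hasWirtAt_conj_coord (j : Fin n) (z : Fin n → ℂ) :
    HasWirtAt (fun w => conj (w j)) 0 (Pi.single j 1) z := by
  refine ((Complex.conjCLE : ℂ →L[ℝ] ℂ) ∘L
    (ContinuousLinearMap.proj (R := ℝ) (φ := fun _ : Fin n => ℂ) j)).hasFDerivAt.congr_fderiv ?_
  ext u
  simp [wirtCLM_apply, Pi.single_apply]

theorem HasWirtAt.add (hF : HasWirtAt F P Q z) (hG : HasWirtAt G P' Q' z) :
    HasWirtAt (fun w => F w + G w) (P + P') (Q + Q') z := by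
  refine (HasFDerivAt.add hF hG).congr_fderiv ?_
  ext u
  simp only [wirtCLM_apply, _root_.add_apply, ← Finset.sum_add_distrib, Pi.add_apply]
  exact Finset.sum_congr rfl fun j _ => by ring

theorem HasWirtAt.mul (hF : HasWirtAt F P Q z) (hG : HasWirtAt G P' Q' z) :
    HasWirtAt (fun w => F w * G w) (F z • P' + G z • P) (F z • Q' + G z • Q) z := by
  refine (HasFDerivAt.mul hF hG).congr_fderiv ?_
  ext u
  simp only [wirtCLM_apply, _root_.add_apply, _root_.smul_apply,
    smul_eq_mul, Finset.mul_sum, ← Finset.sum_add_distrib, Pi.add_apply, Pi.smul_apply]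
  exact Finset.sum_congr rfl fun j _ => by ring

theorem HasWirtAt.const_mul (c : ℂ) (hF : HasWirtAt F P Q z) :
    HasWirtAt (fun w => c * F w) (c • P) (c • Q) z :=
  ((hasWirtAt_const c z).mul hF).congr_coeff (by simp) (by simp)

theorem HasWirtAt.sub (hF : HasWirtAt F P Q z) (hG : HasWirtAt G P' Q' z) :
    HasWirtAt (fun w => F w - G w) (P - P') (Q - Q') z := by
  refine (HasFDerivAt.sub hF hG).congr_fderiv ?_
  ext u
  simp only [wirtCLM_apply, _root_.sub_apply, ← Finset.sum_sub_distrib, Pi.sub_apply]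
  exact Finset.sum_congr rfl fun j _ => by ring

theorem HasWirtAt.sum {ι : Type*} {s : Finset ι} {F : ι → (Fin n → ℂ) → ℂ} {P Q : ι → Fin n → ℂ}
    (h : ∀ i ∈ s, HasWirtAt (F i) (P i) (Q i) z) :
    HasWirtAt (fun w => ∑ i ∈ s, F i w) (∑ i ∈ s, P i) (∑ i ∈ s, Q i) z := by
  refine (HasFDerivAt.fun_sum h).congr_fderiv ?_
  ext u
  simp only [wirtCLM_apply, _root_.sum_apply, Finset.sum_apply, Finset.sum_mul,
    ← Finset.sum_add_distrib]
  exact Finset.sum_comm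

theorem HasWirtAt.comp_hasDerivAt {g : ℂ → ℂ} {g' : ℂ} (hg : HasDerivAt g g' (F z))
    (hF : HasWirtAt F P Q z) : HasWirtAt (fun w => g (F w)) (g' • P) (g' • Q) z := by
  refine ((hg.hasFDerivAt.restrictScalars ℝ).comp z hF).congr_fderiv ?_
  ext u
  simp only [wirtCLM_apply, ContinuousLinearMap.comp_apply, Finset.sum_mul,
    ContinuousLinearMap.coe_restrictScalars', ContinuousLinearMap.toSpanSingleton_apply,
    smul_eq_mul, Pi.smul_apply]
  exact Finset.sum_congr rfl fun j _ => by ring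

theorem conj_dot (z w : Fin n → ℂ) :
    conj (dot z w) = dot (fun j => conj (z j)) fun j => conj (w j) := by
  simp [dot]

theorem ofReal_absSq (z : Fin n → ℂ) : (absSq z : ℂ) = dot z fun j => conj (z j) := by
  simp [absSq, dot, Complex.mul_conj']

theorem ofReal_norm_dot_sq (z : Fin n → ℂ) :
    ((‖dot z z‖ ^ 2 : ℝ) : ℂ) = dot z z * conj (dot z z) := by
  rw [Complex.mul_conj']
  norm_cast

theorem ofReal_Delta (z : Fin n → ℂ) :
    (Delta z : ℂ) = 1 - 2 * dot z (fun j => conj (z j)) + dot z z * conj (dot z z) := by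
  rw [Delta, Complex.ofReal_add, ofReal_norm_dot_sq, Complex.ofReal_sub, Complex.ofReal_mul,
    ofReal_absSq]
  simp

theorem hasWirtAt_dot_self (z : Fin n → ℂ) : HasWirtAt (fun w => dot w w) ((2 : ℂ) • z) 0 z := by
  refine (HasWirtAt.sum fun j (_ : j ∈ Finset.univ) =>
    (hasWirtAt_coord j z).mul (hasWirtAt_coord j z)).congr_coeff ?_ ?_
  · intro j
    simp [Finset.sum_add_distrib, Pi.single_apply, two_mul]
  · simp

theorem hasWirtAt_conj_dot_self (z : Fin n → ℂ) :
    HasWirtAt (fun w => conj (dot w w)) 0 ((2 : ℂ) • fun j => conj (z j)) z := by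
  simp_rw [conj_dot]
  refine (HasWirtAt.sum fun j (_ : j ∈ Finset.univ) =>
    (hasWirtAt_conj_coord j z).mul (hasWirtAt_conj_coord j z)).congr_coeff ?_ ?_
  · simp
  · intro j
    simp [Finset.sum_add_distrib, Pi.single_apply, two_mul]

theorem hasWirtAt_absSq (z : Fin n → ℂ) :
    HasWirtAt (fun w => dot w fun j => conj (w j)) (fun j => conj (z j)) z z := by
  refine (HasWirtAt.sum fun j (_ : j ∈ Finset.univ) =>
    (hasWirtAt_coord j z).mul (hasWirtAt_conj_coord j z)).congr_coeff ?_ ?_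
  · intro j
    simp [Pi.single_apply]
  · intro j
    simp [Pi.single_apply]

/-- The Wirtinger derivative `∂Δ/∂z_j`; since `Δ` is real, `∂Δ/∂z̄_j` is its conjugate. -/
def dDelta (z : Fin n → ℂ) (j : Fin n) : ℂ := 2 * z j * conj (dot z z) - 2 * conj (z j)

theorem hasWirtAt_Delta (z : Fin n → ℂ) :
    HasWirtAt (fun w => (Delta w : ℂ)) (dDelta z) (fun j => conj (dDelta z j)) z := by
  simp_rw [ofReal_Delta]
  refine (((hasWirtAt_const 1 z).sub ((hasWirtAt_absSq z).const_mul 2)).add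
    ((hasWirtAt_dot_self z).mul (hasWirtAt_conj_dot_self z))).congr_coeff ?_ ?_ <;> intro j
  · simp only [dDelta, Pi.add_apply, Pi.sub_apply, Pi.smul_apply, Pi.zero_apply, smul_eq_mul]
    ring
  · simp only [dDelta, Pi.add_apply, Pi.sub_apply, Pi.smul_apply, Pi.zero_apply, smul_eq_mul,
      map_sub, map_mul, Complex.conj_conj, map_ofNat]
    ring

theorem ofReal_Delta_ne_zero {z : Fin n → ℂ} (hz : z ∈ domain n) : (Delta z : ℂ) ≠ 0 :=
  Complex.ofReal_ne_zero.2 (Delta_pos hz).ne'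

theorem log_bergmanKernel {z : Fin n → ℂ} (hz : z ∈ domain n) :
    Complex.log (bergmanKernel n z z) = -n * Complex.log (Delta z : ℂ) := by
  have hD := Delta_pos hz
  rw [bergmanKernel, ← ofReal_Delta, ← Complex.ofReal_pow, ← Complex.ofReal_inv,
    ← Complex.ofReal_log (by positivity), ← Complex.ofReal_log hD.le, Real.log_inv, Real.log_pow]
  push_cast
  ring

theorem wirtingerBar_log_bergmanKernel {z : Fin n → ℂ} (hz : z ∈ domain n) (k : Fin n) :
    wirtingerBar k (fun w => Complex.log (bergmanKernel n w w)) z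
      = -n * (conj (dDelta z k) * (Delta z : ℂ)⁻¹) := by
  have hlog := (HasWirtAt.comp_hasDerivAt
    (Complex.hasDerivAt_log (Complex.ofReal_mem_slitPlane.2 (Delta_pos hz)))
    (hasWirtAt_Delta z)).const_mul (-(n : ℂ))
  have hkernel : HasWirtAt (fun w => Complex.log (bergmanKernel n w w)) _ _ z :=
    HasFDerivAt.congr_of_eventuallyEq hlog (by
      filter_upwards [(isOpen_domain n).mem_nhds hz] with w hw using log_bergmanKernel hw)
  rw [hkernel.wirtingerBar_eq]
  simp only [Pi.smul_apply, smul_eq_mul]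
  ring

theorem hasWirtAt_conj_dDelta (z : Fin n → ℂ) (k : Fin n) :
    HasWirtAt (fun w => conj (dDelta w k))
      (fun j => 4 * z j * conj (z k) - if j = k then 2 else 0)
      (fun j => if j = k then 2 * dot z z else 0) z := by
  simp only [dDelta, map_sub, map_mul, Complex.conj_conj, map_ofNat]
  refine ((((hasWirtAt_conj_coord k z).const_mul 2).mul (hasWirtAt_dot_self z)).sub
    ((hasWirtAt_coord k z).const_mul 2)).congr_coeff ?_ ?_ <;> intro j
  · simp only [Pi.sub_apply, Pi.add_apply, Pi.smul_apply, Pi.zero_apply, smul_eq_mul,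
      Pi.single_apply]
    split_ifs <;> ring
  · simp only [Pi.sub_apply, Pi.add_apply, Pi.smul_apply, Pi.zero_apply, smul_eq_mul,
      Pi.single_apply]
    split_ifs <;> ring

theorem metricCoeff_eq (hn : n ≠ 0) {z : Fin n → ℂ} (hz : z ∈ domain n) (j k : Fin n) :
    metricCoeff n j k z = ((if j = k then 1 else 0) - 2 * z j * conj (z k)) / Delta z
      + dDelta z j * conj (dDelta z k) / (2 * (Delta z : ℂ) ^ 2) := by
  have hD := ofReal_Delta_ne_zero hz
  have hquot := ((hasWirtAt_conj_dDelta z k).mul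
    (HasWirtAt.comp_hasDerivAt (hasDerivAt_inv hD) (hasWirtAt_Delta z))).const_mul (-(n : ℂ))
  have hlog : HasWirtAt
      (wirtingerBar k fun w => Complex.log (bergmanKernel n w w)) _ _ z :=
    HasFDerivAt.congr_of_eventuallyEq hquot (by
      filter_upwards [(isOpen_domain n).mem_nhds hz] with w hw using
        wirtingerBar_log_bergmanKernel hw k)
  have hn' : (n : ℂ) ≠ 0 := Nat.cast_ne_zero.2 hn
  rw [metricCoeff, hlog.wirtinger_eq]
  simp only [Pi.smul_apply, Pi.add_apply, smul_eq_mul]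
  split_ifs <;> field_simp <;> ring

theorem conj_metricCoeff (hn : n ≠ 0) {z : Fin n → ℂ} (hz : z ∈ domain n) (j k : Fin n) :
    conj (metricCoeff n j k z) = metricCoeff n k j z := by
  simp only [metricCoeff_eq hn hz, map_add, map_sub, map_mul, map_div₀, map_pow, map_ofNat,
    Complex.conj_conj, Complex.conj_ofReal, apply_ite conj, map_one, map_zero, eq_comm (a := k)]
  ring

/-- The Wirtinger derivative of `momentMapSO2` with respect to `z_j`. -/
def dMomentMapSO2 (z : Fin n → ℂ) (j : Fin n) : ℂ :=
  ((2 * z j * conj (dot z z) - conj (z j)) * Delta z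
    - (dot z z * conj (dot z z) - dot z fun j => conj (z j)) * dDelta z j) / (Delta z : ℂ) ^ 2

theorem hasWirtAt_momentMapSO2 {z : Fin n → ℂ} (hz : z ∈ domain n) :
    HasWirtAt (fun w => (momentMapSO2 n w : ℂ)) (dMomentMapSO2 z)
      (fun j => conj (dMomentMapSO2 z j)) z := by
  have hD := ofReal_Delta_ne_zero hz
  have hquot : (fun w : Fin n → ℂ => (momentMapSO2 n w : ℂ)) = fun w =>
      (dot w w * conj (dot w w) - dot w fun j => conj (w j)) * (Delta w : ℂ)⁻¹ := by
    funext w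
    rw [momentMapSO2, Complex.ofReal_div, Complex.ofReal_sub, ofReal_norm_dot_sq, ofReal_absSq,
      div_eq_mul_inv, Delta]
    congr 3
    ring
  rw [hquot]
  refine ((((hasWirtAt_dot_self z).mul (hasWirtAt_conj_dot_self z)).sub (hasWirtAt_absSq z)).mul
    (HasWirtAt.comp_hasDerivAt (hasDerivAt_inv hD) (hasWirtAt_Delta z))).congr_coeff ?_ ?_
      <;> intro j
  · simp only [dMomentMapSO2, Pi.add_apply, Pi.sub_apply, Pi.smul_apply, Pi.zero_apply, smul_eq_mul]
    field_simp
    ring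
  · simp only [dMomentMapSO2, Pi.add_apply, Pi.sub_apply, Pi.smul_apply, Pi.zero_apply,
      smul_eq_mul, map_sub, map_mul, map_div₀, map_pow, map_ofNat, Complex.conj_conj,
      Complex.conj_ofReal, ← ofReal_absSq]
    field_simp
    ring

theorem sum_conj_dDelta_mul (z : Fin n → ℂ) :
    ∑ k, conj (dDelta z k) * conj (z k)
      = 2 * (dot z z * conj (dot z z) - dot z fun j => conj (z j)) := by
  simp only [dDelta, map_sub, map_mul, Complex.conj_conj, map_ofNat]
  rw [conj_dot]
  generalize dot z z = s
  simp only [dot, Finset.mul_sum, mul_sub, ← Finset.sum_sub_distrib]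
  exact Finset.sum_congr rfl fun k _ => by ring

/-- Since `∑ z̄_k ∂/∂z̄_k (log Δ) = 2 μ`, contracting `g_{jk} = -½ ∂_j ∂̄_k log Δ` with `z̄_k` gives
`-∂_j μ`. -/
theorem sum_metricCoeff_mul_conj (hn : n ≠ 0) {z : Fin n → ℂ} (hz : z ∈ domain n) (j : Fin n) :
    ∑ k, metricCoeff n j k z * conj (z k) = -dMomentMapSO2 z j := by
  have hD := ofReal_Delta_ne_zero hz
  have hdelta : ∑ k, (if j = k then conj (z k) else 0) = conj (z j) := by simp
  have hdot : ∑ k, conj (z k) * conj (z k) = conj (dot z z) := (conj_dot z z).symm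
  calc ∑ k, metricCoeff n j k z * conj (z k)
      = ∑ k, ((if j = k then conj (z k) else 0) / Delta z
          - 2 * z j / Delta z * (conj (z k) * conj (z k))
          + dDelta z j / (2 * (Delta z : ℂ) ^ 2) * (conj (dDelta z k) * conj (z k))) := by
        refine Finset.sum_congr rfl fun k _ => ?_
        rw [metricCoeff_eq hn hz]
        split_ifs <;> ring
    _ = (conj (z j) - 2 * z j * conj (dot z z)) / Delta z + dDelta z j / (Delta z : ℂ) ^ 2
          * (dot z z * conj (dot z z) - dot z fun j => conj (z j)) := by
        rw [Finset.sum_add_distrib, Finset.sum_sub_distrib, ← Finset.sum_div, ← Finset.mul_sum,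
          ← Finset.mul_sum, hdelta, hdot, sum_conj_dDelta_mul]
        field_simp
    _ = -dMomentMapSO2 z j := by
        rw [dMomentMapSO2]
        field_simp
        ring

theorem sum_metricCoeff_mul (hn : n ≠ 0) {z : Fin n → ℂ} (hz : z ∈ domain n) (k : Fin n) :
    ∑ j, metricCoeff n j k z * z j = -conj (dMomentMapSO2 z k) := by
  rw [← map_neg, ← sum_metricCoeff_mul_conj hn hz, map_sum]
  simp only [map_mul, conj_metricCoeff hn hz, Complex.conj_conj]

theorem symplecticForm_I_smul_left (hn : n ≠ 0) {z : Fin n → ℂ} (hz : z ∈ domain n) (X : ℝ)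
    (u : Fin n → ℂ) :
    symplecticForm n z ((Complex.I * X) • z) u
      = X * wirtCLM (dMomentMapSO2 z) (fun j => conj (dMomentMapSO2 z j)) u := by
  have hcontract : ∑ j, ∑ k, metricCoeff n j k z *
      (((Complex.I * X) • z) j * conj (u k) - u j * conj (((Complex.I * X) • z) k))
      = Complex.I * X * (∑ k, (∑ j, metricCoeff n j k z * z j) * conj (u k)
        + ∑ j, (∑ k, metricCoeff n j k z * conj (z k)) * u j) := by
    simp only [Finset.sum_mul]
    rw [Finset.sum_comm (f := fun k j => metricCoeff n j k z * z j * conj (u k)),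
      ← Finset.sum_add_distrib, Finset.mul_sum]
    refine Finset.sum_congr rfl fun j _ => ?_
    rw [← Finset.sum_add_distrib, Finset.mul_sum]
    refine Finset.sum_congr rfl fun k _ => ?_
    simp only [Pi.smul_apply, smul_eq_mul, map_mul, Complex.conj_I, Complex.conj_ofReal]
    ring
  rw [symplecticForm, hcontract]
  simp only [sum_metricCoeff_mul hn hz, sum_metricCoeff_mul_conj hn hz, neg_mul,
    Finset.sum_neg_distrib, wirtCLM_apply, Finset.sum_add_distrib]
  linear_combination (-X * (∑ j, dMomentMapSO2 z j * u j
    + ∑ j, conj (dMomentMapSO2 z j) * conj (u j))) * Complex.I_mul_I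

theorem inducedField_eq (X : ℝ) (z : Fin n → ℂ) : inducedField X z = (Complex.I * X) • z := by
  have h : HasDerivAt (fun r : ℝ => (Circle.exp (r * X) : ℂ) • z) ((Complex.I * X) • z) 0 := by
    have hline : HasDerivAt (fun r : ℝ => ((r * X : ℝ) : ℂ) * Complex.I) (X * Complex.I) 0 := by
      simpa using (((hasDerivAt_id (0 : ℝ)).mul_const X).ofReal_comp).mul_const Complex.I
    simpa [Circle.coe_exp, mul_comm] using hline.cexp.smul_const z
  exact h.deriv

theorem contDiffOn_momentMapSO2 (n : ℕ) :
    ContDiffOn ℝ (⊤ : ℕ∞) (momentMapSO2 n) (domain n) := by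
  have habsSq : ContDiff ℝ (⊤ : ℕ∞) (absSq : (Fin n → ℂ) → ℝ) := by
    unfold absSq
    exact ContDiff.sum fun j _ => (contDiff_apply ℝ ℂ j).norm_sq ℝ
  have hdot : ContDiff ℝ (⊤ : ℕ∞) (fun z : Fin n → ℂ => ‖dot z z‖ ^ 2) := by
    refine ContDiff.norm_sq ℝ ?_
    unfold dot
    exact ContDiff.sum fun j _ => (contDiff_apply ℝ ℂ j).mul (contDiff_apply ℝ ℂ j)
  refine ContDiffOn.div (hdot.sub habsSq).contDiffOn
    ((contDiff_const.add hdot).sub (contDiff_const.mul habsSq)).contDiffOn fun z hz => ?_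
  exact (sub_pos.2 hz.2).ne'

theorem dot_smul_smul (c : ℂ) (z : Fin n → ℂ) : dot (c • z) (c • z) = c ^ 2 * dot z z := by
  simp only [dot, Finset.mul_sum, Pi.smul_apply, smul_eq_mul]
  exact Finset.sum_congr rfl fun j _ => by ring

theorem absSq_smul (c : ℂ) (z : Fin n → ℂ) : absSq (c • z) = ‖c‖ ^ 2 * absSq z := by
  simp only [absSq, Finset.mul_sum, Pi.smul_apply, norm_smul, mul_pow]

theorem norm_dot_smul_smul (c : ℂ) (z : Fin n → ℂ) :
    ‖dot (c • z) (c • z)‖ ^ 2 = (‖c‖ ^ 2) ^ 2 * ‖dot z z‖ ^ 2 := by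
  rw [dot_smul_smul, norm_mul, norm_pow]
  ring

theorem momentMapSO2_circle_smul (t : Circle) (z : Fin n → ℂ) :
    momentMapSO2 n ((t : ℂ) • z) = momentMapSO2 n z := by
  rw [momentMapSO2, norm_dot_smul_smul, absSq_smul, Circle.norm_coe]
  simp [momentMapSO2]

theorem isMomentMapSO2_momentMapSO2 (hn : n ≠ 0) : IsMomentMapSO2 n (momentMapSO2 n) where
  smooth := contDiffOn_momentMapSO2 n
  equivariant t z _ := momentMapSO2_circle_smul t z
  hamiltonian X z hz u := by
    have hd : DifferentiableAt ℝ (momentMapSO2 n) z :=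
      ((contDiffOn_momentMapSO2 n).contDiffAt ((isOpen_domain n).mem_nhds hz)).differentiableAt
        (by simp)
    have hcomplex : HasFDerivAt (fun w => (momentMapSO2 n w : ℂ))
        (Complex.ofRealCLM ∘L fderiv ℝ (momentMapSO2 n) z) z :=
      Complex.ofRealCLM.hasFDerivAt.comp z hd.hasFDerivAt
    rw [inducedField_eq, symplecticForm_I_smul_left hn hz,
      ← hcomplex.unique (hasWirtAt_momentMapSO2 hz), fderiv_mul_const hd]
    simp

theorem norm_dot_self_le (z : Fin n → ℂ) : ‖dot z z‖ ≤ absSq z := by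
  refine (norm_sum_le _ _).trans (le_of_eq ?_)
  exact Finset.sum_congr rfl fun j _ => by rw [norm_mul, sq]

theorem absSq_nonneg (z : Fin n → ℂ) : 0 ≤ absSq z := Finset.sum_nonneg fun _ _ => by positivity

theorem smul_mem_domain {z : Fin n → ℂ} (hz : z ∈ domain n) {c : ℂ} (hc : ‖c‖ ≤ 1) :
    c • z ∈ domain n := by
  obtain ⟨hball, hΔ⟩ := hz
  have hs0 : 0 ≤ ‖c‖ ^ 2 := by positivity
  have hs1 : ‖c‖ ^ 2 ≤ 1 := pow_le_one₀ (norm_nonneg _) hc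
  have ha := absSq_nonneg z
  have hb : ‖dot z z‖ ^ 2 ≤ absSq z ^ 2 := pow_le_pow_left₀ (norm_nonneg _) (norm_dot_self_le z) 2
  rw [domain, mem_ofPred_eq, absSq_smul, norm_dot_smul_smul]
  set s := ‖c‖ ^ 2
  set a := absSq z
  set b := ‖dot z z‖ ^ 2
  refine ⟨by nlinarith, ?_⟩
  have hscale : 0 ≤ (1 - s) * (2 * a - (1 + s) * b) := by
    refine mul_nonneg (by linarith) ?_
    have : 0 ≤ b := by positivity
    nlinarith
  nlinarith

theorem isPreconnected_domain (n : ℕ) : IsPreconnected (domain n) := by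
  rcases (domain n).eq_empty_or_nonempty with h | ⟨z, hz⟩
  · rw [h]; exact isPreconnected_empty
  refine (StarConvex.isPathConnected (a := 0) ?_ ?_).isConnected.isPreconnected
  · rw [starConvex_zero_iff (𝕜 := ℝ)]
    intro w hw a ha0 ha1
    have := smul_mem_domain hw (c := (a : ℂ)) (by rwa [Complex.norm_real, Real.norm_of_nonneg ha0])
    rwa [Complex.coe_smul] at this
  · simpa using smul_mem_domain hz (c := 0) (by simp)

theorem IsMomentMapSO2.exists_eq_add (hn : n ≠ 0) {μ : (Fin n → ℂ) → ℝ} (hμ : IsMomentMapSO2 n μ) :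
    ∃ c, ∀ z ∈ domain n, μ z = momentMapSO2 n z + c := by
  have hd : ∀ {ν : (Fin n → ℂ) → ℝ}, IsMomentMapSO2 n ν → ∀ z ∈ domain n, DifferentiableAt ℝ ν z :=
    fun hν z hz => (hν.smooth.contDiffAt ((isOpen_domain n).mem_nhds hz)).differentiableAt (by simp)
  have h0 := isMomentMapSO2_momentMapSO2 hn
  have hfderiv : ∀ z ∈ domain n, fderiv ℝ μ z = fderiv ℝ (momentMapSO2 n) z := by
    intro z hz
    ext u
    have h := (hμ.hamiltonian 1 z hz u).trans (h0.hamiltonian 1 z hz u).symm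
    simpa using h
  obtain ⟨c, hc⟩ := (isOpen_domain n).exists_is_const_of_fderiv_eq_zero (isPreconnected_domain n)
    (f := fun z => μ z - momentMapSO2 n z)
    (fun z hz => ((hd hμ z hz).sub (hd h0 z hz)).differentiableWithinAt) (fun z hz => by
      rw [fderiv_fun_sub (hd hμ z hz) (hd h0 z hz), hfderiv z hz, sub_self]
      rfl)
  exact ⟨c, fun z hz => by linarith [hc z hz]⟩

end MomentMap

/-! ## The measure is finite -/

section Finiteness

open scoped Real

theorem lintegral_norm_sq_eq_lintegral_Ioi {g : ℝ → ℝ≥0∞} (hg : Measurable g) :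
    ∫⁻ w : ℂ, g (‖w‖ ^ 2) = ENNReal.ofReal π * ∫⁻ u in Ioi 0, g u := by
  have himage : (fun r : ℝ => r ^ 2) '' Ioi 0 = Ioi 0 := by
    refine Subset.antisymm (image_subset_iff.2 fun r hr => pow_pos (mem_Ioi.1 hr) 2) fun u hu => ?_
    exact ⟨√u, Real.sqrt_pos.2 hu, Real.sq_sqrt (le_of_lt hu)⟩
  have hradial : ∫⁻ u in Ioi 0, g u = ∫⁻ r in Ioi 0, ENNReal.ofReal (2 * r) * g (r ^ 2) := by
    rw [← himage, lintegral_image_eq_lintegral_abs_deriv_mul measurableSet_Ioi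
      (fun r _ => by simpa using (hasDerivAt_pow 2 r).hasDerivWithinAt)
      ((pow_left_strictMonoOn₀ two_ne_zero).injOn.mono fun r hr => le_of_lt hr), himage]
    refine setLIntegral_congr_fun measurableSet_Ioi fun r hr => ?_
    rw [abs_of_pos (mul_pos two_pos hr)]
  calc ∫⁻ w : ℂ, g (‖w‖ ^ 2)
      = ∫⁻ p in Ioi (0 : ℝ) ×ˢ Ioo (-π) π, ENNReal.ofReal p.1 * g (p.1 ^ 2) := by
        simp [← Complex.lintegral_comp_polarCoord_symm, polarCoord]
    _ = ∫⁻ r in Ioi (0 : ℝ), ENNReal.ofReal (2 * π) * (ENNReal.ofReal r * g (r ^ 2)) := by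
        rw [Measure.volume_eq_prod, ← Measure.prod_restrict, lintegral_prod _ (by fun_prop)]
        simp [mul_comm, ← two_mul]
    _ = ENNReal.ofReal π * ∫⁻ u in Ioi 0, g u := by
        rw [hradial, ← lintegral_const_mul _ (by fun_prop)]
        refine lintegral_congr fun r => ?_
        rw [ENNReal.ofReal_mul two_pos.le, ENNReal.ofReal_mul two_pos.le]
        ring

variable {s : ℝ}

theorem lintegral_enorm_rpow_neg_lt_top (hs1 : s < 1) :
    ∫⁻ t in Ioc (-1 : ℝ) 1, ‖t‖ₑ ^ (-s) < ⊤ := by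
  have hint : IntervalIntegrable (fun t : ℝ => |t| ^ (-s)) volume (-1) 1 := by
    refine intervalIntegrable_of_even (fun t => by rw [abs_neg]) fun x hx => ?_
    refine (intervalIntegral.intervalIntegrable_rpow' (by linarith : -1 < -s)).congr_uIoo
      fun t ht => ?_
    rw [uIoo_of_le hx.le] at ht
    rw [abs_of_pos ht.1]
  refine lt_of_le_of_lt (le_of_eq (setLIntegral_congr_fun_ae measurableSet_Ioc ?_))
    hint.1.lintegral_lt_top
  filter_upwards [Measure.ae_ne volume (0 : ℝ)] with t ht _
  rw [Real.enorm_eq_ofReal_abs, ENNReal.ofReal_rpow_of_pos (abs_pos.2 ht)]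

theorem setLIntegral_enorm_norm_add_sq_sub_rpow_neg_le (hs : 0 < s) (A : Set ℂ) (w₀ : ℂ) (κ : ℝ) :
    ∫⁻ w in A, ‖‖w + w₀‖ ^ 2 - κ‖ₑ ^ (-s)
      ≤ volume A + ENNReal.ofReal π * ∫⁻ t in Ioc (-1 : ℝ) 1, ‖t‖ₑ ^ (-s) := by
  set g : ℝ → ℝ≥0∞ := (Ioc (-1) 1).indicator fun t => ‖t‖ₑ ^ (-s) with hg
  have hgm : Measurable g := (by fun_prop : Measurable fun t : ℝ => ‖t‖ₑ ^ (-s)).indicator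
    measurableSet_Ioc
  have hle (t : ℝ) : ‖t‖ₑ ^ (-s) ≤ 1 + g t := by
    by_cases ht : t ∈ Ioc (-1 : ℝ) 1
    · rw [hg, indicator_of_mem ht]
      exact le_add_self
    · refine le_add_right (ENNReal.rpow_le_one_of_one_le_of_neg ?_ (neg_lt_zero.2 hs))
      rw [Real.enorm_eq_ofReal_abs, ENNReal.one_le_ofReal, le_abs]
      rw [mem_Ioc, not_and_or, not_lt, not_le] at ht
      rcases ht with ht | ht
      · exact Or.inr (by linarith)
      · exact Or.inl ht.le
  calc ∫⁻ w in A, ‖‖w + w₀‖ ^ 2 - κ‖ₑ ^ (-s)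
      ≤ ∫⁻ w in A, (1 + g (‖w + w₀‖ ^ 2 - κ)) := lintegral_mono fun w => hle _
    _ ≤ volume A + ∫⁻ w : ℂ, g (‖w + w₀‖ ^ 2 - κ) := by
        rw [lintegral_add_left measurable_const, setLIntegral_one]
        gcongr
        exact Measure.restrict_le_self
    _ = volume A + ENNReal.ofReal π * ∫⁻ u in Ioi 0, g (u - κ) := by
        rw [lintegral_add_right_eq_self (fun w : ℂ => g (‖w‖ ^ 2 - κ)),
          lintegral_norm_sq_eq_lintegral_Ioi (g := fun u => g (u - κ)) (by fun_prop)]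
    _ ≤ volume A + ENNReal.ofReal π * ∫⁻ t, g t := by
        rw [← lintegral_sub_right_eq_self g κ]
        gcongr
        exact Measure.restrict_le_self
    _ = _ := by rw [hg, lintegral_indicator measurableSet_Ioc]

theorem setLIntegral_enorm_quadratic_rpow_neg_le (hs : 0 < s) (A : Set ℂ) {c : ℝ} (hc : c ≠ 0)
    (β : ℂ) (γ : ℝ) :
    ∫⁻ w in A, ‖c * ‖w‖ ^ 2 + 2 * (conj β * w).re + γ‖ₑ ^ (-s)
      ≤ ‖c‖ₑ ^ (-s)
        * (volume A + ENNReal.ofReal π * ∫⁻ t in Ioc (-1 : ℝ) 1, ‖t‖ₑ ^ (-s)) := by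
  have hsquare (w : ℂ) : c * ‖w‖ ^ 2 + 2 * (conj β * w).re + γ
      = c * (‖w + β / c‖ ^ 2 - (‖β‖ ^ 2 / c ^ 2 - γ / c)) := by
    simp only [← Complex.normSq_eq_norm_sq, Complex.normSq_apply, Complex.add_re, Complex.add_im,
      Complex.div_ofReal_re, Complex.div_ofReal_im, Complex.mul_re, Complex.conj_re,
      Complex.conj_im]
    field_simp
    ring
  simp only [hsquare, enorm_mul, ENNReal.mul_rpow_of_ne_top enorm_ne_top enorm_ne_top]
  rw [lintegral_const_mul _ (by fun_prop)]
  gcongr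
  exact setLIntegral_enorm_norm_add_sq_sub_rpow_neg_le hs A _ _

theorem lintegral_fin_cons {m : ℕ} {Φ : (Fin (m + 1) → ℂ) → ℝ≥0∞} (hΦ : Measurable Φ) :
    ∫⁻ z, Φ z = ∫⁻ x, ∫⁻ y, Φ (Fin.cons x y) := by
  have h := ((volume_preserving_piFinSuccAbove (fun _ : Fin (m + 1) => ℂ) 0).symm
    _).lintegral_comp hΦ
  rw [← h, Measure.volume_eq_prod, lintegral_prod _ (by fun_prop)]
  simp [MeasurableEquiv.piFinSuccAbove, Fin.consEquiv]

theorem lintegral_fin_cons_cons_shear {m : ℕ} {Φ : (Fin (m + 2) → ℂ) → ℝ≥0∞} (hΦ : Measurable Φ) :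
    ∫⁻ z, Φ z = ∫⁻ a, ∫⁻ y, ∫⁻ t,
      Φ (Fin.cons (a - Complex.I * t) (Fin.cons t y : Fin (m + 1) → ℂ)) := by
  have hcons : Measurable fun p : (ℂ × ℂ) × (Fin m → ℂ) =>
      Φ (Fin.cons p.1.1 (Fin.cons p.1.2 p.2 : Fin (m + 1) → ℂ)) := by
    refine hΦ.comp (measurable_pi_iff.2 fun j => ?_)
    refine Fin.cases ?_ (fun j => Fin.cases ?_ (fun j => ?_) j) j <;>
      simp only [Fin.cons_zero, Fin.cons_succ] <;> fun_prop
  calc ∫⁻ z, Φ z = ∫⁻ x, ∫⁻ t, ∫⁻ y, Φ (Fin.cons x (Fin.cons t y : Fin (m + 1) → ℂ)) := by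
        rw [lintegral_fin_cons hΦ]
        exact lintegral_congr fun x => lintegral_fin_cons (by fun_prop)
    _ = ∫⁻ t, ∫⁻ x, ∫⁻ y, Φ (Fin.cons x (Fin.cons t y : Fin (m + 1) → ℂ)) :=
        lintegral_lintegral_swap hcons.lintegral_prod_right'.aemeasurable
    _ = ∫⁻ t, ∫⁻ a, ∫⁻ y, Φ (Fin.cons (a - Complex.I * t) (Fin.cons t y : Fin (m + 1) → ℂ)) :=
        lintegral_congr fun t => (lintegral_sub_right_eq_self
          (fun x => ∫⁻ y, Φ (Fin.cons x (Fin.cons t y : Fin (m + 1) → ℂ))) (Complex.I * t)).symm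
    _ = ∫⁻ a, ∫⁻ t, ∫⁻ y, Φ (Fin.cons (a - Complex.I * t) (Fin.cons t y : Fin (m + 1) → ℂ)) :=
        lintegral_lintegral_swap (hcons.lintegral_prod_right'.comp (by fun_prop :
          Measurable fun p : ℂ × ℂ => (p.2 - Complex.I * p.1, p.1))).aemeasurable
    _ = ∫⁻ a, ∫⁻ y, ∫⁻ t, Φ (Fin.cons (a - Complex.I * t) (Fin.cons t y : Fin (m + 1) → ℂ)) :=
        lintegral_congr fun a => lintegral_lintegral_swap (hcons.comp (by fun_prop :
          Measurable fun p : ℂ × (Fin m → ℂ) => ((a - Complex.I * p.1, p.1), p.2))).aemeasurable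

theorem exists_Delta_cons_cons_shear {m : ℕ} (a : ℂ) (y : Fin m → ℂ) : ∃ (β : ℂ) (γ : ℝ), ∀ t : ℂ,
    Delta (Fin.cons (a - Complex.I * t) (Fin.cons t y : Fin (m + 1) → ℂ) : Fin (m + 2) → ℂ)
      = 4 * (‖a‖ ^ 2 - 1) * ‖t‖ ^ 2 + 2 * (conj β * t).re + γ := by
  refine ⟨2 * Complex.I * (conj a * (a ^ 2 + dot y y) - a),
    1 - 2 * (‖a‖ ^ 2 + absSq y) + ‖a ^ 2 + dot y y‖ ^ 2, fun t => ?_⟩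
  have hdot : dot (Fin.cons (a - Complex.I * t) (Fin.cons t y : Fin (m + 1) → ℂ) : Fin (m + 2) → ℂ)
      (Fin.cons (a - Complex.I * t) (Fin.cons t y : Fin (m + 1) → ℂ))
      = a ^ 2 + dot y y - 2 * Complex.I * a * t := by
    simp only [dot, Fin.sum_univ_succ, Fin.cons_zero, Fin.cons_succ]
    linear_combination t ^ 2 * Complex.I_mul_I
  have habsSq : absSq (Fin.cons (a - Complex.I * t) (Fin.cons t y : Fin (m + 1) → ℂ)
      : Fin (m + 2) → ℂ) = ‖a - Complex.I * t‖ ^ 2 + ‖t‖ ^ 2 + absSq y := by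
    simp only [absSq, Fin.sum_univ_succ, Fin.cons_zero, Fin.cons_succ, add_assoc]
  rw [Delta, hdot, habsSq]
  generalize dot y y = q
  simp only [← Complex.normSq_eq_norm_sq, Complex.normSq_apply]
  simp only [Complex.sub_re, Complex.sub_im, Complex.add_re, Complex.add_im, Complex.mul_re,
    Complex.mul_im, Complex.conj_re, Complex.conj_im, Complex.I_re, Complex.I_im, Complex.re_ofNat,
    Complex.im_ofNat, pow_two]
  ring

theorem norm_apply_lt_one_of_mem_domain {n : ℕ} {z : Fin n → ℂ} (hz : z ∈ domain n) (j : Fin n) :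
    ‖z j‖ < 1 := by
  have hle : ‖z j‖ ^ 2 ≤ absSq z :=
    Finset.single_le_sum (f := fun j => ‖z j‖ ^ 2) (fun _ _ => by positivity) (Finset.mem_univ j)
  exact (sq_lt_one_iff₀ (norm_nonneg _)).1 (hle.trans_lt hz.1)

theorem Delta_le_one_of_mem_domain {n : ℕ} {z : Fin n → ℂ} (hz : z ∈ domain n) : Delta z ≤ 1 := by
  have hle : ‖dot z z‖ ^ 2 ≤ absSq z ^ 2 :=
    pow_le_pow_left₀ (norm_nonneg _) (norm_dot_self_le z) 2
  rw [Delta]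
  nlinarith [hz.1, absSq_nonneg z]

theorem lintegral_le_setLIntegral {α : Type*} [MeasurableSpace α] {ν : Measure α}
    {f g : α → ℝ≥0∞} {S : Set α} (hS : MeasurableSet S) (hzero : ∀ x ∉ S, f x = 0)
    (hle : ∀ x ∈ S, f x ≤ g x) : ∫⁻ x, f x ∂ν ≤ ∫⁻ x in S, g x ∂ν := by
  rw [← lintegral_indicator hS]
  refine lintegral_mono fun x => ?_
  by_cases hx : x ∈ S
  · simpa only [indicator_of_mem hx] using hle x hx
  · simp only [hzero x hx, zero_le]

theorem setLIntegral_domain_le {m : ℕ} {F : (Fin (m + 2) → ℂ) → ℝ≥0∞} (hF : Measurable F) :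
    ∫⁻ z in domain (m + 2), F z ≤ ∫⁻ a in Metric.ball 0 2, ∫⁻ y in Metric.ball 0 1,
      ∫⁻ t in Metric.ball 0 1,
        F (Fin.cons (a - Complex.I * t) (Fin.cons t y : Fin (m + 1) → ℂ)) := by
  have ht {a t : ℂ} {y : Fin m → ℂ} (h : Fin.cons (a - Complex.I * t)
      (Fin.cons t y : Fin (m + 1) → ℂ) ∈ domain (m + 2)) : t ∈ Metric.ball 0 1 := by
    simpa using norm_apply_lt_one_of_mem_domain h 1
  have hy {a t : ℂ} {y : Fin m → ℂ} (h : Fin.cons (a - Complex.I * t)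
      (Fin.cons t y : Fin (m + 1) → ℂ) ∈ domain (m + 2)) : y ∈ Metric.ball 0 1 := by
    rw [mem_ball_zero_iff, pi_norm_lt_iff one_pos]
    exact fun j => by simpa using norm_apply_lt_one_of_mem_domain h j.succ.succ
  have ha {a t : ℂ} {y : Fin m → ℂ} (h : Fin.cons (a - Complex.I * t)
      (Fin.cons t y : Fin (m + 1) → ℂ) ∈ domain (m + 2)) : a ∈ Metric.ball 0 2 := by
    have hfirst : ‖a - Complex.I * t‖ < 1 := by simpa using norm_apply_lt_one_of_mem_domain h 0
    have hshift : ‖Complex.I * t‖ < 1 := by simpa using ht h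
    have := norm_add_le (a - Complex.I * t) (Complex.I * t)
    rw [sub_add_cancel] at this
    rw [mem_ball_zero_iff]
    linarith
  rw [← lintegral_indicator (isOpen_domain _).measurableSet,
    lintegral_fin_cons_cons_shear (hF.indicator (isOpen_domain _).measurableSet)]
  refine lintegral_le_setLIntegral measurableSet_ball (fun a hna => ?_) fun a _ =>
    lintegral_le_setLIntegral measurableSet_ball (fun y hny => ?_) fun y _ =>
    lintegral_le_setLIntegral measurableSet_ball (fun t hnt => ?_)
      fun t _ => indicator_le_self _ _ _
  · simp [indicator_of_notMem (mt ha hna)]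
  · simp [indicator_of_notMem (mt hy hny)]
  · rw [indicator_of_notMem (mt ht hnt)]

theorem setLIntegral_domain_enorm_Delta_rpow_neg_lt_top (hs : 0 < s) (hs1 : s < 1) (m : ℕ) :
    ∫⁻ z in domain (m + 2), ‖Delta z‖ₑ ^ (-s) < ⊤ := by
  set K : ℝ → ℝ≥0∞ := fun R => volume (Metric.ball (0 : ℂ) R)
    + ENNReal.ofReal π * ∫⁻ t in Ioc (-1 : ℝ) 1, ‖t‖ₑ ^ (-s)
  have hKtop (R : ℝ) : K R < ⊤ := ENNReal.add_lt_top.2 ⟨measure_ball_lt_top,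
    ENNReal.mul_lt_top ENNReal.ofReal_lt_top (lintegral_enorm_rpow_neg_lt_top hs1)⟩
  have hfibre {a : ℂ} (ha : ‖a‖ ≠ 1) (y : Fin m → ℂ) : ∫⁻ t in Metric.ball 0 1,
      ‖Delta (Fin.cons (a - Complex.I * t) (Fin.cons t y : Fin (m + 1) → ℂ) : Fin (m + 2) → ℂ)‖ₑ
        ^ (-s) ≤ ‖4 * (‖a‖ ^ 2 - 1)‖ₑ ^ (-s) * K 1 := by
    obtain ⟨β, γ, hβγ⟩ := exists_Delta_cons_cons_shear a y
    simp only [hβγ]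
    refine setLIntegral_enorm_quadratic_rpow_neg_le hs _ (mul_ne_zero four_ne_zero ?_) β γ
    rwa [sub_ne_zero, Ne, pow_eq_one_iff_of_nonneg (norm_nonneg a) two_ne_zero]
  have hsphere : ∀ᵐ a : ℂ, ‖a‖ ≠ 1 := by
    simpa using measure_eq_zero_iff_ae_notMem.1 (Measure.addHaar_sphere volume (0 : ℂ) 1)
  have hbase := setLIntegral_enorm_quadratic_rpow_neg_le hs (Metric.ball 0 2) four_ne_zero 0 (-4)
  calc ∫⁻ z in domain (m + 2), ‖Delta z‖ₑ ^ (-s)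
      ≤ ∫⁻ a in Metric.ball (0 : ℂ) 2, ∫⁻ y in Metric.ball (0 : Fin m → ℂ) 1,
          ‖4 * (‖a‖ ^ 2 - 1)‖ₑ ^ (-s) * K 1 := by
        refine (setLIntegral_domain_le (continuous_Delta.measurable.enorm.pow_const _)).trans ?_
        refine lintegral_mono_ae ((ae_restrict_of_ae hsphere).mono fun a ha => ?_)
        exact lintegral_mono fun y => hfibre ha y
    _ = (∫⁻ a in Metric.ball (0 : ℂ) 2, ‖4 * ‖a‖ ^ 2 + 2 * (conj 0 * a).re + -4‖ₑ ^ (-s))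
          * (K 1 * volume (Metric.ball (0 : Fin m → ℂ) 1)) := by
        rw [← lintegral_mul_const _ (by fun_prop)]
        refine lintegral_congr fun a => ?_
        rw [setLIntegral_const, mul_assoc]
        congr 3
        simp only [map_zero, zero_mul, Complex.zero_re]
        ring
    _ < ⊤ := by
        refine ENNReal.mul_lt_top (hbase.trans_lt (ENNReal.mul_lt_top ?_ (hKtop 2)))
          (ENNReal.mul_lt_top (hKtop 1) measure_ball_lt_top)
        exact (ENNReal.rpow_ne_top_of_ne_zero (by simp) enorm_ne_top).lt_top

theorem weightedMeasure_univ_lt_top {n : ℕ} (hn : 2 ≤ n) {lam : ℝ} (hlam : (n : ℝ) - 1 < lam) :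
    weightedMeasure n lam univ < ⊤ := by
  obtain ⟨m, rfl⟩ := Nat.exists_eq_add_of_le' hn
  set s := max (((m + 2 : ℕ) : ℝ) - lam) (1 / 2)
  have hs : 0 < s := lt_max_of_lt_right (by norm_num)
  have hs1 : s < 1 := max_lt (by linarith) (by norm_num)
  rw [weightedMeasure, withDensity_apply _ MeasurableSet.univ, Measure.restrict_univ]
  refine lt_of_le_of_lt (setLIntegral_mono' (isOpen_domain _).measurableSet fun z hz => ?_)
    (setLIntegral_domain_enorm_Delta_rpow_neg_lt_top hs hs1 m)
  have hpos := Delta_pos hz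
  rw [Real.enorm_of_nonneg hpos.le, ENNReal.ofReal_rpow_of_pos hpos]
  refine ENNReal.ofReal_le_ofReal (Real.rpow_le_rpow_of_exponent_ge hpos
    (Delta_le_one_of_mem_domain hz) ?_)
  linarith [le_max_left (((m + 2 : ℕ) : ℝ) - lam) (1 / 2)]

end Finiteness

/-! ## Symmetries of the measure -/

section Symmetry

variable {n : ℕ} {lam : ℝ}

instance isFiniteMeasure_bergmanMeasure : IsFiniteMeasure (bergmanMeasure n lam) :=
  ⟨(ENNReal.inv_mul_le_one _).trans_lt ENNReal.one_lt_top⟩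

theorem ae_mem_domain : ∀ᵐ z ∂bergmanMeasure n lam, z ∈ domain n :=
  Measure.ae_smul_measure ((withDensity_absolutelyContinuous _ _).ae_le
    (ae_restrict_mem (isOpen_domain n).measurableSet)) _

theorem measurable_density (n : ℕ) (lam : ℝ) :
    Measurable fun z : Fin n → ℂ => ENNReal.ofReal (Delta z ^ (lam - n)) :=
  ENNReal.measurable_ofReal.comp (continuous_Delta.measurable.pow_const _)

theorem eqOn_domain_of_ae_eq {X : Type*} [TopologicalSpace X] [T2Space X] (hn : 2 ≤ n)
    (hlam : (n : ℝ) - 1 < lam) {f g : (Fin n → ℂ) → X} (hf : ContinuousOn f (domain n))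
    (hg : ContinuousOn g (domain n)) (h : f =ᵐ[bergmanMeasure n lam] g) :
    EqOn f g (domain n) := by
  have hweighted : f =ᵐ[weightedMeasure n lam] g :=
    (Measure.ae_ennreal_smul_measure_iff
      (ENNReal.inv_ne_zero.2 (weightedMeasure_univ_lt_top hn hlam).ne)).1 h
  rw [Filter.EventuallyEq, weightedMeasure, ae_withDensity_iff (measurable_density n lam)]
    at hweighted
  refine Measure.eqOn_open_of_ae_eq (μ := volume) ?_ (isOpen_domain n) hf hg
  filter_upwards [hweighted, ae_restrict_mem (isOpen_domain n).measurableSet] with z hz hzd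
  exact hz (ENNReal.ofReal_pos.2 (Real.rpow_pos_of_pos (Delta_pos hzd) _)).ne'

/-- A linear map preserving `|z|` and `|zᵀ z|`. These maps form the group generated by
`SO(2)` and `O(n)`, the isotropy group of the origin in the domain. -/
structure IsSymmetry (e : (Fin n → ℂ) →ₗ[ℂ] (Fin n → ℂ)) : Prop where
  absSq_apply : ∀ z, absSq (e z) = absSq z
  norm_dot_apply : ∀ z, ‖dot (e z) (e z)‖ = ‖dot z z‖

namespace IsSymmetry

variable {e : (Fin n → ℂ) →ₗ[ℂ] (Fin n → ℂ)}

theorem mem_domain_iff (he : IsSymmetry e) {z : Fin n → ℂ} : e z ∈ domain n ↔ z ∈ domain n := by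
  simp only [domain, mem_ofPred_eq, he.absSq_apply, he.norm_dot_apply]

theorem preimage_domain (he : IsSymmetry e) : e ⁻¹' domain n = domain n :=
  Set.ext fun _ => he.mem_domain_iff

theorem Delta_apply (he : IsSymmetry e) (z : Fin n → ℂ) : Delta (e z) = Delta z := by
  rw [Delta, Delta, he.absSq_apply, he.norm_dot_apply]

theorem injective (he : IsSymmetry e) : Function.Injective e := by
  refine (injective_iff_map_eq_zero e).2 fun z hz => funext fun j => norm_eq_zero.1 ?_
  have hzero : absSq z = 0 := by rw [← he.absSq_apply, hz]; simp [absSq]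
  have hterm := (Finset.sum_eq_zero_iff_of_nonneg fun j _ => by positivity).1 hzero j
    (Finset.mem_univ j)
  exact (pow_eq_zero_iff two_ne_zero).1 hterm

end IsSymmetry

theorem measurePreserving_of_preimage_eq {E : Type*} [NormedAddCommGroup E] [NormedSpace ℝ E]
    [FiniteDimensional ℝ E] [MeasurableSpace E] [BorelSpace E] {μ : Measure E}
    [μ.IsAddHaarMeasure] {e : E →ₗ[ℝ] E} (he : Function.Injective e) {s : Set E}
    (hs : e ⁻¹' s = s) (hs0 : μ s ≠ 0) (hst : μ s ≠ ⊤) : MeasurePreserving e μ μ := by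
  have hdet : LinearMap.det e ≠ 0 :=
    (LinearEquiv.isUnit_det' (LinearEquiv.ofInjectiveEndo e he)).ne_zero
  have hscale := Measure.addHaar_preimage_linearMap μ hdet s
  rw [hs] at hscale
  have hone : ENNReal.ofReal |(LinearMap.det e)⁻¹| = 1 :=
    ((ENNReal.mul_left_inj hs0 hst).1 ((one_mul _).trans hscale)).symm
  refine ⟨e.continuous_of_finiteDimensional.measurable, ?_⟩
  rw [Measure.map_linearMap_addHaar_eq_smul_addHaar μ hdet, hone, one_smul]

theorem zero_mem_domain : (0 : Fin n → ℂ) ∈ domain n := by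
  simp [domain, absSq, dot]

theorem domain_subset_closedBall : domain n ⊆ Metric.closedBall 0 1 := fun z hz => by
  rw [mem_closedBall_zero_iff, pi_norm_le_iff_of_nonneg zero_le_one]
  exact fun j => (norm_apply_lt_one_of_mem_domain hz j).le

theorem IsSymmetry.measurePreserving_volume {e : (Fin n → ℂ) →ₗ[ℂ] (Fin n → ℂ)}
    (he : IsSymmetry e) : MeasurePreserving e volume volume :=
  measurePreserving_of_preimage_eq (e := e.restrictScalars ℝ) he.injective he.preimage_domain
    ((isOpen_domain n).measure_pos _ ⟨0, zero_mem_domain⟩).ne'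
    (measure_ne_top_of_subset domain_subset_closedBall measure_closedBall_lt_top.ne)

theorem IsSymmetry.measurePreserving {e : (Fin n → ℂ) →ₗ[ℂ] (Fin n → ℂ)} (he : IsSymmetry e) :
    MeasurePreserving e (bergmanMeasure n lam) (bergmanMeasure n lam) := by
  have hvol := he.measurePreserving_volume
  refine ⟨hvol.measurable, ?_⟩
  rw [bergmanMeasure, Measure.map_smul]
  congr 1
  refine Measure.ext fun s hs => ?_
  rw [Measure.map_apply hvol.measurable hs, weightedMeasure, withDensity_apply _ hs,
    withDensity_apply _ (hvol.measurable hs), Measure.restrict_restrict hs,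
    Measure.restrict_restrict (hvol.measurable hs),
    ← hvol.setLIntegral_comp_preimage (hs.inter (isOpen_domain n).measurableSet)
      (measurable_density n lam), preimage_inter, he.preimage_domain]
  simp only [he.Delta_apply]

theorem isSymmetry_circle_smul (t : Circle) :
    IsSymmetry ((t : ℂ) • LinearMap.id : (Fin n → ℂ) →ₗ[ℂ] (Fin n → ℂ)) where
  absSq_apply z := by simp [absSq_smul, Circle.norm_coe]
  norm_dot_apply z := by simp [dot_smul_smul, Circle.norm_coe]

theorem measurePreserving_circle_smul (t : Circle) :
    MeasurePreserving (fun z : Fin n → ℂ => (t : ℂ) • z) (bergmanMeasure n lam)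
      (bergmanMeasure n lam) :=
  (isSymmetry_circle_smul t).measurePreserving

/-- The rotation by the angle `θ` in the plane of the coordinates `i` and `j`. -/
def planeRot (i j : Fin n) (θ : ℝ) : (Fin n → ℂ) →ₗ[ℂ] (Fin n → ℂ) :=
  LinearMap.pi fun k =>
    if k = i then (Real.cos θ : ℂ) • LinearMap.proj i - (Real.sin θ : ℂ) • LinearMap.proj j
    else if k = j then (Real.sin θ : ℂ) • LinearMap.proj i + (Real.cos θ : ℂ) • LinearMap.proj j
    else LinearMap.proj k

theorem planeRot_apply (i j : Fin n) (θ : ℝ) (z : Fin n → ℂ) (k : Fin n) :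
    planeRot i j θ z k =
      if k = i then Real.cos θ * z i - Real.sin θ * z j
      else if k = j then Real.sin θ * z i + Real.cos θ * z j else z k := by
  simp only [planeRot, LinearMap.pi_apply]
  split_ifs <;> rfl

theorem planeRot_zero (i j : Fin n) (z : Fin n → ℂ) : planeRot i j 0 z = z := by
  funext k
  simp only [planeRot_apply, Real.cos_zero, Real.sin_zero]
  split_ifs with hi hj
  · simp [hi]
  · simp [hj]
  · rfl

theorem dot_planeRot {i j : Fin n} (hij : i ≠ j) (θ : ℝ) (z w : Fin n → ℂ) :
    dot (planeRot i j θ z) (planeRot i j θ w) = dot z w := by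
  have hpyth : (Real.cos θ : ℂ) ^ 2 + (Real.sin θ : ℂ) ^ 2 = 1 := by
    exact_mod_cast Real.cos_sq_add_sin_sq θ
  rw [← sub_eq_zero, dot, dot, ← Finset.sum_sub_distrib,
    Fintype.sum_eq_add i j hij fun k hk => by simp [planeRot_apply, hk.1, hk.2]]
  simp only [planeRot_apply, if_true, hij.symm, if_false]
  linear_combination (z i * w i + z j * w j) * hpyth

theorem conj_planeRot (i j : Fin n) (θ : ℝ) (z : Fin n → ℂ) :
    (fun k => conj (planeRot i j θ z k)) = planeRot i j θ fun k => conj (z k) := by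
  funext k
  simp only [planeRot_apply]
  split_ifs <;> simp only [map_add, map_sub, map_mul, Complex.conj_ofReal]

theorem isSymmetry_planeRot {i j : Fin n} (hij : i ≠ j) (θ : ℝ) : IsSymmetry (planeRot i j θ) where
  absSq_apply z := by
    rw [← Complex.ofReal_inj, ofReal_absSq, ofReal_absSq, conj_planeRot, dot_planeRot hij]
  norm_dot_apply z := by rw [dot_planeRot hij]

end Symmetry

/-! ## Integrals of polynomials against invariant symbols -/

section InvariantIntegral

variable {n : ℕ} {lam : ℝ}

theorem exists_norm_le_of_continuous {f : (Fin n → ℂ) → ℂ} (hf : Continuous f) :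
    ∃ C, ∀ z ∈ domain n, ‖f z‖ ≤ C := by
  obtain ⟨C, hC⟩ := (isCompact_closedBall (0 : Fin n → ℂ) 1).exists_bound_of_continuousOn
    hf.continuousOn
  exact ⟨C, fun z hz => hC z (domain_subset_closedBall hz)⟩

theorem memLp_of_continuous {f : (Fin n → ℂ) → ℂ} (hf : Continuous f) (r : ℝ≥0∞) :
    MemLp f r (bergmanMeasure n lam) := by
  obtain ⟨C, hC⟩ := exists_norm_le_of_continuous hf
  exact (memLp_top_of_bound hf.aestronglyMeasurable C
    (ae_mem_domain.mono fun z hz => hC z hz)).mono_exponent le_top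

theorem integrable_mul_of_continuous {b f : (Fin n → ℂ) → ℂ}
    (hb : MemLp b ⊤ (bergmanMeasure n lam)) (hf : Continuous f) :
    Integrable (fun z => b z * f z) (bergmanMeasure n lam) :=
  memLp_one_iff_integrable.1 ((memLp_of_continuous hf 1).mul (p := ⊤) hb)

/-- A function on the domain that is invariant under the isotropy group of the origin. -/
def IsInvariantSymbol (b : (Fin n → ℂ) → ℂ) : Prop :=
  ∀ e, IsSymmetry e → ∀ z ∈ domain n, b (e z) = b z

theorem IsInvariantSymbol.integral_mul_comp {b f : (Fin n → ℂ) → ℂ} (hinv : IsInvariantSymbol b)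
    (hb : MemLp b ⊤ (bergmanMeasure n lam)) (hf : Continuous f)
    {e : (Fin n → ℂ) →ₗ[ℂ] (Fin n → ℂ)} (he : IsSymmetry e) :
    ∫ z, b z * f (e z) ∂bergmanMeasure n lam = ∫ z, b z * f z ∂bergmanMeasure n lam := by
  have hpres := he.measurePreserving (lam := lam)
  conv_rhs => rw [← hpres.map_eq]
  rw [integral_map hpres.aemeasurable
    (by rw [hpres.map_eq]; exact (integrable_mul_of_continuous hb hf).aestronglyMeasurable)]
  refine integral_congr_ae (ae_mem_domain.mono fun z hz => ?_)
  simp only [hinv e he z hz]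

theorem IsInvariantSymbol.integral_mul_eq_zero_of_circle_smul {b f : (Fin n → ℂ) → ℂ}
    (hinv : IsInvariantSymbol b) (hb : MemLp b ⊤ (bergmanMeasure n lam)) (hf : Continuous f)
    {t : Circle} (h : ∀ z, f ((t : ℂ) • z) = -f z) :
    ∫ z, b z * f z ∂bergmanMeasure n lam = 0 := by
  have hcomp := hinv.integral_mul_comp hb hf (isSymmetry_circle_smul t)
  simp only [LinearMap.smul_apply, LinearMap.id_apply, h, mul_neg, integral_neg] at hcomp
  exact self_eq_neg.1 hcomp.symm

theorem eval_smul_of_isHomogeneous {k : ℕ} {p : MvPolynomial (Fin n) ℂ} (hp : p.IsHomogeneous k)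
    (c : ℂ) (z : Fin n → ℂ) : eval (c • z) p = c ^ k * eval z p := by
  rw [eval_eq', eval_eq', Finset.mul_sum]
  refine Finset.sum_congr rfl fun d hd => ?_
  have hdeg : ∑ i, d i = k := by
    simpa [Finsupp.weight_apply, Finsupp.sum_fintype] using hp (mem_support_iff.1 hd)
  simp only [Pi.smul_apply, smul_eq_mul, mul_pow, Finset.prod_mul_distrib,
    Finset.prod_pow_eq_pow_sum, hdeg]
  ring

theorem continuous_conj_eval_mul_eval (p q : MvPolynomial (Fin n) ℂ) :
    Continuous fun z => conj (eval z p) * eval z q :=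
  (Complex.continuous_conj.comp p.continuous_eval).mul q.continuous_eval

theorem IsInvariantSymbol.integral_eq_zero_of_degree_ne {b : (Fin n → ℂ) → ℂ}
    (hinv : IsInvariantSymbol b) (hb : MemLp b ⊤ (bergmanMeasure n lam)) {k l : ℕ} (hkl : k ≠ l)
    {p q : MvPolynomial (Fin n) ℂ} (hp : p.IsHomogeneous k) (hq : q.IsHomogeneous l) :
    ∫ z, b z * (conj (eval z p) * eval z q) ∂bergmanMeasure n lam = 0 := by
  set t : Circle := Circle.exp (Real.pi / (l - k)) with ht
  have hpow : conj (t : ℂ) ^ k * (t : ℂ) ^ l = -1 := by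
    have hlk : (l : ℂ) - k ≠ 0 := sub_ne_zero.2 (Nat.cast_injective.ne hkl.symm)
    rw [ht, Circle.coe_exp, ← Complex.exp_conj, ← Complex.exp_nat_mul, ← Complex.exp_nat_mul,
      ← Complex.exp_add, ← Complex.exp_pi_mul_I]
    congr 1
    simp only [map_mul, Complex.conj_I, Complex.conj_ofReal]
    push_cast
    field_simp
    ring
  refine hinv.integral_mul_eq_zero_of_circle_smul (t := t) hb
    (continuous_conj_eval_mul_eval p q) fun z => ?_
  simp only [eval_smul_of_isHomogeneous hp, eval_smul_of_isHomogeneous hq, map_mul, map_pow]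
  linear_combination conj (eval z p) * eval z q * hpow

theorem hasDerivAt_eval {γ : ℝ → Fin n → ℂ} {γ' : Fin n → ℂ} {t : ℝ}
    (h : ∀ k, HasDerivAt (fun s => γ s k) (γ' k) t) (p : MvPolynomial (Fin n) ℂ) :
    HasDerivAt (fun s => eval (γ s) p) (∑ k, γ' k * eval (γ t) (pderiv k p)) t := by
  induction p using MvPolynomial.induction_on with
  | C a => simpa using hasDerivAt_const t a
  | add p q hp hq =>
    simp only [map_add, mul_add, Finset.sum_add_distrib]
    exact hp.add hq
  | mul_X p i hp =>
    simp only [map_mul, eval_X]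
    refine (hp.mul (h i)).congr_deriv ?_
    simp only [Derivation.leibniz, smul_eq_mul, map_add, map_mul, eval_X, pderiv_X, mul_add,
      Finset.sum_add_distrib, Finset.sum_mul]
    rw [add_comm]
    congr 1
    · rw [Fintype.sum_eq_single i fun k hk => by simp [hk.symm]]
      simp [mul_comm]
    · exact Finset.sum_congr rfl fun k _ => by ring

theorem hasDerivAt_planeRot {i j : Fin n} (hij : i ≠ j) (z : Fin n → ℂ) (θ : ℝ) (k : Fin n) :
    HasDerivAt (fun s => planeRot i j s z k)
      (if k = i then -planeRot i j θ z j else if k = j then planeRot i j θ z i else 0) θ := by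
  have hcos : HasDerivAt (fun s : ℝ => (Real.cos s : ℂ)) (-Real.sin θ : ℂ) θ := by
    simpa using (Real.hasDerivAt_cos θ).ofReal_comp
  have hsin : HasDerivAt (fun s : ℝ => (Real.sin s : ℂ)) (Real.cos θ : ℂ) θ :=
    (Real.hasDerivAt_sin θ).ofReal_comp
  simp only [planeRot_apply, if_true, hij.symm, if_false]
  split_ifs
  · exact ((hcos.mul_const _).sub (hsin.mul_const _)).congr_deriv (by ring)
  · exact ((hsin.mul_const _).add (hcos.mul_const _)).congr_deriv (by ring)
  · exact hasDerivAt_const θ _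

theorem hasDerivAt_eval_planeRot {i j : Fin n} (hij : i ≠ j) (z : Fin n → ℂ)
    (p : MvPolynomial (Fin n) ℂ) (θ : ℝ) :
    HasDerivAt (fun s => eval (planeRot i j s z) p) (eval (planeRot i j θ z) (rot i j p)) θ := by
  refine (hasDerivAt_eval (hasDerivAt_planeRot hij z θ) p).congr_deriv ?_
  rw [Fintype.sum_eq_add i j hij fun k hk => by simp [hk.1, hk.2]]
  simp only [if_true, hij.symm, if_false, rot_apply, map_sub, map_mul, eval_X]
  ring

theorem hasDerivAt_integral_mul_of_bounded {Ω : Type*} [MeasurableSpace Ω] {μ : Measure Ω}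
    {b : Ω → ℂ} (hb : Integrable b μ) {F F' : ℝ → Ω → ℂ} {C : ℝ} {t₀ : ℝ}
    (hF : ∀ t, AEStronglyMeasurable (F t) μ) (hF_int : Integrable (fun x => b x * F t₀ x) μ)
    (hF' : AEStronglyMeasurable (F' t₀) μ) (hbound : ∀ᵐ x ∂μ, ∀ t, ‖F' t x‖ ≤ C)
    (hderiv : ∀ x t, HasDerivAt (fun s => F s x) (F' t x) t) :
    HasDerivAt (fun t => ∫ x, b x * F t x ∂μ) (∫ x, b x * F' t₀ x ∂μ) t₀ :=
  (hasDerivAt_integral_of_dominated_loc_of_deriv_le (F' := fun t x => b x * F' t x)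
    (bound := fun x => ‖b x‖ * C) univ_mem (Eventually.of_forall fun t => hb.1.mul (hF t)) hF_int
    (hb.1.mul hF')
    (hbound.mono fun x hx t _ => by
      rw [norm_mul]; exact mul_le_mul_of_nonneg_left (hx t) (norm_nonneg _))
    (hb.norm.mul_const C)
    (Eventually.of_forall fun x t _ => (hderiv x t).const_mul (b x))).2

theorem IsInvariantSymbol.integral_mul_eq_zero_of_hasDerivAt_planeRot {b f f' : (Fin n → ℂ) → ℂ}
    (hinv : IsInvariantSymbol b) (hb : MemLp b ⊤ (bergmanMeasure n lam)) (hf : Continuous f)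
    (hf' : Continuous f') {i j : Fin n} (hij : i ≠ j)
    (hderiv : ∀ z θ, HasDerivAt (fun s => f (planeRot i j s z)) (f' (planeRot i j θ z)) θ) :
    ∫ z, b z * f' z ∂bergmanMeasure n lam = 0 := by
  obtain ⟨C, hC⟩ := exists_norm_le_of_continuous hf'
  have hcont : ∀ θ, Continuous (planeRot i j θ) := fun θ =>
    LinearMap.continuous_of_finiteDimensional _
  have hconst : ∀ θ, ∫ z, b z * f (planeRot i j θ z) ∂bergmanMeasure n lam
      = ∫ z, b z * f z ∂bergmanMeasure n lam := fun θ =>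
    hinv.integral_mul_comp hb hf (isSymmetry_planeRot hij θ)
  have hd := hasDerivAt_integral_mul_of_bounded (t₀ := 0) (C := C)
    (F := fun θ z => f (planeRot i j θ z)) (F' := fun θ z => f' (planeRot i j θ z))
    ((hb.mono_exponent le_top).integrable le_rfl)
    (fun θ => (hf.comp (hcont θ)).aestronglyMeasurable)
    (integrable_mul_of_continuous hb (hf.comp (hcont 0)))
    (hf'.comp (hcont 0)).aestronglyMeasurable
    (ae_mem_domain.mono fun z hz θ => hC _ ((isSymmetry_planeRot hij θ).mem_domain_iff.2 hz))
    hderiv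
  simp only [hconst, planeRot_zero] at hd
  exact hd.unique (hasDerivAt_const 0 _)

theorem IsInvariantSymbol.integral_rot_mul {b : (Fin n → ℂ) → ℂ}
    (hinv : IsInvariantSymbol b) (hb : MemLp b ⊤ (bergmanMeasure n lam)) (i j : Fin n)
    (p q : MvPolynomial (Fin n) ℂ) :
    ∫ z, b z * (conj (eval z (rot i j p)) * eval z q) ∂bergmanMeasure n lam
      = -∫ z, b z * (conj (eval z p) * eval z (rot i j q)) ∂bergmanMeasure n lam := by
  rcases eq_or_ne i j with rfl | hij
  · simp [rot_apply]
  have hzero := hinv.integral_mul_eq_zero_of_hasDerivAt_planeRot hb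
    (continuous_conj_eval_mul_eval p q)
    ((continuous_conj_eval_mul_eval (rot i j p) q).add
      (continuous_conj_eval_mul_eval p (rot i j q))) hij fun z θ =>
    (hasDerivAt_eval_planeRot hij z p θ).star.mul (hasDerivAt_eval_planeRot hij z q θ)
  simp only [Pi.add_apply, mul_add] at hzero
  rw [integral_add (integrable_mul_of_continuous hb (continuous_conj_eval_mul_eval _ _))
    (integrable_mul_of_continuous hb (continuous_conj_eval_mul_eval _ _))] at hzero
  exact eq_neg_of_add_eq_zero_left hzero

end InvariantIntegral

/-! ## Density of the polynomials -/

section DirectionalDerivative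

variable {E : Type*} [NormedAddCommGroup E] [NormedSpace ℂ E]

theorem hasDerivAt_add_smul {f : E → ℂ} {z v : E} {ζ : ℂ} (hf : DifferentiableAt ℂ f (z + ζ • v)) :
    HasDerivAt (fun ζ : ℂ => f (z + ζ • v)) (fderiv ℂ f (z + ζ • v) v) ζ :=
  hf.hasFDerivAt.comp_hasDerivAt ζ
    (by simpa using ((hasDerivAt_id ζ).smul_const v).const_add z)

theorem fderiv_apply_eq_circleIntegral {f : E → ℂ} {z v : E} {δ : ℝ} (hδ : 0 < δ)
    (hf : ∀ ζ ∈ Metric.closedBall (0 : ℂ) δ, DifferentiableAt ℂ f (z + ζ • v)) :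
    fderiv ℂ f z v =
      (2 * Real.pi * Complex.I)⁻¹ • ∮ ζ in C(0, δ), (1 / (ζ - 0) ^ 2) • f (z + ζ • v) := by
  rw [DifferentiableOn.deriv_eq_smul_circleIntegral hδ fun ζ hζ =>
      (hasDerivAt_add_smul (hf ζ hζ)).differentiableAt.differentiableWithinAt,
    inv_smul_smul₀ Complex.two_pi_I_ne_zero,
    (hasDerivAt_add_smul (hf 0 (Metric.mem_closedBall_self hδ.le))).deriv, zero_smul, add_zero]

theorem exists_ball_norm_fderiv_le {U : Set E} (hU : IsOpen U) {f : E → ℂ}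
    (hf : DifferentiableOn ℂ f U) {z : E} (hz : z ∈ U) :
    ∃ r > 0, Metric.ball z r ⊆ U ∧ ∃ M, ∀ w ∈ Metric.ball z r, ‖fderiv ℂ f w‖ ≤ M := by
  have hnear : ∀ᶠ w in 𝓝 z, w ∈ U ∧ ‖f w‖ < ‖f z‖ + 1 :=
    (hU.eventually_mem hz).and <|
      (hf.differentiableAt (hU.mem_nhds hz)).continuousAt.norm.eventually_lt_const (lt_add_one _)
  obtain ⟨r, hr, hball⟩ := Metric.eventually_nhds_iff_ball.1 hnear
  refine ⟨r / 2, half_pos hr, fun w hw => (hball w (Metric.ball_subset_ball (by linarith) hw)).1,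
    2 * (‖f z‖ + 1) / (r / 2), fun w hw => ?_⟩
  have hsub : Metric.ball w (r / 2) ⊆ Metric.ball z r :=
    Metric.ball_subset_ball' (by linarith [Metric.mem_ball.1 hw])
  refine Complex.norm_fderiv_le_div_of_mapsTo_ball (hf.mono fun y hy => (hball y (hsub hy)).1)
    (fun y hy => ?_) (half_pos hr)
  rw [Metric.mem_closedBall, dist_eq_norm]
  linarith [norm_sub_le (f y) (f w), (hball y (hsub hy)).2,
    (hball w (hsub (Metric.mem_ball_self (half_pos hr)))).2]

theorem differentiableAt_circleIntegral_add_smul [FiniteDimensional ℂ E] {U : Set E}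
    {f : E → ℂ} (hf : ∀ w ∈ U, DifferentiableAt ℂ f w) {M : ℝ} (hM : ∀ w ∈ U, ‖fderiv ℂ f w‖ ≤ M)
    {z v : E} {ρ δ : ℝ} (hρ : 0 < ρ) (hδ : 0 ≤ δ)
    (hU : ∀ w ∈ Metric.ball z ρ, ∀ ζ ∈ Metric.sphere (0 : ℂ) δ, w + ζ • v ∈ U) {c : ℂ → ℂ}
    (hc : ContinuousOn c (Metric.sphere 0 δ)) :
    DifferentiableAt ℂ (fun w => ∮ ζ in C(0, δ), c ζ • f (w + ζ • v)) z := by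
  borelize E
  set a : ℝ → ℂ := fun θ => deriv (circleMap 0 δ) θ * c (circleMap 0 δ θ) with ha
  have hsphere : ∀ θ, circleMap 0 δ θ ∈ Metric.sphere (0 : ℂ) δ := circleMap_mem_sphere 0 hδ
  have ha_cont : Continuous a := by
    simp only [ha, deriv_circleMap]
    exact ((continuous_circleMap 0 δ).mul continuous_const).mul
      (hc.comp_continuous (continuous_circleMap 0 δ) hsphere)
  have hpath : ∀ w, Continuous fun θ => w + circleMap 0 δ θ • v := fun w =>
    continuous_const.add ((continuous_circleMap 0 δ).smul continuous_const)
  have hcont : ∀ w ∈ Metric.ball z ρ, Continuous fun θ => a θ * f (w + circleMap 0 δ θ • v) :=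
    fun w hw => ha_cont.mul <| continuous_iff_continuousAt.2 fun θ =>
      ContinuousAt.comp (g := f) (hf _ (hU w hw _ (hsphere θ))).continuousAt
        (hpath w).continuousAt
  simp only [circleIntegral, smul_eq_mul, ← mul_assoc]
  exact (intervalIntegral.hasFDerivAt_integral_of_dominated_of_fderiv_le
    (F' := fun w θ => a θ • fderiv ℂ f (w + circleMap 0 δ θ • v)) (bound := fun θ => ‖a θ‖ * M)
    (Metric.ball_mem_nhds z hρ)
    (eventually_of_mem (Metric.ball_mem_nhds z hρ) fun w hw => (hcont w hw).aestronglyMeasurable)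
    ((hcont z (Metric.mem_ball_self hρ)).intervalIntegrable _ _)
    (ha_cont.measurable.smul
      ((measurable_fderiv ℂ f).comp (hpath z).measurable)).aestronglyMeasurable
    (Eventually.of_forall fun θ _ w hw => by
      rw [norm_smul]
      exact mul_le_mul_of_nonneg_left (hM _ (hU w hw _ (hsphere θ))) (norm_nonneg _))
    ((ha_cont.norm.mul continuous_const).intervalIntegrable _ _)
    (Eventually.of_forall fun θ _ w hw =>
      ((hf _ (hU w hw _ (hsphere θ))).hasFDerivAt.comp w
        ((hasFDerivAt_id w).add_const _)).const_mul (a θ))).differentiableAt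

theorem differentiableOn_fderiv_apply [FiniteDimensional ℂ E] {U : Set E} (hU : IsOpen U)
    {f : E → ℂ} (hf : DifferentiableOn ℂ f U) (v : E) :
    DifferentiableOn ℂ (fun z => fderiv ℂ f z v) U := by
  intro z hz
  obtain ⟨r, hr, hrU, M, hM⟩ := exists_ball_norm_fderiv_le hU hf hz
  have hdiff : ∀ w ∈ Metric.ball z r, DifferentiableAt ℂ f w := fun w hw =>
    hf.differentiableAt (hU.mem_nhds (hrU hw))
  obtain ⟨δ, hδ, hδv⟩ : ∃ δ > 0, δ * ‖v‖ < r / 2 :=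
    ⟨r / 2 / (‖v‖ + 1), by positivity, by
      rw [div_mul_eq_mul_div, div_lt_iff₀ (by positivity)]; nlinarith [norm_nonneg v]⟩
  have hmem : ∀ w ∈ Metric.ball z (r / 2), ∀ ζ ∈ Metric.closedBall (0 : ℂ) δ,
      w + ζ • v ∈ Metric.ball z r := fun w hw ζ hζ => by
    rw [mem_ball_iff_norm] at hw ⊢
    calc ‖w + ζ • v - z‖ = ‖(w - z) + ζ • v‖ := by rw [add_sub_right_comm]
      _ ≤ ‖w - z‖ + ‖ζ‖ * ‖v‖ := (norm_add_le _ _).trans_eq (by rw [norm_smul])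
      _ ≤ ‖w - z‖ + δ * ‖v‖ := by gcongr; exact mem_closedBall_zero_iff.1 hζ
      _ < r := by linarith
  have hcauchy : (fun w => fderiv ℂ f w v) =ᶠ[𝓝 z] fun w => (2 * Real.pi * Complex.I)⁻¹ •
      ∮ ζ in C(0, δ), (1 / (ζ - 0) ^ 2) • f (w + ζ • v) :=
    eventually_of_mem (Metric.ball_mem_nhds z (half_pos hr)) fun w hw =>
      fderiv_apply_eq_circleIntegral hδ fun ζ hζ => hdiff _ (hmem w hw ζ hζ)
  have hkernel : ContinuousOn (fun ζ : ℂ => 1 / (ζ - 0) ^ 2) (Metric.sphere 0 δ) :=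
    continuousOn_const.div ((continuousOn_id.sub continuousOn_const).pow 2) fun ζ hζ =>
      pow_ne_zero 2 (by rw [sub_zero]; exact ne_zero_of_mem_sphere hδ.ne' ⟨ζ, hζ⟩)
  have hint := differentiableAt_circleIntegral_add_smul hdiff hM (half_pos hr) hδ.le
    (fun w hw ζ hζ => hmem w hw ζ (Metric.sphere_subset_closedBall hζ)) hkernel
  exact ((hint.const_smul (2 * Real.pi * Complex.I : ℂ)⁻¹).congr_of_eventuallyEq
    hcauchy).differentiableWithinAt

end DirectionalDerivative

section TaylorPart

variable {n : ℕ} {lam : ℝ} {F : (Fin n → ℂ) → ℂ}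

/-- `m!` times the homogeneous part of degree `m` of the Taylor expansion of `F` at the origin. -/
def taylorPart (m : ℕ) (F : (Fin n → ℂ) → ℂ) (z : Fin n → ℂ) : ℂ :=
  iteratedDeriv m (fun ζ : ℂ => F (ζ • z)) 0

theorem hasDerivAt_slice (hF : DifferentiableOn ℂ F (domain n)) {z : Fin n → ℂ} {ζ : ℂ}
    (hζ : ζ • z ∈ domain n) :
    HasDerivAt (fun ζ : ℂ => F (ζ • z)) (fderiv ℂ F (ζ • z) z) ζ := by
  have hline := hasDerivAt_add_smul (z := 0) (v := z) (ζ := ζ) (f := F)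
  simp only [zero_add] at hline
  exact hline (hF.differentiableAt ((isOpen_domain n).mem_nhds hζ))

theorem differentiableOn_slice (hF : DifferentiableOn ℂ F (domain n)) {z : Fin n → ℂ}
    (hz : z ∈ domain n) :
    DifferentiableOn ℂ (fun ζ : ℂ => F (ζ • z)) (Metric.closedBall 0 1) := fun _ hζ =>
  (hasDerivAt_slice hF (smul_mem_domain hz
    (mem_closedBall_zero_iff.1 hζ))).differentiableAt.differentiableWithinAt

theorem taylorPart_succ (hF : DifferentiableOn ℂ F (domain n)) (m : ℕ) {z : Fin n → ℂ}
    (hz : z ∈ domain n) :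
    taylorPart (m + 1) F z
      = ∑ j, z j * taylorPart m (fun w => fderiv ℂ F w (Pi.single j 1)) z := by
  have hball : Metric.ball (0 : ℂ) 1 ∈ 𝓝 (0 : ℂ) := Metric.ball_mem_nhds _ one_pos
  have hderiv : deriv (fun ζ : ℂ => F (ζ • z)) =ᶠ[𝓝 0]
      fun ζ => ∑ j, z j * fderiv ℂ F (ζ • z) (Pi.single j 1) := by
    filter_upwards [hball] with ζ hζ
    rw [(hasDerivAt_slice hF (smul_mem_domain hz (mem_ball_zero_iff.1 hζ).le)).deriv]
    generalize fderiv ℂ F (ζ • z) = L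
    conv_lhs => rw [pi_eq_sum_univ' z, map_sum]
    simp only [map_smul, smul_eq_mul]
  have hsmooth : ∀ j, ContDiffAt ℂ m
      (fun ζ : ℂ => z j * fderiv ℂ F (ζ • z) (Pi.single j 1)) 0 := fun j =>
    contDiffAt_const.mul (((differentiableOn_slice (differentiableOn_fderiv_apply
      (isOpen_domain n) hF _) hz).mono Metric.ball_subset_closedBall).analyticAt hball).contDiffAt
  simp only [taylorPart]
  rw [iteratedDeriv_succ', Filter.EventuallyEq.iteratedDeriv_eq m hderiv,
    iteratedDeriv_fun_sum fun j _ => hsmooth j]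
  simp only [iteratedDeriv_const_mul_field]

theorem exists_isHomogeneous_eval_eq_taylorPart (m : ℕ) : ∀ {F : (Fin n → ℂ) → ℂ},
    DifferentiableOn ℂ F (domain n) → ∃ P : MvPolynomial (Fin n) ℂ, P.IsHomogeneous m ∧
      ∀ z ∈ domain n, eval z P = taylorPart m F z := by
  induction m with
  | zero => exact fun {F} _ => ⟨C (F 0), isHomogeneous_C _ _, fun z _ => by simp [taylorPart]⟩
  | succ m ih =>
    intro F hF
    choose P hP hPe using fun j : Fin n =>
      ih (differentiableOn_fderiv_apply (isOpen_domain n) hF (Pi.single j 1))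
    refine ⟨∑ j, X j * P j, IsHomogeneous.sum _ _ _ fun j _ => ?_, fun z hz => ?_⟩
    · rw [add_comm]
      exact (isHomogeneous_X ℂ j).mul (hP j)
    · simp only [taylorPart_succ hF m hz, map_sum, map_mul, eval_X, hPe _ z hz]

theorem eq_zero_of_taylorPart_eq_zero (hF : DifferentiableOn ℂ F (domain n))
    (h : ∀ m, ∀ z ∈ domain n, taylorPart m F z = 0) {z : Fin n → ℂ} (hz : z ∈ domain n) :
    F z = 0 := by
  have hlim : Tendsto (fun r : ℝ => (r : ℂ) • z) (𝓝[>] 1) (𝓝 z) := by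
    have hcont : Continuous fun r : ℝ => (r : ℂ) • z := by fun_prop
    simpa using (hcont.tendsto 1).mono_left nhdsWithin_le_nhds
  obtain ⟨r, hr, hr1⟩ := ((hlim.eventually ((isOpen_domain n).mem_nhds hz)).and
    self_mem_nhdsWithin).exists
  have hr0 : (0 : ℝ) < r := one_pos.trans hr1
  have hmem : (r : ℂ)⁻¹ ∈ Metric.ball (0 : ℂ) 1 := by
    rw [mem_ball_zero_iff, norm_inv, Complex.norm_real, Real.norm_of_nonneg hr0.le]
    exact inv_lt_one_of_one_lt₀ hr1
  have htaylor := Complex.hasSum_taylorSeries_on_ball ((differentiableOn_slice hF hr).mono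
    Metric.ball_subset_closedBall) hmem
  have hcoeff : ∀ m, iteratedDeriv m (fun ζ : ℂ => F (ζ • (r : ℂ) • z)) 0 = 0 := fun m => h m _ hr
  simp only [hcoeff, smul_zero] at htaylor
  have hzero := htaylor.unique hasSum_zero
  rwa [smul_smul, inv_mul_cancel₀ (Complex.ofReal_ne_zero.2 hr0.ne'), one_smul] at hzero

theorem integral_circle_conj_pow_mul {f : ℂ → ℂ}
    (hf : DifferentiableOn ℂ f (Metric.closedBall 0 1)) (m : ℕ) :
    ∫ θ in Ioc 0 (2 * Real.pi), conj (Circle.exp θ : ℂ) ^ m * f (Circle.exp θ)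
      = 2 * Real.pi / m.factorial * iteratedDeriv m f 0 := by
  have hcauchy := DifferentiableOn.circleIntegral_one_div_sub_center_pow_smul one_pos m hf
  rw [circleIntegral, intervalIntegral.integral_of_le Real.two_pi_pos.le, smul_eq_mul] at hcauchy
  have hintegrand : ∀ θ : ℝ, deriv (circleMap 0 1) θ •
      (1 / (circleMap 0 1 θ - 0) ^ (m + 1)) • f (circleMap 0 1 θ)
      = Complex.I * (conj (Circle.exp θ : ℂ) ^ m * f (Circle.exp θ)) := fun θ => by
    have hcircle : circleMap 0 1 θ = (Circle.exp θ : ℂ) := by simp [circleMap]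
    have hne : (Circle.exp θ : ℂ) ≠ 0 := Circle.coe_ne_zero _
    rw [deriv_circleMap, hcircle, ← Circle.coe_inv_eq_conj, Circle.coe_inv, smul_eq_mul,
      smul_eq_mul, sub_zero, inv_pow]
    field_simp
    ring
  simp only [hintegrand, integral_const_mul] at hcauchy
  refine mul_left_cancel₀ Complex.I_ne_zero (hcauchy.trans ?_)
  ring

theorem integral_circle_mul_conj_eval (hF : DifferentiableOn ℂ F (domain n)) {m : ℕ}
    {p : MvPolynomial (Fin n) ℂ} (hp : p.IsHomogeneous m) {z : Fin n → ℂ} (hz : z ∈ domain n) :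
    ∫ θ in Ioc 0 (2 * Real.pi),
        F ((Circle.exp θ : ℂ) • z) * conj (eval ((Circle.exp θ : ℂ) • z) p)
      = 2 * Real.pi / m.factorial * (taylorPart m F z * conj (eval z p)) := by
  rw [taylorPart, ← mul_assoc, ← integral_circle_conj_pow_mul (differentiableOn_slice hF hz) m,
    ← integral_mul_const]
  refine integral_congr_ae (Eventually.of_forall fun θ => ?_)
  simp only [eval_smul_of_isHomogeneous hp, map_mul, map_pow]
  ring

theorem integral_comp_of_measurePreserving {Ω Ω' E : Type*} [MeasurableSpace Ω]
    [MeasurableSpace Ω'] [NormedAddCommGroup E] [NormedSpace ℝ E] {μ : Measure Ω}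
    {ν : Measure Ω'} {φ : Ω → Ω'} (hφ : MeasurePreserving φ μ ν) {f : Ω' → E}
    (hf : StronglyMeasurable f) : ∫ x, f (φ x) ∂μ = ∫ x, f x ∂ν := by
  rw [← hφ.map_eq, integral_map hφ.aemeasurable hf.aestronglyMeasurable]

theorem integral_integral_comp_of_measurePreserving {Ω Θ E : Type*} [MeasurableSpace Ω]
    [MeasurableSpace Θ] [NormedAddCommGroup E] [NormedSpace ℝ E] [CompleteSpace E]
    {μ : Measure Ω} [SFinite μ] {κ : Measure Θ} [IsFiniteMeasure κ] {φ : Θ → Ω → Ω}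
    (hφ : Measurable fun x : Ω × Θ => φ x.2 x.1) (hφ_pres : ∀ θ, MeasurePreserving (φ θ) μ μ)
    {f : Ω → E} (hf : StronglyMeasurable f) (hf_int : Integrable f μ) :
    ∫ x, ∫ θ, f (φ θ x) ∂κ ∂μ = κ.real univ • ∫ x, f x ∂μ := by
  have hint : Integrable (Function.uncurry fun x θ => f (φ θ x)) (μ.prod κ) := by
    refine (integrable_prod_iff' (hf.comp_measurable hφ).aestronglyMeasurable).2
      ⟨Eventually.of_forall fun θ => (hφ_pres θ).integrable_comp_of_integrable hf_int, ?_⟩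
    exact (integrable_const (∫ x, ‖f x‖ ∂μ)).congr (Eventually.of_forall fun θ =>
      (integral_comp_of_measurePreserving (hφ_pres θ) hf.norm).symm)
  rw [integral_integral_swap hint]
  simp only [integral_comp_of_measurePreserving (hφ_pres _) hf, integral_const]

theorem integral_taylorPart_mul_conj_eval (hF : DifferentiableOn ℂ F (domain n))
    (hFm : Measurable F) (hF2 : MemLp F 2 (bergmanMeasure n lam)) {m : ℕ}
    {p : MvPolynomial (Fin n) ℂ} (hp : p.IsHomogeneous m) :
    ∫ z, taylorPart m F z * conj (eval z p) ∂bergmanMeasure n lam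
      = m.factorial * ∫ z, F z * conj (eval z p) ∂bergmanMeasure n lam := by
  have hp_cont : Continuous fun z => conj (eval z p) :=
    Complex.continuous_conj.comp p.continuous_eval
  have haction : Measurable fun x : (Fin n → ℂ) × ℝ => (Circle.exp x.2 : ℂ) • x.1 := by fun_prop
  have hfubini := integral_integral_comp_of_measurePreserving
    (κ := volume.restrict (Ioc 0 (2 * Real.pi))) haction
    (fun θ => measurePreserving_circle_smul (lam := lam) (Circle.exp θ))
    (hFm.mul hp_cont.measurable).stronglyMeasurable
    (hF2.integrable_mul (memLp_of_continuous hp_cont 2))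
  simp only [Pi.mul_apply] at hfubini
  rw [integral_congr_ae (ae_mem_domain.mono fun z hz => integral_circle_mul_conj_eval hF hp hz),
    integral_const_mul, measureReal_restrict_apply_univ, Real.volume_real_Ioc_of_le
      Real.two_pi_pos.le, sub_zero, Complex.real_smul] at hfubini
  have hpi : (Real.pi : ℂ) ≠ 0 := Complex.ofReal_ne_zero.2 Real.pi_ne_zero
  have hfac : (m.factorial : ℂ) ≠ 0 := Nat.cast_ne_zero.2 m.factorial_ne_zero
  push_cast at hfubini
  field_simp at hfubini
  exact hfubini

end TaylorPart

section PolynomialClass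

variable {n : ℕ} {lam : ℝ}

/-- The class of a polynomial in the Bergman space. -/
def polynomialClass (n : ℕ) (lam : ℝ) : MvPolynomial (Fin n) ℂ →ₗ[ℂ] bergman n lam where
  toFun p := ⟨(memLp_of_continuous p.continuous_eval 2).toLp _, fun z => eval z p,
    (AnalyticOnNhd.eval_mvPolynomial p).differentiableOn.mono (subset_univ _),
    MemLp.coeFn_toLp _⟩
  map_add' p q := by
    simp only [map_add]
    rfl
  map_smul' c p := by
    simp only [smul_eval]
    rfl

theorem coeFn_polynomialClass (p : MvPolynomial (Fin n) ℂ) :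
    (polynomialClass n lam p : Lp ℂ 2 (bergmanMeasure n lam)) =ᵐ[bergmanMeasure n lam]
      fun z => eval z p :=
  MemLp.coeFn_toLp (memLp_of_continuous p.continuous_eval 2)

theorem inner_polynomialClass {F : bergman n lam} {f : (Fin n → ℂ) → ℂ}
    (hF : (F : Lp ℂ 2 (bergmanMeasure n lam)) =ᵐ[bergmanMeasure n lam] f)
    (p : MvPolynomial (Fin n) ℂ) :
    inner ℂ (polynomialClass n lam p) F
      = ∫ z, f z * conj (eval z p) ∂bergmanMeasure n lam := by
  rw [Submodule.coe_inner, L2.inner_def]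
  refine integral_congr_ae ?_
  filter_upwards [hF, coeFn_polynomialClass p] with z hFz hpz
  rw [hFz, hpz, RCLike.inner_apply]

theorem eval_eq_zero_of_polynomialClass_eq_zero (hn : 2 ≤ n) (hlam : (n : ℝ) - 1 < lam)
    {p : MvPolynomial (Fin n) ℂ} (hp : polynomialClass n lam p = 0) {z : Fin n → ℂ}
    (hz : z ∈ domain n) : eval z p = 0 := by
  refine eqOn_domain_of_ae_eq hn hlam p.continuous_eval.continuousOn
    (g := fun _ => 0) continuousOn_const ((coeFn_polynomialClass p).symm.trans ?_) hz
  rw [hp]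
  exact Lp.coeFn_zero _ _ _

theorem polynomialClass_injective (hn : 2 ≤ n) (hlam : (n : ℝ) - 1 < lam) :
    Function.Injective (polynomialClass n lam) := by
  refine (injective_iff_map_eq_zero _).2 fun p hp => ?_
  obtain ⟨r, hr, hball⟩ := Metric.isOpen_iff.1 (isOpen_domain n) 0 zero_mem_domain
  refine MvPolynomial.funext_set (fun _ => Metric.ball (0 : ℂ) r)
    (fun _ => (infinite_of_mem_nhds 0 (Metric.ball_mem_nhds 0 hr))) fun z hz => ?_
  rw [map_zero]
  refine eval_eq_zero_of_polynomialClass_eq_zero hn hlam hp (hball ?_)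
  rwa [← ball_pi _ hr] at hz

theorem eq_zero_of_inner_polynomialClass_eq_zero (hn : 2 ≤ n) (hlam : (n : ℝ) - 1 < lam)
    {F : bergman n lam} (hF : ∀ p, inner ℂ (polynomialClass n lam p) F = 0) : F = 0 := by
  classical
  obtain ⟨f, hf, hFf⟩ := F.2
  -- Off `domain n` the holomorphic representative may fail to be measurable.
  set g := (domain n).indicator f with hg
  have hgf : EqOn g f (domain n) := fun z hz => indicator_of_mem hz f
  have hg_diff : DifferentiableOn ℂ g (domain n) := hf.congr hgf
  have hg_meas : Measurable g := by
    rw [hg, ← Set.piecewise_eq_indicator]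
    exact hf.continuousOn.measurable_piecewise (g := fun _ => (0 : ℂ)) continuousOn_const
      (isOpen_domain n).measurableSet
  have hFg : (F : Lp ℂ 2 (bergmanMeasure n lam)) =ᵐ[bergmanMeasure n lam] g :=
    hFf.trans (ae_mem_domain.mono fun z hz => (hgf hz).symm)
  have hg_zero : ∀ z ∈ domain n, g z = 0 := fun z hz =>
    eq_zero_of_taylorPart_eq_zero hg_diff (fun m => by
      obtain ⟨P, hP, hP_eval⟩ := exists_isHomogeneous_eval_eq_taylorPart m hg_diff
      suffices polynomialClass n lam P = 0 from fun w hw =>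
        (hP_eval w hw).symm.trans (eval_eq_zero_of_polynomialClass_eq_zero hn hlam this hw)
      rw [← inner_self_eq_zero (𝕜 := ℂ), inner_polynomialClass
          ((coeFn_polynomialClass P).trans (ae_mem_domain.mono hP_eval)),
        integral_taylorPart_mul_conj_eval hg_diff hg_meas
          ((memLp_congr_ae hFg).1 (Lp.memLp (F : Lp ℂ 2 (bergmanMeasure n lam)))) hP,
        ← inner_polynomialClass hFg, hF, mul_zero]) hz
  refine Subtype.ext (Lp.ext (hFg.trans ?_))
  filter_upwards [ae_mem_domain, Lp.coeFn_zero ℂ 2 (bergmanMeasure n lam)] with z hz hz0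
  rw [hg_zero z hz, Submodule.coe_zero, hz0, Pi.zero_apply]

end PolynomialClass

/-! ## Operators that are diagonal with respect to a Hilbert sum -/

section Diagonal

variable {ι H : Type*} [NormedAddCommGroup H] [InnerProductSpace ℂ H] [CompleteSpace H]
  {V : ι → Submodule ℂ H}

/-- `A` acts on each of the subspaces `V k` as a scalar. -/
def IsDiagonal (V : ι → Submodule ℂ H) (A : H →L[ℂ] H) : Prop :=
  ∃ c : ι → ℂ, ∀ k, ∀ F ∈ V k, A F = c k • F

theorem exists_hasSum_of_isHilbertSum
    (hV : IsHilbertSum ℂ (fun k => V k) fun k => (V k).subtypeₗᵢ) (x : H) :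
    ∃ w : ∀ k, V k, HasSum (fun k => (w k : H)) x := by
  refine ⟨hV.linearIsometryEquiv x, ?_⟩
  simpa using hV.hasSum_linearIsometryEquiv_symm (hV.linearIsometryEquiv x)

theorem eq_zero_of_forall_inner_eq_zero
    (hV : IsHilbertSum ℂ (fun k => V k) fun k => (V k).subtypeₗᵢ) {x : H}
    (h : ∀ k, ∀ F ∈ V k, inner ℂ F x = 0) : x = 0 := by
  obtain ⟨w, hw⟩ := exists_hasSum_of_isHilbertSum hV x
  have hinner := hw.mapL (innerSL ℂ x)
  simp only [innerSL_apply_apply, inner_eq_zero_symm.1 (h _ _ (w _).2)] at hinner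
  exact inner_self_eq_zero.1 (hinner.unique hasSum_zero)

theorem isDiagonal_of_inner_eq
    (hV : IsHilbertSum ℂ (fun k => V k) fun k => (V k).subtypeₗᵢ) {A : H →L[ℂ] H}
    (h : ∀ k, ∃ c : ℂ, ∀ F ∈ V k, ∀ l, ∀ G ∈ V l, inner ℂ G (A F) = c * inner ℂ G F) :
    IsDiagonal V A := by
  choose c hc using h
  refine ⟨c, fun k F hF => sub_eq_zero.1 (eq_zero_of_forall_inner_eq_zero hV fun l G hG => ?_)⟩
  rw [inner_sub_right, inner_smul_right, hc k F hF l G hG, sub_self]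

theorem IsDiagonal.star (hV : IsHilbertSum ℂ (fun k => V k) fun k => (V k).subtypeₗᵢ)
    {A : H →L[ℂ] H} (hA : IsDiagonal V A) : IsDiagonal V (star A) := by
  obtain ⟨c, hc⟩ := hA
  refine isDiagonal_of_inner_eq hV fun k => ⟨conj (c k), fun F hF l G hG => ?_⟩
  rw [ContinuousLinearMap.star_eq_adjoint, ContinuousLinearMap.adjoint_inner_right, hc l G hG,
    inner_smul_left]
  rcases eq_or_ne l k with rfl | hlk
  · rfl
  · have horth : inner ℂ G F = 0 := hV.OrthogonalFamily hlk ⟨G, hG⟩ ⟨F, hF⟩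
    rw [horth, mul_zero, mul_zero]

theorem IsDiagonal.mul_comm (hV : IsHilbertSum ℂ (fun k => V k) fun k => (V k).subtypeₗᵢ)
    {A B : H →L[ℂ] H} (hA : IsDiagonal V A) (hB : IsDiagonal V B) : A * B = B * A := by
  obtain ⟨c, hc⟩ := hA
  obtain ⟨d, hd⟩ := hB
  ext x
  obtain ⟨w, hw⟩ := exists_hasSum_of_isHilbertSum hV x
  have hcomm : ∀ k, (A * B) (w k) = (B * A) (w k) := fun k => by
    simp only [mul_apply_eq_comp, hc k _ (w k).2, hd k _ (w k).2, map_smul, smul_comm (c k)]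
  have hAB := hw.mapL (A * B)
  simp only [hcomm] at hAB
  exact hAB.unique (hw.mapL (B * A))

/-- The operators that act on each summand of a Hilbert sum as a scalar. -/
def diagonalOperators (hV : IsHilbertSum ℂ (fun k => V k) fun k => (V k).subtypeₗᵢ) :
    StarSubalgebra ℂ (H →L[ℂ] H) where
  carrier := {A | IsDiagonal V A}
  mul_mem' := fun {A B} ⟨c, hc⟩ ⟨d, hd⟩ => ⟨c * d, fun k F hF => by
    simp only [mul_apply_eq_comp, hd k F hF, map_smul, hc k F hF, smul_smul,
      Pi.mul_apply, mul_comm]⟩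
  add_mem' := fun {A B} ⟨c, hc⟩ ⟨d, hd⟩ => ⟨c + d, fun k F hF => by
    simp only [add_apply, hc k F hF, hd k F hF, add_smul, Pi.add_apply]⟩
  algebraMap_mem' r := ⟨fun _ => r, fun _ _ _ => by
    rw [Algebra.algebraMap_eq_smul_one]
    rfl⟩
  star_mem' hA := hA.star hV

theorem mul_comm_of_mem_cstarAlgebraGenerated
    (hV : IsHilbertSum ℂ (fun k => V k) fun k => (V k).subtypeₗᵢ) {S : Set (H →L[ℂ] H)}
    (hS : ∀ A ∈ S, IsDiagonal V A) {A B : H →L[ℂ] H} (hA : A ∈ cstarAlgebraGenerated S)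
    (hB : B ∈ cstarAlgebraGenerated S) : A * B = B * A := by
  have hdiag : StarAlgebra.adjoin ℂ S ≤ diagonalOperators hV := StarAlgebra.adjoin_le hS
  have hcomm : ∀ A B : StarAlgebra.adjoin ℂ S, A * B = B * A := fun A B =>
    Subtype.ext (IsDiagonal.mul_comm hV (hdiag A.2) (hdiag B.2))
  exact congrArg Subtype.val (((StarAlgebra.adjoin ℂ S).commRingTopologicalClosure hcomm).mul_comm
    ⟨A, hA⟩ ⟨B, hB⟩)

end Diagonal

theorem exists_mem_ne_zero_inner_eq_mul_inner {H : Type*} [NormedAddCommGroup H]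
    [InnerProductSpace ℂ H] {W : Submodule ℂ H} [FiniteDimensional ℂ W] (hW : W ≠ ⊥)
    (A : H →L[ℂ] H) :
    ∃ c : ℂ, ∃ x ∈ W, x ≠ 0 ∧ ∀ y ∈ W, inner ℂ y (A x) = c * inner ℂ y x := by
  have := Submodule.nontrivial_iff_ne_bot.2 hW
  obtain ⟨c, hc⟩ := Module.End.exists_eigenvalue
    (W.orthogonalProjectionOnto ∘L A ∘L W.subtypeL).toLinearMap
  obtain ⟨x, hx⟩ := hc.exists_hasEigenvector
  refine ⟨c, x, x.2, fun h => hx.2 (Subtype.ext h), fun y hy => ?_⟩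
  have hproj : W.orthogonalProjectionOnto (A x) = c • x := hx.apply_eq_smul
  rw [← Submodule.inner_orthogonalProjectionOnto_eq_of_mem_left (⟨y, hy⟩ : W) (A x), hproj,
    Submodule.coe_inner, Submodule.coe_smul, inner_smul_right]

/-! ## Toeplitz operators with invariant symbols -/

variable {n : ℕ} {lam : ℝ}

theorem mem_component_iff {k : ℕ × ℕ} {F : bergman n lam} : F ∈ component n lam k ↔
    ∃ p ∈ harmonicPoly n k.1, polynomialClass n lam (p * quad n ^ k.2) = F := by
  refine exists_congr fun p => and_congr_right fun _ => ?_
  have hp := coeFn_polynomialClass (lam := lam) (p * quad n ^ k.2)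
  simp only [map_mul, map_pow, eval_quad] at hp
  exact ⟨fun hF => Subtype.ext (Lp.ext (hp.trans hF.symm)), by rintro rfl; exact hp⟩

instance finiteDimensional_component (k : ℕ × ℕ) : FiniteDimensional ℂ (component n lam k) := by
  have hmap : component n lam k = (harmonicPoly n k.1).map
      (polynomialClass n lam ∘ₗ LinearMap.mulRight ℂ (quad n ^ k.2)) := by
    ext F
    exact mem_component_iff
  rw [hmap]
  infer_instance

/-- The matrix of `A` on the polynomials, as a sesquilinear form. -/
def operatorForm (A : bergman n lam →L[ℂ] bergman n lam) :
    MvPolynomial (Fin n) ℂ →ₗ⋆[ℂ] MvPolynomial (Fin n) ℂ →ₗ[ℂ] ℂ :=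
  ((innerₛₗ ℂ).comp (polynomialClass n lam)).compl₂ (A.toLinearMap ∘ₗ polynomialClass n lam)

theorem operatorForm_apply (A : bergman n lam →L[ℂ] bergman n lam)
    (p q : MvPolynomial (Fin n) ℂ) :
    operatorForm A p q = inner ℂ (polynomialClass n lam p) (A (polynomialClass n lam q)) := rfl

/-- `A` is the compression to the Bergman space of the multiplication by a bounded invariant
function, as far as its matrix on the polynomials is concerned. Both the identity and the Toeplitz
operators with invariant symbols are of this form. -/
def HasInvariantSymbol (A : bergman n lam →L[ℂ] bergman n lam) : Prop :=
  ∃ b : (Fin n → ℂ) → ℂ, MemLp b ⊤ (bergmanMeasure n lam) ∧ IsInvariantSymbol b ∧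
    ∀ p q, operatorForm A p q
      = ∫ z, b z * (conj (eval z p) * eval z q) ∂bergmanMeasure n lam

theorem hasInvariantSymbol_one :
    HasInvariantSymbol (1 : bergman n lam →L[ℂ] bergman n lam) :=
  ⟨fun _ => 1, memLp_const 1, fun _ _ _ _ => rfl, fun p q => by
    simp only [operatorForm_apply, one_apply_eq_self, one_mul,
      inner_polynomialClass (coeFn_polynomialClass q), mul_comm]⟩

theorem hasInvariantSymbol_toeplitz {a : Lp ℂ ⊤ (bergmanMeasure n lam)} {b : (Fin n → ℂ) → ℂ}
    (hab : a =ᵐ[bergmanMeasure n lam] b) (hb : IsInvariantSymbol b) :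
    HasInvariantSymbol (toeplitz a) := by
  refine ⟨b, (memLp_congr_ae hab).1 (Lp.memLp a), hb, fun p q => ?_⟩
  rw [operatorForm_apply, toeplitz, ContinuousLinearMap.comp_apply,
    Submodule.inner_orthogonalProjectionOnto_eq_of_mem_left, L2.inner_def]
  refine integral_congr_ae ?_
  have hmul : mulOp a (polynomialClass n lam q) =ᵐ[bergmanMeasure n lam]
      fun z => a z * (polynomialClass n lam q : Lp ℂ 2 (bergmanMeasure n lam)) z :=
    (ContinuousLinearMap.mul ℂ ℂ).coeFn_holder a _
  filter_upwards [hmul, hab, coeFn_polynomialClass p, coeFn_polynomialClass q]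
    with z hmul hab hp hq
  rw [ContinuousLinearMap.comp_apply, Submodule.subtypeL_apply, hmul, hab, hp, hq,
    RCLike.inner_apply]
  ring

theorem HasInvariantSymbol.rotInvariant_operatorForm {A : bergman n lam →L[ℂ] bergman n lam}
    (hA : HasInvariantSymbol A) : RotInvariant (operatorForm A) := by
  obtain ⟨b, hb, hinv, hA⟩ := hA
  intro i j p q
  rw [hA, hA, hinv.integral_rot_mul hb]

theorem HasInvariantSymbol.inner_eq_zero_of_ne (hn : 2 ≤ n)
    {A : bergman n lam →L[ℂ] bergman n lam} (hA : HasInvariantSymbol A) {k l : ℕ × ℕ}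
    (hkl : k ≠ l) {F G : bergman n lam} (hF : F ∈ component n lam k)
    (hG : G ∈ component n lam l) : inner ℂ F (A G) = 0 := by
  obtain ⟨p, hp, rfl⟩ := mem_component_iff.1 hF
  obtain ⟨q, hq, rfl⟩ := mem_component_iff.1 hG
  rw [← operatorForm_apply]
  by_cases hdeg : k.1 + 2 * k.2 = l.1 + 2 * l.2
  · have hfst : k.1 ≠ l.1 := fun h => hkl (Prod.ext h (by omega))
    exact hA.rotInvariant_operatorForm.apply_mul_quad_pow_eq_zero hn hfst hp hq _ _
  · obtain ⟨b, hb, hinv, hA⟩ := hA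
    rw [hA]
    exact hinv.integral_eq_zero_of_degree_ne hb hdeg
      ((mem_harmonicPoly.1 hp).1.mul ((isHomogeneous_quad n).pow k.2))
      ((mem_harmonicPoly.1 hq).1.mul ((isHomogeneous_quad n).pow l.2))

theorem isHilbertSum_component (hn : 2 ≤ n) (hlam : (n : ℝ) - 1 < lam) :
    IsHilbertSum ℂ (fun k => component n lam k) fun k => (component n lam k).subtypeₗᵢ := by
  have (k : ℕ × ℕ) : CompleteSpace (component n lam k) := FiniteDimensional.complete ℂ _
  refine IsHilbertSum.mkInternal _ (fun k l hkl F G =>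
    hasInvariantSymbol_one.inner_eq_zero_of_ne hn hkl F.2 G.2) (top_le_iff.2 ?_)
  rw [Submodule.topologicalClosure_eq_top_iff, Submodule.eq_bot_iff]
  intro F hF
  have htop := eq_top_of_harmonicPoly_mul_quad_pow_mem (n := n) (by omega)
    (W := (ℂ ∙ F)ᗮ.comap (polynomialClass n lam)) fun k m h hh =>
      Submodule.mem_orthogonal_singleton_iff_inner_left.2 <| hF _ <|
        Submodule.mem_iSup_of_mem (k, m) (mem_component_iff.2 ⟨h, hh, rfl⟩)
  exact eq_zero_of_inner_polynomialClass_eq_zero hn hlam fun p =>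
    Submodule.mem_orthogonal_singleton_iff_inner_left.1 (htop.ge (Submodule.mem_top (x := p)))

theorem HasInvariantSymbol.exists_inner_eq_mul_inner (hn : 3 ≤ n) (hlam : (n : ℝ) - 1 < lam)
    {A : bergman n lam →L[ℂ] bergman n lam} (hA : HasInvariantSymbol A) (k : ℕ × ℕ) :
    ∃ c : ℂ, ∀ F ∈ component n lam k, ∀ G ∈ component n lam k,
      inner ℂ G (A F) = c * inner ℂ G F := by
  by_cases hbot : component n lam k = ⊥
  · simp [hbot]
  obtain ⟨c, F₀, hF₀, hne, heig⟩ := exists_mem_ne_zero_inner_eq_mul_inner hbot A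
  obtain ⟨p₀, hp₀, rfl⟩ := mem_component_iff.1 hF₀
  have hgram := hasInvariantSymbol_one.rotInvariant_operatorForm (n := n) (lam := lam)
  have haniso : ∀ p ∈ harmonicPoly n k.1,
      operatorForm (1 : bergman n lam →L[ℂ] bergman n lam) (p * quad n ^ k.2)
        (p * quad n ^ k.2) = 0 → p = 0 := fun p _ hp => by
    have hmul : p * quad n ^ k.2 = 0 :=
      (map_eq_zero_iff _ (polynomialClass_injective (by omega) hlam)).1 (inner_self_eq_zero.1 hp)
    exact (mul_eq_zero.1 hmul).resolve_right (pow_ne_zero _ (quad_ne_zero (by omega)))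
  refine ⟨c, fun F hF G hG => ?_⟩
  obtain ⟨p, hp, rfl⟩ := mem_component_iff.1 hG
  obtain ⟨q, hq, rfl⟩ := mem_component_iff.1 hF
  -- Schur: the form of `A - c` on the irreducible space `harmonicPoly n k.1` is invariant and has
  -- a nontrivial kernel, so it vanishes.
  exact sub_eq_zero.1 <| (hgram.compl_mul_quad_pow k.2).apply_eq_zero_of_exists hn haniso
    ((hA.rotInvariant_operatorForm.sub_smul hgram c).compl_mul_quad_pow k.2)
    ⟨p₀, hp₀, by rintro rfl; simp at hne, fun p hp =>
      sub_eq_zero.2 (heig _ (mem_component_iff.2 ⟨p, hp, rfl⟩))⟩ hp hq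

theorem HasInvariantSymbol.isDiagonal (hn : 3 ≤ n) (hlam : (n : ℝ) - 1 < lam)
    {A : bergman n lam →L[ℂ] bergman n lam} (hA : HasInvariantSymbol A) :
    IsDiagonal (component n lam) A := by
  have hn2 : 2 ≤ n := by omega
  refine isDiagonal_of_inner_eq (isHilbertSum_component hn2 hlam) fun k => ?_
  obtain ⟨c, hc⟩ := hA.exists_inner_eq_mul_inner hn hlam k
  refine ⟨c, fun F hF l G hG => ?_⟩
  rcases eq_or_ne l k with rfl | hlk
  · exact hc F hF G hG
  · have horth := hasInvariantSymbol_one.inner_eq_zero_of_ne hn2 hlk hG hF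
    rw [one_apply_eq_self] at horth
    rw [hA.inner_eq_zero_of_ne hn2 hlk hG hF, horth, mul_zero]

theorem IsMomentMapSO2.isInvariantSymbol (hn : n ≠ 0) {μ : (Fin n → ℂ) → ℝ}
    (hμ : IsMomentMapSO2 n μ) (f : ℝ → ℂ) : IsInvariantSymbol fun z => f (μ z) := by
  obtain ⟨c, hc⟩ := hμ.exists_eq_add hn
  intro e he z hz
  simp only [hc _ hz, hc _ (he.mem_domain_iff.2 hz), momentMapSO2, he.absSq_apply,
    he.norm_dot_apply]

end CartanIV

end

theorem theorem5p1 (n : ℕ) (hn : 3 ≤ n) (lam : ℝ) (hlam : (n : ℝ) - 1 < lam) :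
    IsMomentMapSO2 n (momentMapSO2 n) ∧
    IsHilbertSum ℂ (fun k : ℕ × ℕ => component n lam k)
      (fun k => (component n lam k).subtypeₗᵢ) ∧
    ∀ μ : (Fin n → ℂ) → ℝ, IsMomentMapSO2 n μ →
      (∀ S ∈ toeplitzAlgebra (momentMapSymbols n lam μ),
        ∀ T ∈ toeplitzAlgebra (momentMapSymbols n lam μ), S * T = T * S) ∧
      ∀ f : ℝ → ℂ, Measurable f →
        ∀ hf : MemLp (fun z => f (μ z)) ⊤ (bergmanMeasure n lam),
          (∀ k : ℕ × ℕ, ∀ F ∈ component n lam k, toeplitz (hf.toLp _) F ∈ component n lam k) ∧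
          ∃ c : ℕ × ℕ → ℂ, ∀ k : ℕ × ℕ, ∀ F ∈ component n lam k,
            toeplitz (hf.toLp _) F = c k • F := by
  have hn0 : n ≠ 0 := by omega
  have hsum := isHilbertSum_component (by omega : 2 ≤ n) hlam
  have hdiag : ∀ μ, IsMomentMapSO2 n μ → ∀ (f : ℝ → ℂ) (a : Lp ℂ ⊤ (bergmanMeasure n lam)),
      (a =ᵐ[bergmanMeasure n lam] fun z => f (μ z)) → IsDiagonal (component n lam) (toeplitz a) :=
    fun μ hμ f a haf =>
      (hasInvariantSymbol_toeplitz haf (hμ.isInvariantSymbol hn0 f)).isDiagonal hn hlam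
  refine ⟨isMomentMapSO2_momentMapSO2 hn0, hsum,
    fun μ hμ => ⟨fun S hS T hT => ?_, fun f _ hf => ?_⟩⟩
  · refine mul_comm_of_mem_cstarAlgebraGenerated hsum ?_ hS hT
    rintro _ ⟨a, ⟨f, -, haf⟩, rfl⟩
    exact hdiag μ hμ f a haf
  · obtain ⟨c, hc⟩ := hdiag μ hμ f _ (MemLp.coeFn_toLp hf)
    refine ⟨fun k F hF => ?_, c, hc⟩
    rw [hc k F hF]
    exact Submodule.smul_mem _ _ hF
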